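/- Let $M$ be a smooth manifold of dimension $n\ge 3$, let $\alpha=\sqrt{a_{ij}(x)y^iy^j}$ and $\bar\alpha=\sqrt{\bar a_{ij}(x)y^iy^j}$ be two Riemannian metrics on $M$, and let $\beta=b_i(x)y^i$ and $\bar\beta=\bar b_i(x)y^i$ be two nowhere vanishing smooth $1$-forms on $M$ that are collinear at every point, with $\|\beta\|_\alpha<1$. Consider the metric $F=(\alpha+\beta)^2/\alpha$, defined on all nonzero tangent vectors, and the Kropina metric $\bar F=\bar\alpha^2/\bar\beta$, defined on the tangent vectors with $\bar\beta>0$. Conventions. The spray coefficients of a metric $F$ with fundamental tensor $g_{ij}=\frac12\partial^2F^2/\partial y^i\partial y^j$ are $G^i=\frac14 g^{il}\{\frac{\partial^2F^2}{\partial x^k\partial y^l}y^k-\frac{\partial F^2}{\partial x^l}\}$; $G^i_\alpha$ and $\bar G^i_{\bar\alpha}$ are those of $\alpha$ and $\bar\alpha$. $F$ and $\bar F$ are projectively related if there is a scalar function $P(x,y)$ with $G^i=\bar G^i+Py^i$ in all local coordinates, wherever both metrics are defined. A metric is a Douglas metric if its Douglas tensor $D^i_{jkl}=\frac{\partial^3}{\partial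 y^j\partial y^k\partial y^l}\big(G^i-\frac1{n+1}\frac{\partial G^m}{\partial y^m}y^i\big)$ vanishes on its domain. Let $b_{i|j}$ be the covariant derivative of $\beta$ with respect to the Levi-Civita connection of $\alpha$, $b^i=a^{ij}b_j$ and $b^2=b^ib_i$. Similarly, with respect to $\bar\alpha$, put $\bar b^i=\bar a^{ij}\bar b_j$, $\bar b^2=\bar b^i\bar b_i$, $\bar r_{00}=\bar r_{ij}y^iy^j$ with $\bar r_{ij}=\frac12(\bar b_{i|j}+\bar b_{j|i})$, $\bar s_{ij}=\frac12(\bar b_{i|j}-\bar b_{j|i})$, $\bar s_j=\bar b^i\bar s_{ij}$ and $\bar s^i=\bar a^{ij}\bar s_j$. Then: (a) $F$ is a Douglas metric if and only if there is a smooth function $\tau=\tau(x)$ on $M$ such that $$b_{i|j}=2\tau\big[(1+2b^2)a_{ij}-3b_ib_j\big].\qquad(*)$$ (b) $F$ is projectively related to $\bar F$ if and only if both $F$ and $\bar F$ are Douglas metrics and there are a smooth function $\tau$ on $M$ satisfying $(*)$ and a smooth $1$-form $\theta=\theta_i(x)y^i$ on $M$ such that, for all tangent vectors $y$, $$G^i_\alpha-\bar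 G^i_{\bar\alpha}=\frac{1}{2\bar b^2}\big(\bar\alpha^2\bar s^i+\bar r_{00}\bar b^i\big)+\theta y^i-2\tau\alpha^2b^i .$$ -/

import Mathlib

open scoped Manifold ContDiff Bundle

noncomputable section

namespace ProjFinsler

/-- The coordinate space `ℝⁿ`. -/
abbrev Coord (n : ℕ) := EuclideanSpace ℝ (Fin n)

section Local

/-! ### Formulas in local coordinates

`x` denotes the coordinates of a point and `y` the components of a tangent vector at that point. -/

variable {n : ℕ}

/-- The partial derivative `∂f/∂uʲ` at the point `u`. -/
def pd (f : Coord n → ℝ) (j : Fin n) (u : Coord n) : ℝ :=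
  fderiv ℝ f u (EuclideanSpace.single j 1)

/-- The fundamental tensor `g_ij = (1/2) ∂²(F²)/∂yⁱ∂yʲ`. -/
def fundTensor (F : Coord n → Coord n → ℝ) (x y : Coord n) : Matrix (Fin n) (Fin n) ℝ :=
  Matrix.of fun i j => (1 / 2) * pd (fun v => pd (fun w => F x w ^ 2) i v) j y

/-- The spray coefficients
`Gⁱ = (1/4) gⁱˡ (∂²(F²)/∂xᵏ∂yˡ yᵏ - ∂(F²)/∂xˡ)`. -/
def sprayCoeff (F : Coord n → Coord n → ℝ) (i : Fin n) (x y : Coord n) : ℝ :=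
  (1 / 4) * ∑ l, (fundTensor F x y)⁻¹ i l *
    ((∑ k, pd (fun u => pd (fun w => F u w ^ 2) l y) k x * y k)
      - pd (fun u => F u y ^ 2) l x)

/-- The Douglas tensor
`Dⁱ_jkl = ∂³/∂yʲ∂yᵏ∂yˡ (Gⁱ - 1/(n+1) ∂Gᵐ/∂yᵐ yⁱ)`. -/
def douglasTensor (F : Coord n → Coord n → ℝ) (i j k l : Fin n) (x y : Coord n) : ℝ :=
  pd (fun y₁ => pd (fun y₂ => pd (fun y₃ =>
    sprayCoeff F i x y₃ - 1 / ((n : ℝ) + 1) * (∑ m, pd (sprayCoeff F m x) m y₃) * y₃ i)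
    l y₂) k y₁) j y

/-- The Christoffel symbols `Γᵏ_ij` of the Levi-Civita connection of `a_ij`. -/
def christoffel (a : Coord n → Matrix (Fin n) (Fin n) ℝ) (k i j : Fin n) (x : Coord n) : ℝ :=
  (1 / 2) * ∑ l, (a x)⁻¹ k l *
    (pd (fun u => a u l j) i x + pd (fun u => a u l i) j x - pd (fun u => a u i j) l x)

/-- The covariant derivative `b_{i|j} = ∂b_i/∂xʲ - Γᵏ_ij b_k`. -/
def covDeriv (a : Coord n → Matrix (Fin n) (Fin n) ℝ) (b : Coord n → Fin n → ℝ)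
    (i j : Fin n) (x : Coord n) : ℝ :=
  pd (fun u => b u i) j x - ∑ k, christoffel a k i j x * b x k

/-- `r_ij = (b_{i|j} + b_{j|i}) / 2`. -/
def rTensor (a : Coord n → Matrix (Fin n) (Fin n) ℝ) (b : Coord n → Fin n → ℝ)
    (i j : Fin n) (x : Coord n) : ℝ :=
  (1 / 2) * (covDeriv a b i j x + covDeriv a b j i x)

/-- `s_ij = (b_{i|j} - b_{j|i}) / 2`. -/
def sTensor (a : Coord n → Matrix (Fin n) (Fin n) ℝ) (b : Coord n → Fin n → ℝ)
    (i j : Fin n) (x : Coord n) : ℝ :=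
  (1 / 2) * (covDeriv a b i j x - covDeriv a b j i x)

/-- `bⁱ = aⁱʲ b_j`. -/
def raise (a : Coord n → Matrix (Fin n) (Fin n) ℝ) (b : Coord n → Fin n → ℝ)
    (i : Fin n) (x : Coord n) : ℝ :=
  ∑ j, (a x)⁻¹ i j * b x j

/-- `b² = aⁱʲ b_i b_j`, the squared norm of the one-form. -/
def normSq (a : Coord n → Matrix (Fin n) (Fin n) ℝ) (b : Coord n → Fin n → ℝ)
    (x : Coord n) : ℝ :=
  ∑ i, raise a b i x * b x i

/-- `r₀₀ = r_ij yⁱ yʲ`. -/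
def rZeroZero (a : Coord n → Matrix (Fin n) (Fin n) ℝ) (b : Coord n → Fin n → ℝ)
    (x y : Coord n) : ℝ :=
  ∑ i, ∑ j, rTensor a b i j x * y i * y j

/-- `s_j = bⁱ s_ij`. -/
def sCovector (a : Coord n → Matrix (Fin n) (Fin n) ℝ) (b : Coord n → Fin n → ℝ)
    (x : Coord n) (j : Fin n) : ℝ :=
  ∑ i, raise a b i x * sTensor a b i j x

end Local

section Global

/-! ### Objects on a smooth manifold `M` of dimension `n` -/

variable {n : ℕ} {M : Type*} [TopologicalSpace M] [ChartedSpace (Coord n) M]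

/-- The expression of a function of tangent vectors in the coordinates `(u, v)` of the tangent
bundle induced by a chart `e`. -/
def inChart (e : OpenPartialHomeomorph M (Coord n)) (F : ∀ x : M, TangentSpace (𝓡 n) x → ℝ)
    (u v : Coord n) : ℝ :=
  F (e.symm u) (mfderiv (𝓡 n) (𝓡 n) e.symm u v)

/-- The set of nonzero tangent vectors at `x`. -/
def nonzeroVec (x : M) : Set (TangentSpace (𝓡 n) x) := {y | y ≠ 0}

/-- `F` and `F'`, with conic domains `A` and `A'`, are projectively related: there is a scalar
function `P` with `Gⁱ = G'ⁱ + P yⁱ` in all local coordinates, wherever both metrics are defined. -/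
def ProjectivelyRelated (F : ∀ x : M, TangentSpace (𝓡 n) x → ℝ)
    (A : ∀ x : M, Set (TangentSpace (𝓡 n) x))
    (F' : ∀ x : M, TangentSpace (𝓡 n) x → ℝ) (A' : ∀ x : M, Set (TangentSpace (𝓡 n) x)) : Prop :=
  ∃ P : ∀ x : M, TangentSpace (𝓡 n) x → ℝ,
    ∀ e ∈ IsManifold.maximalAtlas (𝓡 n) ∞ M, ∀ u ∈ e.target, ∀ v : Coord n,
      mfderiv (𝓡 n) (𝓡 n) e.symm u v ∈ A (e.symm u) ∩ A' (e.symm u) →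
      ∀ i, sprayCoeff (inChart e F) i u v
        = sprayCoeff (inChart e F') i u v + inChart e P u v * v i

/-- `F`, with conic domain `A`, is a Douglas metric: its Douglas tensor vanishes. -/
def IsDouglas (F : ∀ x : M, TangentSpace (𝓡 n) x → ℝ)
    (A : ∀ x : M, Set (TangentSpace (𝓡 n) x)) : Prop :=
  ∀ e ∈ IsManifold.maximalAtlas (𝓡 n) ∞ M, ∀ u ∈ e.target, ∀ v : Coord n,
    mfderiv (𝓡 n) (𝓡 n) e.symm u v ∈ A (e.symm u) →
    ∀ i j k l, douglasTensor (inChart e F) i j k l u v = 0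

variable [IsManifold (𝓡 n) ∞ M]

variable (n M) in
/-- Smooth Riemannian metrics on `M`. -/
abbrev Metric :=
  Bundle.ContMDiffRiemannianMetric (𝓡 n) ∞ (Coord n) (fun x : M => TangentSpace (𝓡 n) x)

variable (n M) in
/-- Smooth one-forms on `M`: smooth sections of the cotangent bundle. -/
abbrev OneForm :=
  ContMDiffSection (𝓡 n) (Coord n →L[ℝ] ℝ) ∞
    (fun x : M => TangentSpace (𝓡 n) x →L[ℝ] Bundle.Trivial M ℝ x)

/-- The value `β_x(y)` of a one-form. -/
def formFn (β : OneForm n M) (x : M) (y : TangentSpace (𝓡 n) x) : ℝ := β x y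

/-- The Riemannian norm `α(x, y) = √(a_ij(x) yⁱ yʲ)`. -/
def alphaFn (α : Metric n M) (x : M) (y : TangentSpace (𝓡 n) x) : ℝ :=
  Real.sqrt (α.inner x y y)

/-- The metric `(α + β)² / α`. -/
def berwaldFn (α : Metric n M) (β : OneForm n M) (x : M) (y : TangentSpace (𝓡 n) x) : ℝ :=
  (alphaFn α x y + formFn β x y) ^ 2 / alphaFn α x y

/-- The Kropina metric `α² / β`. -/
def kropinaFn (α : Metric n M) (β : OneForm n M) (x : M) (y : TangentSpace (𝓡 n) x) : ℝ :=
  alphaFn α x y ^ 2 / formFn β x y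

/-- The conic domain `β > 0` of the Kropina metric `α² / β`. -/
def kropinaDomain (β : OneForm n M) (x : M) : Set (TangentSpace (𝓡 n) x) :=
  {y | 0 < formFn β x y}

/-- The components `a_ij` of a Riemannian metric in the chart `e`. -/
def metricCoeff (e : OpenPartialHomeomorph M (Coord n)) (α : Metric n M) (u : Coord n) :
    Matrix (Fin n) (Fin n) ℝ :=
  Matrix.of fun i j => α.inner (e.symm u)
    (mfderiv (𝓡 n) (𝓡 n) e.symm u (EuclideanSpace.single i 1))
    (mfderiv (𝓡 n) (𝓡 n) e.symm u (EuclideanSpace.single j 1))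

/-- The components `b_i` of a one-form in the chart `e`. -/
def formCoeff (e : OpenPartialHomeomorph M (Coord n)) (β : OneForm n M) (u : Coord n)
    (i : Fin n) : ℝ :=
  inChart e (formFn β) u (EuclideanSpace.single i 1)

/-- The identity `b_{i|j} = 2 τ ((1 + 2 b²) a_ij - 3 b_i b_j)` in all local coordinates. -/
def CovDerivIdentity (α : Metric n M) (β : OneForm n M) (τ : M → ℝ) : Prop :=
  ∀ e ∈ IsManifold.maximalAtlas (𝓡 n) ∞ M, ∀ u ∈ e.target, ∀ i j,
    covDeriv (metricCoeff e α) (formCoeff e β) i j u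
      = 2 * τ (e.symm u) *
        ((1 + 2 * normSq (metricCoeff e α) (formCoeff e β) u) * metricCoeff e α u i j
          - 3 * formCoeff e β u i * formCoeff e β u j)

/-- The relation
`G_αⁱ - G_α'ⁱ = (α'² s'ⁱ + r'₀₀ b'ⁱ) / (2 b'²) + θ yⁱ - 2 τ α² bⁱ` in all local coordinates. -/
def SprayRelation (α : Metric n M) (β : OneForm n M) (α' : Metric n M) (β' : OneForm n M)
    (τ : M → ℝ) (θ : OneForm n M) : Prop :=
  ∀ e ∈ IsManifold.maximalAtlas (𝓡 n) ∞ M, ∀ u ∈ e.target, ∀ (v : Coord n) (i : Fin n),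
    sprayCoeff (inChart e (alphaFn α)) i u v - sprayCoeff (inChart e (alphaFn α')) i u v
      = 1 / (2 * normSq (metricCoeff e α') (formCoeff e β') u) *
          (inChart e (alphaFn α') u v ^ 2
              * raise (metricCoeff e α') (sCovector (metricCoeff e α') (formCoeff e β')) i u
            + rZeroZero (metricCoeff e α') (formCoeff e β') u v
              * raise (metricCoeff e α') (formCoeff e β') i u)
        + inChart e (formFn θ) u v * v i
        - 2 * τ (e.symm u) * inChart e (alphaFn α) u v ^ 2
          * raise (metricCoeff e α) (formCoeff e β) i u

end Global

end ProjFinsler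

end

open ProjFinsler

open ProjFinsler

namespace ProjFinsler

noncomputable section

open Filter Topology Matrix

variable {n : ℕ}

/-! ### Coordinate partial derivatives: rules, and values on linear and quadratic forms. -/

section Calculus

/-! Write A = α², B = β, T^i = s^i_0 and Δ = (1 + 2b²)A − 3B². The condition ‖β‖ < 1 and
Cauchy–Schwarz make Δ positive on nonzero vectors. Solving for the spray of a metric with F² = f(A,
B) (`sprayCoeff_alphaBeta`) gives explicit formulas for both metrics. A vanishing Douglas tensor
means that the spray is polynomial up to a multiple of y: one direction is Euler's identity, the
other is integration over a convex cone (`douglasTensor_eq_zero`,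
`exists_quadratic_of_douglasTensor_eq_zero`).

For F = (α+β)²/α, suppose that the spray is polynomial modulo y on some open set. Wedging with y
removes the unknown multiple, and clearing denominators gives U + √A·V = 0 with U, V polynomial. As
√A is not a quotient of polynomials in at least two variables, V = 0. Contracting V = 0 with y and
with b gives s_0(A − B²) = 0, so s_0 = 0 and then s_ij = 0. What remains says that Δ divides
A·r_00·(b ∧ y). At suitable complex zeros of Δ the factors A and b ∧ y do not vanish, so r_00 does,
and r_00 = 2τΔ. This is (*); see `berwald_core`. Conversely (*) turns the spray into G_α + 2τα²b +
2τ(α − 2β)y.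

For the Kropina metric the only obstruction is a pole along β̄ = 0. If its spray agrees modulo y
with something continuous across that hyperplane, then T̄ − (s̄_0/b̄²)b̄ is parallel to y there. It
is also orthogonal to y, hence zero, and s̄_ij = (b̄_i s̄_j − b̄_j s̄_i)/b̄² follows
(`kropinaCond_of_sprayCoeff_eq`). Under this condition the poles cancel, so the spray is quadratic
modulo y. The argument applies when F̄ is Douglas, and also when F̄ is projectively related to F,
because the spray of F is smooth at all nonzero vectors. In the second case the spray of F becomes
polynomial modulo y on β̄ > 0, and (*) follows from the previous paragraph.

With both normal forms, projective relatedness says that explicit quadratic forms Q^i satisfy Q^i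
y^j = Q^j y^i. Such Q^i equal θy^i for a linear form θ (`quadratic_eq_linear_mul`), which is the
relation between G_α and Ḡ_ᾱ.

All this is pointwise in a chart. Globally, τ is determined by r_00 = 2τΔ, and θ by scalars on the
tangent bundle, so both agree on chart overlaps and are smooth. -/

theorem pd_congr {f g : Coord n → ℝ} {u : Coord n} (h : f =ᶠ[𝓝 u] g) (j : Fin n) :
    pd f j u = pd g j u := by
  simp only [pd, h.fderiv_eq]

theorem pd_const (c : ℝ) (j : Fin n) (u : Coord n) : pd (fun _ => c) j u = 0 := by
  simp [pd]

theorem pd_add {f g : Coord n → ℝ} {u : Coord n} (hf : DifferentiableAt ℝ f u)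
    (hg : DifferentiableAt ℝ g u) (j : Fin n) :
    pd (fun v => f v + g v) j u = pd f j u + pd g j u := by
  simp [pd, fderiv_fun_add hf hg]

theorem pd_sub {f g : Coord n → ℝ} {u : Coord n} (hf : DifferentiableAt ℝ f u)
    (hg : DifferentiableAt ℝ g u) (j : Fin n) :
    pd (fun v => f v - g v) j u = pd f j u - pd g j u := by
  simp [pd, fderiv_fun_sub hf hg]

theorem pd_mul {f g : Coord n → ℝ} {u : Coord n} (hf : DifferentiableAt ℝ f u)
    (hg : DifferentiableAt ℝ g u) (j : Fin n) :
    pd (fun v => f v * g v) j u = pd f j u * g u + f u * pd g j u := by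
  simp [pd, fderiv_fun_mul hf hg]; ring

theorem pd_const_mul {f : Coord n → ℝ} {u : Coord n} (hf : DifferentiableAt ℝ f u) (c : ℝ)
    (j : Fin n) : pd (fun v => c * f v) j u = c * pd f j u := by
  rw [pd_mul (differentiableAt_const c) hf, pd_const]; ring

theorem pd_mul_const {f : Coord n → ℝ} {u : Coord n} (hf : DifferentiableAt ℝ f u) (c : ℝ)
    (j : Fin n) : pd (fun v => f v * c) j u = pd f j u * c := by
  rw [pd_mul hf (differentiableAt_const c), pd_const]; ring

theorem pd_sum {ι : Type*} (s : Finset ι) {f : ι → Coord n → ℝ} {u : Coord n}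
    (hf : ∀ i ∈ s, DifferentiableAt ℝ (f i) u) (j : Fin n) :
    pd (fun v => ∑ i ∈ s, f i v) j u = ∑ i ∈ s, pd (f i) j u := by
  simp [pd, fderiv_fun_sum hf]

theorem pd_coord (i j : Fin n) (u : Coord n) :
    pd (fun v : Coord n => v i) j u = if i = j then 1 else 0 := by
  have : HasFDerivAt (fun v : Coord n => v i) (EuclideanSpace.proj i : Coord n →L[ℝ] ℝ) u :=
    (EuclideanSpace.proj i : Coord n →L[ℝ] ℝ).hasFDerivAt
  simp [pd, this.fderiv]

theorem differentiableAt_coord (i : Fin n) (u : Coord n) :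
    DifferentiableAt ℝ (fun v : Coord n => v i) u := by fun_prop

theorem fderiv_eq_sum_pd (f : Coord n → ℝ) (u v : Coord n) :
    fderiv ℝ f u v = ∑ j, pd f j u * v j := by
  have : v = ∑ j, v j • EuclideanSpace.single j (1 : ℝ) := by
    ext i; simp [Pi.single_apply]
  conv_lhs => rw [this]
  simp [pd, mul_comm]

/-- The chain rule for a function of two real variables. -/
theorem pd_comp₂ {f : ℝ → ℝ → ℝ} {fA fB : ℝ} {A B : Coord n → ℝ} {u : Coord n}
    (hf : HasFDerivAt (fun p : ℝ × ℝ => f p.1 p.2)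
      (fA • ContinuousLinearMap.fst ℝ ℝ ℝ + fB • ContinuousLinearMap.snd ℝ ℝ ℝ) (A u, B u))
    (hA : DifferentiableAt ℝ A u) (hB : DifferentiableAt ℝ B u) (j : Fin n) :
    pd (fun v => f (A v) (B v)) j u = fA * pd A j u + fB * pd B j u := by
  have h := HasFDerivAt.comp u (f := fun v => (A v, B v)) hf
    (hA.hasFDerivAt.prodMk hB.hasFDerivAt)
  have h' : HasFDerivAt (fun v => f (A v) (B v)) _ u := h
  simp [pd, h'.fderiv]

theorem differentiableAt_comp₂ {f : ℝ → ℝ → ℝ} {L : ℝ × ℝ →L[ℝ] ℝ} {A B : Coord n → ℝ}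
    {u : Coord n} (hf : HasFDerivAt (fun p : ℝ × ℝ => f p.1 p.2) L (A u, B u))
    (hA : DifferentiableAt ℝ A u) (hB : DifferentiableAt ℝ B u) :
    DifferentiableAt ℝ (fun v => f (A v) (B v)) u :=
  (HasFDerivAt.comp u (f := fun v => (A v, B v)) hf
    (hA.hasFDerivAt.prodMk hB.hasFDerivAt)).differentiableAt

theorem contDiffOn_pd {f : Coord n → ℝ} {Ω : Set (Coord n)} (hΩ : IsOpen Ω)
    (hf : ContDiffOn ℝ ∞ f Ω) (j : Fin n) : ContDiffOn ℝ ∞ (pd f j) Ω :=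
  (hf.fderiv_of_isOpen hΩ (m := ∞) (by simp)).clm_apply contDiffOn_const

theorem dotProduct_quadratic_eq_sum (a : Matrix (Fin n) (Fin n) ℝ) (v : Fin n → ℝ) :
    v ⬝ᵥ a *ᵥ v = ∑ i, ∑ j, a i j * v i * v j := by
  simp only [dotProduct, mulVec, Finset.mul_sum]
  refine Finset.sum_congr rfl fun i _ => Finset.sum_congr rfl fun j _ => by ring

theorem pd_quadratic (a : Matrix (Fin n) (Fin n) ℝ) (l : Fin n) (v : Coord n) :
    pd (fun w : Coord n => w.ofLp ⬝ᵥ a *ᵥ w.ofLp) l v = ((a + aᵀ) *ᵥ v.ofLp) l := by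
  simp_rw [dotProduct_quadratic_eq_sum]
  rw [pd_sum _ (fun i _ => by fun_prop)]
  have : ∀ i, pd (fun w : Coord n => ∑ j, a i j * w i * w j) l v
      = ∑ j, (a i j * (if i = l then 1 else 0) * v j + a i j * v i * if j = l then 1 else 0) := by
    intro i
    rw [pd_sum _ (fun i _ => by fun_prop)]
    refine Finset.sum_congr rfl fun j _ => ?_
    rw [pd_mul (by fun_prop) (by fun_prop), pd_const_mul (by fun_prop), pd_coord, pd_coord]
  simp_rw [this, Finset.sum_add_distrib]
  simp [mulVec, dotProduct, add_mul, Finset.sum_add_distrib, mul_ite, ite_mul]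

theorem pd_linear (b : Fin n → ℝ) (l : Fin n) (v : Coord n) :
    pd (fun w : Coord n => b ⬝ᵥ w.ofLp) l v = b l := by
  simp only [dotProduct]
  rw [pd_sum _ (fun i _ => by fun_prop)]
  have : ∀ i, pd (fun w : Coord n => b i * w i) l v = b i * if i = l then 1 else 0 := fun i => by
    rw [pd_const_mul (by fun_prop), pd_coord]
  simp [this]

theorem contDiff_quadratic (a : Matrix (Fin n) (Fin n) ℝ) :
    ContDiff ℝ ∞ (fun w : Coord n => w.ofLp ⬝ᵥ a *ᵥ w.ofLp) := by
  simp_rw [dotProduct_quadratic_eq_sum]; fun_prop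

theorem differentiable_quadratic (a : Matrix (Fin n) (Fin n) ℝ) :
    Differentiable ℝ (fun w : Coord n => w.ofLp ⬝ᵥ a *ᵥ w.ofLp) :=
  (contDiff_quadratic a).differentiable (by simp)

theorem contDiff_linear (b : Fin n → ℝ) :
    ContDiff ℝ ∞ (fun w : Coord n => b ⬝ᵥ w.ofLp) := by
  simp only [dotProduct]; fun_prop

theorem differentiable_linear (b : Fin n → ℝ) :
    Differentiable ℝ (fun w : Coord n => b ⬝ᵥ w.ofLp) :=
  (contDiff_linear b).differentiable (by simp)

end Calculus

/-! ### Polynomial identities on open sets, reduced to one variable, and irrationality of √A. -/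

section Polynomial

theorem _root_.Polynomial.eq_of_eventually_eval_eq {P Q : Polynomial ℝ} {t₀ : ℝ}
    (h : ∀ᶠ t in 𝓝 t₀, P.eval t = Q.eval t) : P = Q :=
  Polynomial.eq_of_infinite_eval_eq P Q (infinite_of_mem_nhds t₀ h)

/-- If `U² = A V²` for real polynomials and `A` is quadratic without real zeros, then `V = 0`. -/
theorem _root_.Polynomial.eq_zero_of_sq_eq_quadratic_mul_sq {U V : Polynomial ℝ} {a b c : ℝ}
    (ha : a ≠ 0) (hneg : b ^ 2 - 4 * a * c < 0)
    (h : U ^ 2 = (Polynomial.C a * Polynomial.X ^ 2 + Polynomial.C b * Polynomial.X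
      + Polynomial.C c) * V ^ 2) : V = 0 := by
  by_contra hV
  set φ := algebraMap ℝ ℂ
  set w : ℝ := Real.sqrt (4 * a * c - b ^ 2)
  have hw : w ^ 2 = 4 * a * c - b ^ 2 := Real.sq_sqrt (by linarith)
  have hw0 : w ≠ 0 := by
    intro h0; rw [h0] at hw; linarith
  -- The negative discriminant gives two distinct conjugate complex roots, so each is a simple root
  -- of the quadratic factor.
  set z₁ : ℂ := ((-b : ℝ) + (w : ℝ) * Complex.I) / (2 * a) with hz₁
  set z₂ : ℂ := ((-b : ℝ) - (w : ℝ) * Complex.I) / (2 * a) with hz₂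
  have haC : (a : ℂ) ≠ 0 := by exact_mod_cast ha
  have hwC : (w : ℂ) ≠ 0 := by exact_mod_cast hw0
  have hw2 : (w : ℂ) ^ 2 = 4 * a * c - b ^ 2 := by exact_mod_cast hw
  have hz : z₁ ≠ z₂ := by
    intro h0
    rw [hz₁, hz₂, div_left_inj' (by simpa using haC)] at h0
    have : (w : ℂ) * Complex.I = 0 := by linear_combination h0 / 2
    simp [hwC] at this
  have hsum : z₁ + z₂ = - b / a := by
    rw [hz₁, hz₂]; push_cast; field_simp; ring
  have hprod : z₁ * z₂ = c / a := by
    rw [hz₁, hz₂]; push_cast; field_simp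
    linear_combination (-(w:ℂ)^2) * Complex.I_sq + hw2
  have hfac : (Polynomial.C a * Polynomial.X ^ 2 + Polynomial.C b * Polynomial.X
      + Polynomial.C c : Polynomial ℝ).map φ
      = Polynomial.C (a : ℂ) * ((Polynomial.X - Polynomial.C z₁)
        * (Polynomial.X - Polynomial.C z₂)) := by
    have e : (Polynomial.X - Polynomial.C z₁) * (Polynomial.X - Polynomial.C z₂)
      = Polynomial.X ^ 2 - Polynomial.C (z₁ + z₂) * Polynomial.X + Polynomial.C (z₁ * z₂) := by
      simp only [Polynomial.C_add, Polynomial.C_mul]; ring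
    rw [e, hsum, hprod, mul_add, mul_sub, ← mul_assoc, ← Polynomial.C_mul, ← Polynomial.C_mul]
    have e1 : (a : ℂ) * (-b / a) = -b := by field_simp
    have e2 : (a : ℂ) * (c / a) = c := by field_simp
    rw [e1, e2]
    simp [φ]
  have hVm : V.map φ ≠ 0 := by
    rwa [Ne, Polynomial.map_eq_zero]
  have h' := congrArg (Polynomial.map φ) h
  rw [Polynomial.map_mul, Polynomial.map_pow, Polynomial.map_pow, hfac] at h'
  have n1 : (Polynomial.X - Polynomial.C z₁) ≠ 0 := Polynomial.X_sub_C_ne_zero _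
  have n2 : (Polynomial.X - Polynomial.C z₂) ≠ 0 := Polynomial.X_sub_C_ne_zero _
  have nA : Polynomial.C (a : ℂ) * ((Polynomial.X - Polynomial.C z₁)
        * (Polynomial.X - Polynomial.C z₂)) ≠ 0 :=
    mul_ne_zero (by simpa using ha) (mul_ne_zero n1 n2)
  have hUm : U.map φ ≠ 0 := by
    intro h0
    rw [h0] at h'
    exact (mul_ne_zero nA (pow_ne_zero 2 hVm)) (by simpa using h'.symm)
  -- The multiplicity of z₁ is even on the left and odd on the right.
  have h'' := congrArg (Polynomial.rootMultiplicity z₁) h'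
  have e1 : Polynomial.rootMultiplicity z₁ (Polynomial.X - Polynomial.C z₂) = 0 :=
    Polynomial.rootMultiplicity_eq_zero (by simpa [sub_eq_zero] using hz)
  rw [Polynomial.rootMultiplicity_mul (mul_ne_zero nA (pow_ne_zero 2 hVm)),
    Polynomial.rootMultiplicity_mul nA, Polynomial.rootMultiplicity_mul (mul_ne_zero n1 n2),
    Polynomial.rootMultiplicity_C, Polynomial.rootMultiplicity_X_sub_C_self, e1,
    pow_two, pow_two, Polynomial.rootMultiplicity_mul (mul_ne_zero hUm hUm),
    Polynomial.rootMultiplicity_mul (mul_ne_zero hVm hVm)] at h''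
  omega

/-- Functions which are polynomial along every line. -/
def PolyFun (f : Coord n → ℝ) : Prop :=
  ∀ p d : Coord n, ∃ P : Polynomial ℝ, ∀ t : ℝ, f (p + t • d) = P.eval t

theorem eventually_line_mem {Ω : Set (Coord n)} (hΩ : IsOpen Ω) {p : Coord n} (hp : p ∈ Ω)
    (d : Coord n) : ∀ᶠ t : ℝ in 𝓝 0, p + t • d ∈ Ω := by
  have : ContinuousAt (fun t : ℝ => p + t • d) 0 := by fun_prop
  exact this.preimage_mem_nhds (by simpa using hΩ.mem_nhds hp)

namespace PolyFun

variable {f g : Coord n → ℝ}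

theorem const (c : ℝ) : PolyFun (fun _ : Coord n => c) :=
  fun _ _ => ⟨Polynomial.C c, fun t => by simp⟩

theorem coord (i : Fin n) : PolyFun (fun v : Coord n => v i) :=
  fun p d => ⟨Polynomial.C (p i) + Polynomial.X * Polynomial.C (d i), fun t => by simp; ring⟩

theorem add (hf : PolyFun f) (hg : PolyFun g) : PolyFun (fun v => f v + g v) := fun p d => by
  obtain ⟨P, hP⟩ := hf p d
  obtain ⟨Q, hQ⟩ := hg p d
  exact ⟨P + Q, fun t => by simp [hP, hQ]⟩

theorem sub (hf : PolyFun f) (hg : PolyFun g) : PolyFun (fun v => f v - g v) := fun p d => by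
  obtain ⟨P, hP⟩ := hf p d
  obtain ⟨Q, hQ⟩ := hg p d
  exact ⟨P - Q, fun t => by simp [hP, hQ]⟩

theorem mul (hf : PolyFun f) (hg : PolyFun g) : PolyFun (fun v => f v * g v) := fun p d => by
  obtain ⟨P, hP⟩ := hf p d
  obtain ⟨Q, hQ⟩ := hg p d
  exact ⟨P * Q, fun t => by simp [hP, hQ]⟩

theorem pow (hf : PolyFun f) (k : ℕ) : PolyFun (fun v => f v ^ k) := fun p d => by
  obtain ⟨P, hP⟩ := hf p d
  exact ⟨P ^ k, fun t => by simp [hP]⟩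

theorem sum {ι : Type*} {s : Finset ι} {f : ι → Coord n → ℝ} (hf : ∀ i ∈ s, PolyFun (f i)) :
    PolyFun (fun v => ∑ i ∈ s, f i v) := by
  classical
  induction s using Finset.induction_on with
  | empty => simpa using const 0
  | insert i s hi ih =>
    simp only [Finset.sum_insert hi]
    exact (hf i (by simp)).add (ih fun j hj => hf j (by simp [hj]))

theorem linear (b : Fin n → ℝ) : PolyFun (fun v : Coord n => b ⬝ᵥ v.ofLp) :=
  sum fun i _ => (const (b i)).mul (coord i)

theorem mulVec {m : ℕ} (a : Matrix (Fin m) (Fin n) ℝ) (i : Fin m) :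
    PolyFun (fun v : Coord n => (a *ᵥ v.ofLp) i) := linear (a i)

theorem quadratic (a : Matrix (Fin n) (Fin n) ℝ) :
    PolyFun (fun v : Coord n => v.ofLp ⬝ᵥ a *ᵥ v.ofLp) :=
  sum fun i _ => (coord i).mul (mulVec a i)

/-- Join v to a point of Ω by a line: the restriction is a polynomial that vanishes near parameter
0, hence also at parameter 1. -/
theorem eq_zero_of_eq_zero_on_isOpen (hf : PolyFun f) {Ω : Set (Coord n)} (hΩ : IsOpen Ω)
    (hne : Ω.Nonempty) (h : ∀ v ∈ Ω, f v = 0) (v : Coord n) : f v = 0 := by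
  obtain ⟨p, hp⟩ := hne
  obtain ⟨P, hP⟩ := hf p (v - p)
  have : P = 0 := Polynomial.eq_of_eventually_eval_eq (t₀ := 0) <| by
    filter_upwards [eventually_line_mem hΩ hp (v - p)] with t ht
    rw [← hP, h _ ht]; simp
  have h1 := hP 1
  simpa [this] using h1

theorem eq_of_eq_on_isOpen (hf : PolyFun f) (hg : PolyFun g) {Ω : Set (Coord n)}
    (hΩ : IsOpen Ω) (hne : Ω.Nonempty) (h : ∀ v ∈ Ω, f v = g v) (v : Coord n) : f v = g v :=
  sub_eq_zero.1 <| (hf.sub hg).eq_zero_of_eq_zero_on_isOpen hΩ hne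
    (fun v hv => sub_eq_zero.2 (h v hv)) v

/-- The square root of a positive definite quadratic form in at least two variables is not
a quotient of polynomials. -/
theorem eq_zero_of_add_sqrt_mul_eq_zero (hn : 2 ≤ n) {U V : Coord n → ℝ} (hU : PolyFun U)
    (hV : PolyFun V) {a : Matrix (Fin n) (Fin n) ℝ} (ha : a.IsSymm)
    (hpos : ∀ v : Fin n → ℝ, v ≠ 0 → 0 < v ⬝ᵥ a *ᵥ v) {Ω : Set (Coord n)} (hΩ : IsOpen Ω)
    (hne : Ω.Nonempty) (hΩ0 : ∀ v ∈ Ω, v.ofLp ≠ 0)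
    (h : ∀ v ∈ Ω, U v + Real.sqrt (v.ofLp ⬝ᵥ a *ᵥ v.ofLp) * V v = 0) (v : Coord n) :
    V v = 0 := by
  refine hV.eq_zero_of_eq_zero_on_isOpen hΩ hne (fun y hy => ?_) v
  -- Two variables leave room for a nonzero d orthogonal to y. Along y + td the form is then Dt² +
  -- A(y) with D and A(y) positive, which has no real zero.
  obtain ⟨d, hd0, hd⟩ : ∃ d : Fin n → ℝ, d ≠ 0 ∧ y.ofLp ⬝ᵥ a *ᵥ d = 0 := by
    · set c := a *ᵥ y.ofLp with hc
      have hsym : ∀ d, y.ofLp ⬝ᵥ a *ᵥ d = c ⬝ᵥ d := fun d => by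
        rw [hc, dotProduct_mulVec, ← mulVec_transpose, ha]
      let i : Fin n := ⟨0, by omega⟩
      let j : Fin n := ⟨1, by omega⟩
      have hij : i ≠ j := by simp [i, j]
      by_cases hci : c i = 0
      · exact ⟨Pi.single i 1, by simp, by rw [hsym]; simp [hci]⟩
      · refine ⟨Pi.single i (-c j) + Pi.single j (c i), fun h0 => hci ?_, ?_⟩
        · simpa [hij.symm] using congrFun h0 j
        · rw [hsym, dotProduct_add]; simp; ring
  obtain ⟨P, hP⟩ := hU y (WithLp.toLp 2 d)
  obtain ⟨Q, hQ⟩ := hV y (WithLp.toLp 2 d)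
  have hA : ∀ t : ℝ, (y + t • WithLp.toLp 2 d).ofLp ⬝ᵥ a *ᵥ (y + t • WithLp.toLp 2 d).ofLp
      = (d ⬝ᵥ a *ᵥ d) * t ^ 2 + y.ofLp ⬝ᵥ a *ᵥ y.ofLp := by
    intro t
    have hd' : d ⬝ᵥ a *ᵥ y.ofLp = 0 := by
      rw [dotProduct_mulVec, ← mulVec_transpose, ha, dotProduct_comm, hd]
    simp [mulVec_add, dotProduct_add, mulVec_smul, hd, hd']; ring
  have hD := hpos d hd0
  have hY := hpos _ (hΩ0 y hy)
  have hPQ : P ^ 2 = (Polynomial.C (d ⬝ᵥ a *ᵥ d) * Polynomial.X ^ 2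
      + Polynomial.C 0 * Polynomial.X + Polynomial.C (y.ofLp ⬝ᵥ a *ᵥ y.ofLp)) * Q ^ 2 :=
    Polynomial.eq_of_eventually_eval_eq (t₀ := 0) <| by
      filter_upwards [eventually_line_mem hΩ hy (WithLp.toLp 2 d)] with t ht
      have h1 := h _ ht
      rw [hP, hQ, hA] at h1
      have h2 := Real.sq_sqrt (x := (d ⬝ᵥ a *ᵥ d) * t ^ 2 + y.ofLp ⬝ᵥ a *ᵥ y.ofLp)
        (by positivity)
      simp only [Polynomial.eval_pow, Polynomial.eval_mul, Polynomial.eval_add,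
        Polynomial.eval_C, Polynomial.eval_X]
      rw [eq_neg_of_add_eq_zero_left h1]
      linear_combination (Polynomial.eval t Q) ^ 2 * h2
  have hQ0 := Polynomial.eq_zero_of_sq_eq_quadratic_mul_sq hD.ne' (by nlinarith) hPQ
  have h0 := hQ 0
  simpa [hQ0] using h0

end PolyFun

end Polynomial

/-! ### Vanishing Douglas tensor versus sprays polynomial modulo y. -/

section Douglas

theorem exists_const_of_pd_eq_zero {f : Coord n → ℝ} {Ω : Set (Coord n)} (hΩ : IsOpen Ω)
    (hc : Convex ℝ Ω) (hf : DifferentiableOn ℝ f Ω) (h : ∀ v ∈ Ω, ∀ j, pd f j v = 0) :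
    ∃ c, ∀ v ∈ Ω, f v = c :=
  hΩ.exists_is_const_of_fderiv_eq_zero hc.isPreconnected hf fun v hv => by
    ext w
    rw [fderiv_eq_sum_pd]
    simp [h v hv]

theorem pd_comm {f : Coord n → ℝ} {Ω : Set (Coord n)} (hΩ : IsOpen Ω)
    (hf : ContDiffOn ℝ ∞ f Ω) {v : Coord n} (hv : v ∈ Ω) (j k : Fin n) :
    pd (pd f j) k v = pd (pd f k) j v := by
  have hat : ContDiffAt ℝ ∞ f v := hf.contDiffAt (hΩ.mem_nhds hv)
  have hs := hat.isSymmSndFDerivAt (by simpa using ENat.LEInfty.out)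
  have hd : DifferentiableAt ℝ (fderiv ℝ f) v :=
    (hat.fderiv_right (m := ∞) (by simp)).differentiableAt (by simp)
  have e : ∀ j k, pd (pd f j) k v = fderiv ℝ (fderiv ℝ f) v (EuclideanSpace.single k 1)
      (EuclideanSpace.single j 1) := fun j k => by
    have h1 : HasFDerivAt (pd f j) _ v :=
      hd.hasFDerivAt.clm_apply (hasFDerivAt_const (EuclideanSpace.single j (1 : ℝ)) v)
    simp only [pd] at h1 ⊢
    rw [h1.fderiv]
    simp
  rw [e, e, hs.eq]

/-- A function with vanishing third derivatives on a convex open set is a polynomial there. -/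
theorem exists_quadratic_of_pd_pd_pd_eq_zero {f : Coord n → ℝ} {Ω : Set (Coord n)}
    (hΩ : IsOpen Ω) (hc : Convex ℝ Ω) (hf : ContDiffOn ℝ ∞ f Ω)
    (h : ∀ v ∈ Ω, ∀ j k l, pd (pd (pd f l) k) j v = 0) :
    ∃ (q : Matrix (Fin n) (Fin n) ℝ) (c : Fin n → ℝ) (c₀ : ℝ),
      ∀ v ∈ Ω, f v = v.ofLp ⬝ᵥ q *ᵥ v.ofLp + c ⬝ᵥ v.ofLp + c₀ := by
  rcases Ω.eq_empty_or_nonempty with rfl | ⟨p, hp⟩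
  · exact ⟨0, 0, 0, by simp⟩
  have h1 := fun l => contDiffOn_pd hΩ hf l
  have h2 := fun l k => contDiffOn_pd hΩ (h1 l) k
  -- Integrate three times: the second derivatives are constants H, the gradient minus Hv is a
  -- constant c, and f minus the resulting polynomial is a constant. Convexity supplies
  -- connectedness.
  choose H hH using fun l k => exists_const_of_pd_eq_zero hΩ hc
    ((h2 l k).differentiableOn (by simp)) (fun v hv j => h v hv j k l)
  have hsymm : ∀ l k, H l k = H k l := fun l k => by
    rw [← hH l k p hp, ← hH k l p hp, pd_comm hΩ hf hp]
  have hat : ∀ v ∈ Ω, ∀ l, DifferentiableAt ℝ (pd f l) v := fun v hv l =>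
    ((h1 l).contDiffAt (hΩ.mem_nhds hv)).differentiableAt (by simp)
  have hlin : ∀ l, ∃ c, ∀ v ∈ Ω, pd f l v - H l ⬝ᵥ v.ofLp = c := fun l =>
    exists_const_of_pd_eq_zero hΩ hc
      (((h1 l).differentiableOn (by simp)).sub (differentiable_linear (H l)).differentiableOn)
      (fun v hv j => by
        rw [pd_sub (hat v hv l) (differentiable_linear (H l) v), pd_linear, hH l j v hv, sub_self])
  choose c hcl using hlin
  set q : Matrix (Fin n) (Fin n) ℝ := (1 / 2 : ℝ) • Matrix.of H with hq
  have hqq : q + qᵀ = Matrix.of H := by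
    ext i j
    simp only [hq, Matrix.add_apply, Matrix.transpose_apply, Matrix.smul_apply, Matrix.of_apply,
      smul_eq_mul, hsymm j i]
    ring
  have hfat : ∀ v ∈ Ω, DifferentiableAt ℝ f v := fun v hv =>
    (hf.contDiffAt (hΩ.mem_nhds hv)).differentiableAt (by simp)
  obtain ⟨c₀, hc₀⟩ := exists_const_of_pd_eq_zero (f := fun v => f v -
      (v.ofLp ⬝ᵥ q *ᵥ v.ofLp + c ⬝ᵥ v.ofLp)) hΩ hc
    (fun v hv => ((hfat v hv).sub ((differentiable_quadratic q v).add
      (differentiable_linear c v))).differentiableWithinAt)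
    (fun v hv j => by
      rw [pd_sub (hfat v hv) ((differentiable_quadratic q v).fun_add (differentiable_linear c v)),
        pd_add (differentiable_quadratic q v) (differentiable_linear c v), pd_quadratic, pd_linear,
        hqq, ← hcl j v hv]
      simp [Matrix.mulVec])
  exact ⟨q, c, c₀, fun v hv => by linarith [hc₀ v hv]⟩

/-- Euler's identity for positively homogeneous functions of degree one. -/
theorem sum_pd_mul_of_homogeneous {P : Coord n → ℝ} {v : Coord n} (hP : DifferentiableAt ℝ P v)
    (hom : ∀ t : ℝ, 0 < t → P (t • v) = t * P v) : ∑ m, pd P m v * v m = P v := by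
  rw [← fderiv_eq_sum_pd]
  have h1 : HasDerivAt (fun t : ℝ => t • v) v 1 := by
    simpa using (hasDerivAt_id (1 : ℝ)).smul_const v
  have h2 : HasDerivAt (fun t : ℝ => P (t • v)) (fderiv ℝ P v v) 1 := by
    have := HasFDerivAt.comp_hasDerivAt (x := (1 : ℝ)) (f := fun t : ℝ => t • v) (l := P)
      (l' := fderiv ℝ P v) (f' := v) (by simpa using hP.hasFDerivAt) h1
    exact this
  have h3 : HasDerivAt (fun t : ℝ => P (t • v)) (P v) 1 := by
    refine HasDerivAt.congr_of_eventuallyEq (f := fun t => t * P v)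
      (by simpa using (hasDerivAt_id (1 : ℝ)).mul_const (P v)) ?_
    filter_upwards [lt_mem_nhds (zero_lt_one)] with t ht using hom t ht
  exact h2.unique h3

/-- If the spray coefficients are quadratic up to a multiple of `y`, the Douglas tensor
vanishes. -/
theorem douglasTensor_eq_zero {F : Coord n → Coord n → ℝ} {x : Coord n} {Ω : Set (Coord n)}
    (hΩ : IsOpen Ω) {q : Fin n → Matrix (Fin n) (Fin n) ℝ} {P : Coord n → ℝ}
    (hP : DifferentiableOn ℝ P Ω)
    (hom : ∀ v ∈ Ω, ∀ t : ℝ, 0 < t → P (t • v) = t * P v)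
    (h : ∀ v ∈ Ω, ∀ i, sprayCoeff F i x v = v.ofLp ⬝ᵥ q i *ᵥ v.ofLp + P v * v i)
    {v : Coord n} (hv : v ∈ Ω) (i j k l : Fin n) : douglasTensor F i j k l x v = 0 := by
  have hPat : ∀ v ∈ Ω, DifferentiableAt ℝ P v := fun v hv => hP.differentiableAt (hΩ.mem_nhds hv)
  set c : Fin n → ℝ := fun k => ∑ m, (q m + (q m)ᵀ) m k with hc
  -- By Euler's identity the divergence of Py is (n+1)P. The normalised divergence therefore removes
  -- P and leaves only a linear form times y, which is again quadratic.
  have hdiv : ∀ v ∈ Ω, ∑ m, pd (sprayCoeff F m x) m v = c ⬝ᵥ v.ofLp + (n + 1) * P v := by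
    intro v hv
    have : ∀ m, pd (sprayCoeff F m x) m v
        = ((q m + (q m)ᵀ) *ᵥ v.ofLp) m + (pd P m v * v m + P v) := by
      intro m
      rw [pd_congr (g := fun v => v.ofLp ⬝ᵥ q m *ᵥ v.ofLp + P v * v m)
        (by filter_upwards [hΩ.mem_nhds hv] with w hw using h w hw m),
        pd_add (differentiable_quadratic _ _) ((hPat v hv).fun_mul (differentiableAt_coord m v)),
        pd_quadratic,
        pd_mul (hPat v hv) (by fun_prop), pd_coord]
      simp
    simp_rw [this, Finset.sum_add_distrib]
    rw [sum_pd_mul_of_homogeneous (hPat v hv) (hom v hv)]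
    have e : ∑ m, ((q m + (q m)ᵀ) *ᵥ v.ofLp) m = c ⬝ᵥ v.ofLp := by
      simp only [hc, mulVec, dotProduct, Finset.sum_mul]
      exact Finset.sum_comm
    rw [e]
    simp; ring
  set C : Matrix (Fin n) (Fin n) ℝ :=
    q i - (1 / ((n : ℝ) + 1)) • Matrix.of fun r s => (Pi.single i 1 : Fin n → ℝ) r * c s with hC
  have hT : ∀ v ∈ Ω, sprayCoeff F i x v
      - 1 / ((n : ℝ) + 1) * (∑ m, pd (sprayCoeff F m x) m v) * v i = v.ofLp ⬝ᵥ C *ᵥ v.ofLp := by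
    intro v hv
    have hn : (n : ℝ) + 1 ≠ 0 := by positivity
    have e : v.ofLp ⬝ᵥ (Matrix.of fun r s => (Pi.single i 1 : Fin n → ℝ) r * c s) *ᵥ v.ofLp
        = v i * (c ⬝ᵥ v.ofLp) := by
      simp only [dotProduct_quadratic_eq_sum, Matrix.of_apply]
      simp [Pi.single_apply, dotProduct, Finset.mul_sum]
      exact Finset.sum_congr rfl fun j _ => by ring
    rw [h v hv, hdiv v hv, hC, Matrix.sub_mulVec, dotProduct_sub, Matrix.smul_mulVec,
      dotProduct_smul, e, smul_eq_mul]
    field_simp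
    ring
  have h1 : ∀ v ∈ Ω, pd (fun y₃ => sprayCoeff F i x y₃
      - 1 / ((n : ℝ) + 1) * (∑ m, pd (sprayCoeff F m x) m y₃) * y₃ i) l v
      = (C + Cᵀ) l ⬝ᵥ v.ofLp := fun v hv => by
    rw [pd_congr (g := fun v => v.ofLp ⬝ᵥ C *ᵥ v.ofLp)
      (by filter_upwards [hΩ.mem_nhds hv] with w hw using hT w hw), pd_quadratic]
    rfl
  have h2 : ∀ v ∈ Ω, pd (fun y₂ => pd (fun y₃ => sprayCoeff F i x y₃
      - 1 / ((n : ℝ) + 1) * (∑ m, pd (sprayCoeff F m x) m y₃) * y₃ i) l y₂) k v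
      = (C + Cᵀ) l k := fun v hv => by
    rw [pd_congr (g := fun v => (C + Cᵀ) l ⬝ᵥ v.ofLp)
      (by filter_upwards [hΩ.mem_nhds hv] with w hw using h1 w hw), pd_linear]
  rw [douglasTensor, pd_congr (g := fun _ => (C + Cᵀ) l k)
      (by filter_upwards [hΩ.mem_nhds hv] with w hw using h2 w hw), pd_const]

/-- If the Douglas tensor vanishes on a convex open set, the spray coefficients are
polynomial up to a multiple of `y`. -/
theorem exists_quadratic_of_douglasTensor_eq_zero {F : Coord n → Coord n → ℝ} {x : Coord n}
    {Ω : Set (Coord n)} (hΩ : IsOpen Ω) (hc : Convex ℝ Ω)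
    (hF : ∀ i, ContDiffOn ℝ ∞ (sprayCoeff F i x) Ω)
    (h : ∀ v ∈ Ω, ∀ i j k l, douglasTensor F i j k l x v = 0) :
    ∃ (q : Fin n → Matrix (Fin n) (Fin n) ℝ) (c : Fin n → Fin n → ℝ) (c₀ : Fin n → ℝ)
      (P : Coord n → ℝ), ∀ v ∈ Ω, ∀ i, sprayCoeff F i x v
        = (v.ofLp ⬝ᵥ q i *ᵥ v.ofLp + c i ⬝ᵥ v.ofLp + c₀ i) + P v * v i := by
  have hT : ∀ i, ContDiffOn ℝ ∞ (fun y => sprayCoeff F i x y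
      - 1 / ((n : ℝ) + 1) * (∑ m, pd (sprayCoeff F m x) m y) * y i) Ω := fun i =>
    (hF i).sub ((contDiffOn_const.mul (ContDiffOn.sum fun m _ => contDiffOn_pd hΩ (hF m) m)).mul
      (by fun_prop))
  choose q c c₀ hq using fun i => exists_quadratic_of_pd_pd_pd_eq_zero hΩ hc (hT i)
    (fun v hv j k l => h v hv i j k l)
  -- The multiple of y is the normalised divergence itself, the term subtracted in the definition of
  -- the tensor.
  exact ⟨q, c, c₀, fun y => 1 / ((n : ℝ) + 1) * (∑ m, pd (sprayCoeff F m x) m y),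
    fun v hv i => by linarith [hq i v hv]⟩

end Douglas

/-! ### The Riemannian spray, r_ij and s_ij, and sprays of (α, β)-metrics. -/

section Spray

/-- The spray `(1/2) Γⁱ_jk yʲ yᵏ` of a Riemannian metric. -/
def alphaSpray (a : Coord n → Matrix (Fin n) (Fin n) ℝ) (x y : Coord n) (i : Fin n) : ℝ :=
  (1 / 2) * ∑ j, ∑ k, christoffel a i j k x * y j * y k

/-- The tensor `s_ij` as a matrix. -/
def sMat (a : Coord n → Matrix (Fin n) (Fin n) ℝ) (b : Coord n → Fin n → ℝ) (x : Coord n) :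
    Matrix (Fin n) (Fin n) ℝ := Matrix.of fun i j => sTensor a b i j x

/-- The tensor `r_ij` as a matrix. -/
def rMat (a : Coord n → Matrix (Fin n) (Fin n) ℝ) (b : Coord n → Fin n → ℝ) (x : Coord n) :
    Matrix (Fin n) (Fin n) ℝ := Matrix.of fun i j => rTensor a b i j x

variable {a : Coord n → Matrix (Fin n) (Fin n) ℝ} {b : Coord n → Fin n → ℝ} {x : Coord n}

theorem dotProduct_mulVec_comm_of_isSymm {m : Matrix (Fin n) (Fin n) ℝ} (h : m.IsSymm)
    (v w : Fin n → ℝ) : v ⬝ᵥ m *ᵥ w = w ⬝ᵥ m *ᵥ v := by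
  rw [dotProduct_mulVec, ← mulVec_transpose, h, dotProduct_comm]

theorem normSq_eq (a : Coord n → Matrix (Fin n) (Fin n) ℝ) (b : Coord n → Fin n → ℝ)
    (x : Coord n) : normSq a b x = ((a x)⁻¹ *ᵥ b x) ⬝ᵥ b x := rfl

theorem rZeroZero_eq (a : Coord n → Matrix (Fin n) (Fin n) ℝ) (b : Coord n → Fin n → ℝ)
    (x y : Coord n) : rZeroZero a b x y = y.ofLp ⬝ᵥ rMat a b x *ᵥ y.ofLp := by
  rw [dotProduct_quadratic_eq_sum]; rfl

theorem sCovector_eq (a : Coord n → Matrix (Fin n) (Fin n) ℝ) (b : Coord n → Fin n → ℝ)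
    (x : Coord n) : sCovector a b x = ((a x)⁻¹ *ᵥ b x) ᵥ* sMat a b x := rfl

theorem christoffel_comm (hsym : ∀ u, (a u).IsSymm) (k i j : Fin n) :
    christoffel a k i j x = christoffel a k j i x := by
  have : (fun u => a u i j) = fun u => a u j i := funext fun u => (hsym u).apply j i
  simp only [christoffel, this]
  congr 1
  exact Finset.sum_congr rfl fun l _ => by ring

/-- The Christoffel symbols are symmetric in the lower indices and cancel, so up to sign and factor
this is the exterior derivative of β, independent of the metric. -/
theorem sTensor_eq (hsym : ∀ u, (a u).IsSymm) (i j : Fin n) :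
    sTensor a b i j x = (1 / 2) * (pd (fun u => b u i) j x - pd (fun u => b u j) i x) := by
  simp only [sTensor, covDeriv, christoffel_comm hsym _ i j]
  ring

theorem sMat_transpose : (sMat a b x)ᵀ = -sMat a b x := by
  ext i j
  simp [sMat, sTensor]; ring

theorem rMat_isSymm : (rMat a b x).IsSymm := by
  ext i j
  simp [rMat, rTensor]; ring

theorem dotProduct_mulVec_self_of_antisymm {m : Matrix (Fin n) (Fin n) ℝ} (h : mᵀ = -m)
    (v : Fin n → ℝ) : v ⬝ᵥ m *ᵥ v = 0 := by
  have h1 : v ⬝ᵥ m *ᵥ v = v ⬝ᵥ mᵀ *ᵥ v := by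
    rw [mulVec_transpose, dotProduct_comm v (v ᵥ* m), ← dotProduct_mulVec]
  rw [h, neg_mulVec, dotProduct_neg] at h1
  linarith

/-- The Christoffel symbols contracted with `y`, with the upper index lowered. -/
theorem mulVec_alphaSpray (hdet : IsUnit (a x).det) (y : Coord n)
    (l : Fin n) : (a x *ᵥ alphaSpray a x y) l
      = 1 / 2 * ∑ k, y k * ∑ j, pd (fun u => a u l j) k x * y j
        - 1 / 4 * ∑ j, ∑ k, pd (fun u => a u j k) l x * y j * y k := by
  set Z : Fin n → ℝ := fun l => ∑ j, ∑ k, (pd (fun u => a u l k) j x + pd (fun u => a u l j) k x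
    - pd (fun u => a u j k) l x) * y j * y k with hZ
  have h1 : alphaSpray a x y = (1 / 4 : ℝ) • ((a x)⁻¹ *ᵥ Z) := by
    ext i
    simp only [alphaSpray, christoffel, hZ, Pi.smul_apply, mulVec, dotProduct, smul_eq_mul,
      Finset.mul_sum, Finset.sum_mul]
    rw [Finset.sum_comm]
    conv_rhs => rw [Finset.sum_comm]
    rw [Finset.sum_comm]
    refine Finset.sum_congr rfl fun j _ => ?_
    rw [Finset.sum_comm]
    refine Finset.sum_congr rfl fun k _ => Finset.sum_congr rfl fun m _ => by ring
  rw [h1, mulVec_smul, mulVec_mulVec, mul_nonsing_inv _ hdet, one_mulVec]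
  simp only [Pi.smul_apply, hZ, smul_eq_mul, sub_mul, add_mul, Finset.sum_sub_distrib,
    Finset.sum_add_distrib]
  have e1 : ∑ j, ∑ k, pd (fun u => a u l k) j x * y j * y k
      = ∑ k, y k * ∑ j, pd (fun u => a u l j) k x * y j := by
    simp only [Finset.mul_sum]
    exact Finset.sum_congr rfl fun j _ => Finset.sum_congr rfl fun k _ => by ring
  have e2 : ∑ j, ∑ k, pd (fun u => a u l j) k x * y j * y k
      = ∑ k, y k * ∑ j, pd (fun u => a u l j) k x * y j := by
    rw [Finset.sum_comm]
    simp only [Finset.mul_sum]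
    exact Finset.sum_congr rfl fun j _ => Finset.sum_congr rfl fun k _ => by ring
  rw [e1, e2]; ring

/-- Links b·G_α, which appears when the spray equation is contracted with β, to r_00 and the
derivative of β along y. -/
theorem rZeroZero_eq_sub (y : Coord n) :
    rZeroZero a b x y = ∑ k, y k * ∑ i, pd (fun u => b u i) k x * y i
      - 2 * (b x ⬝ᵥ alphaSpray a x y) := by
  have h1 : rZeroZero a b x y = ∑ i, ∑ j, covDeriv a b i j x * y i * y j := by
    simp only [rZeroZero, rTensor, mul_add, add_mul, Finset.sum_add_distrib]
    have : ∑ i, ∑ j, 1 / 2 * covDeriv a b j i x * y i * y j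
        = ∑ i, ∑ j, 1 / 2 * covDeriv a b i j x * y i * y j := by
      rw [Finset.sum_comm]
      exact Finset.sum_congr rfl fun j _ => Finset.sum_congr rfl fun k _ => by ring
    rw [this, ← Finset.sum_add_distrib]
    refine Finset.sum_congr rfl fun j _ => ?_
    rw [← Finset.sum_add_distrib]
    exact Finset.sum_congr rfl fun k _ => by ring
  rw [h1]
  simp only [covDeriv, sub_mul, Finset.sum_sub_distrib]
  congr 1
  · rw [Finset.sum_comm]
    simp only [Finset.mul_sum]
    exact Finset.sum_congr rfl fun j _ => Finset.sum_congr rfl fun k _ => by ring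
  · simp only [alphaSpray, dotProduct, Finset.mul_sum, Finset.sum_mul]
    rw [Finset.sum_comm' (t' := Finset.univ) (s' := fun _ => Finset.univ) (by simp)]
    conv_rhs => rw [Finset.sum_comm]
    conv_rhs => enter [2, j]; rw [Finset.sum_comm]
    rw [Finset.sum_comm]
    exact Finset.sum_congr rfl fun j _ => Finset.sum_congr rfl fun k _ =>
      Finset.sum_congr rfl fun m _ => by ring

/-! ### Solving the spray equation for F² = f(α², β). -/

section AlphaBeta

variable {f fA fB fAA fAB fBB : ℝ → ℝ → ℝ} {Ω : Set (ℝ × ℝ)}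

theorem pd_sq_alphaBeta
    (hf : ∀ p ∈ Ω, HasFDerivAt (fun p : ℝ × ℝ => f p.1 p.2)
      (fA p.1 p.2 • ContinuousLinearMap.fst ℝ ℝ ℝ + fB p.1 p.2 • ContinuousLinearMap.snd ℝ ℝ ℝ) p)
    {F : Coord n → Coord n → ℝ} (hF : ∀ u w : Coord n,
      F u w ^ 2 = f (w.ofLp ⬝ᵥ a u *ᵥ w.ofLp) (b u ⬝ᵥ w.ofLp))
    (hsym : ∀ u, (a u).IsSymm) {u w : Coord n}
    (hmem : (w.ofLp ⬝ᵥ a u *ᵥ w.ofLp, b u ⬝ᵥ w.ofLp) ∈ Ω) (l : Fin n) :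
    pd (fun w => F u w ^ 2) l w
      = fA (w.ofLp ⬝ᵥ a u *ᵥ w.ofLp) (b u ⬝ᵥ w.ofLp) * (2 * (a u *ᵥ w.ofLp) l)
        + fB (w.ofLp ⬝ᵥ a u *ᵥ w.ofLp) (b u ⬝ᵥ w.ofLp) * b u l := by
  simp_rw [hF]
  rw [pd_comp₂ (hf _ hmem) (differentiable_quadratic _ _) (differentiable_linear _ _),
    pd_quadratic, pd_linear, (hsym u).eq, add_mulVec]
  simp only [Pi.add_apply]
  ring

theorem differentiableAt_quadratic_left (ha : ∀ i j, DifferentiableAt ℝ (fun u => a u i j) x)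
    (y : Fin n → ℝ) : DifferentiableAt ℝ (fun u => y ⬝ᵥ a u *ᵥ y) x := by
  simp_rw [dotProduct_quadratic_eq_sum]; fun_prop

theorem differentiableAt_linear_left (hb : ∀ i, DifferentiableAt ℝ (fun u => b u i) x)
    (y : Fin n → ℝ) : DifferentiableAt ℝ (fun u => b u ⬝ᵥ y) x := by
  simp only [dotProduct]; fun_prop

theorem pd_quadratic_left (ha : ∀ i j, DifferentiableAt ℝ (fun u => a u i j) x)
    (y : Fin n → ℝ) (k : Fin n) :
    pd (fun u => y ⬝ᵥ a u *ᵥ y) k x = ∑ i, ∑ j, pd (fun u => a u i j) k x * y i * y j := by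
  simp_rw [dotProduct_quadratic_eq_sum]
  rw [pd_sum _ (fun i _ => by fun_prop)]
  refine Finset.sum_congr rfl fun i _ => ?_
  rw [pd_sum _ (fun i _ => by fun_prop)]
  refine Finset.sum_congr rfl fun j _ => ?_
  rw [pd_mul_const (by fun_prop), pd_mul_const (by fun_prop)]

theorem pd_linear_left (hb : ∀ i, DifferentiableAt ℝ (fun u => b u i) x)
    (y : Fin n → ℝ) (k : Fin n) :
    pd (fun u => b u ⬝ᵥ y) k x = ∑ i, pd (fun u => b u i) k x * y i := by
  simp only [dotProduct]
  rw [pd_sum _ (fun i _ => by fun_prop)]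
  exact Finset.sum_congr rfl fun i _ => pd_mul_const (by fun_prop) _ _

/-- The fundamental tensor is f_A·a plus terms built from ay and b. Only its action on a vector is
recorded: the spray will be verified by applying g to a candidate, so g⁻¹ never has to be written
out. -/
theorem fundTensor_alphaBeta (hΩ : IsOpen Ω)
    (hf : ∀ p ∈ Ω, HasFDerivAt (fun p : ℝ × ℝ => f p.1 p.2)
      (fA p.1 p.2 • ContinuousLinearMap.fst ℝ ℝ ℝ + fB p.1 p.2 • ContinuousLinearMap.snd ℝ ℝ ℝ) p)
    (hfA : ∀ p ∈ Ω, HasFDerivAt (fun p : ℝ × ℝ => fA p.1 p.2)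
      (fAA p.1 p.2 • ContinuousLinearMap.fst ℝ ℝ ℝ
        + fAB p.1 p.2 • ContinuousLinearMap.snd ℝ ℝ ℝ) p)
    (hfB : ∀ p ∈ Ω, HasFDerivAt (fun p : ℝ × ℝ => fB p.1 p.2)
      (fAB p.1 p.2 • ContinuousLinearMap.fst ℝ ℝ ℝ
        + fBB p.1 p.2 • ContinuousLinearMap.snd ℝ ℝ ℝ) p)
    {F : Coord n → Coord n → ℝ} (hF : ∀ u w : Coord n,
      F u w ^ 2 = f (w.ofLp ⬝ᵥ a u *ᵥ w.ofLp) (b u ⬝ᵥ w.ofLp))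
    (hsym : ∀ u, (a u).IsSymm) {y : Coord n} {A B : ℝ}
    (hA : y.ofLp ⬝ᵥ a x *ᵥ y.ofLp = A) (hB : b x ⬝ᵥ y.ofLp = B) (hmem : (A, B) ∈ Ω)
    (H : Fin n → ℝ) (l : Fin n) :
    (fundTensor F x y *ᵥ H) l = fA A B * (a x *ᵥ H) l
      + (2 * fAA A B * (a x *ᵥ y.ofLp) l + fAB A B * b x l) * (y.ofLp ⬝ᵥ a x *ᵥ H)
      + (fAB A B * (a x *ᵥ y.ofLp) l + 1 / 2 * fBB A B * b x l) * (b x ⬝ᵥ H) := by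
  have hnear : ∀ᶠ w : Coord n in 𝓝 y, (w.ofLp ⬝ᵥ a x *ᵥ w.ofLp, b x ⬝ᵥ w.ofLp) ∈ Ω := by
    have : ContinuousAt (fun w : Coord n => (w.ofLp ⬝ᵥ a x *ᵥ w.ofLp, b x ⬝ᵥ w.ofLp)) y :=
      (differentiable_quadratic _ _).continuousAt.prodMk (differentiable_linear _ _).continuousAt
    exact this.preimage_mem_nhds (hΩ.mem_nhds (by simpa [hA, hB] using hmem))
  subst hA hB
  have hg : ∀ i j, fundTensor F x y i j = fA (y.ofLp ⬝ᵥ a x *ᵥ y.ofLp) (b x ⬝ᵥ y.ofLp) * a x i j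
      + (2 * fAA (y.ofLp ⬝ᵥ a x *ᵥ y.ofLp) (b x ⬝ᵥ y.ofLp) * (a x *ᵥ y.ofLp) i
        + fAB (y.ofLp ⬝ᵥ a x *ᵥ y.ofLp) (b x ⬝ᵥ y.ofLp) * b x i) * (a x *ᵥ y.ofLp) j
      + (fAB (y.ofLp ⬝ᵥ a x *ᵥ y.ofLp) (b x ⬝ᵥ y.ofLp) * (a x *ᵥ y.ofLp) i
        + 1 / 2 * fBB (y.ofLp ⬝ᵥ a x *ᵥ y.ofLp) (b x ⬝ᵥ y.ofLp) * b x i) * b x j := by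
    intro i j
    simp only [fundTensor, of_apply]
    rw [pd_congr (g := fun w => fA (w.ofLp ⬝ᵥ a x *ᵥ w.ofLp) (b x ⬝ᵥ w.ofLp)
        * (2 * (a x *ᵥ w.ofLp) i) + fB (w.ofLp ⬝ᵥ a x *ᵥ w.ofLp) (b x ⬝ᵥ w.ofLp) * b x i)
      (by filter_upwards [hnear] with w hw using pd_sq_alphaBeta hf hF hsym hw i)]
    have d1 := differentiableAt_comp₂ (hfA _ hmem) (differentiable_quadratic (a x) y)
      (differentiable_linear (b x) y)
    have d2 := differentiableAt_comp₂ (hfB _ hmem) (differentiable_quadratic (a x) y)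
      (differentiable_linear (b x) y)
    have d3 : DifferentiableAt ℝ (fun w : Coord n => (a x *ᵥ w.ofLp) i) y :=
      differentiable_linear (a x i) y
    have e3 : pd (fun w : Coord n => (a x *ᵥ w.ofLp) i) j y = a x i j := pd_linear (a x i) j y
    rw [pd_add (d1.fun_mul (d3.const_mul 2)) (d2.mul_const _), pd_mul d1 (d3.const_mul 2),
      pd_mul_const d2, pd_const_mul d3, e3,
      pd_comp₂ (hfA _ hmem) (differentiable_quadratic _ _) (differentiable_linear _ _),
      pd_comp₂ (hfB _ hmem) (differentiable_quadratic _ _) (differentiable_linear _ _),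
      pd_quadratic, pd_linear, (hsym x).eq, add_mulVec]
    simp only [Pi.add_apply]
    ring
  have e : y.ofLp ⬝ᵥ a x *ᵥ H = (a x *ᵥ y.ofLp) ⬝ᵥ H := by
    rw [dotProduct_mulVec_comm_of_isSymm (hsym x), dotProduct_comm]
  rw [e]
  have key : ∀ (c₀ c₁ c₂ : ℝ) (u v w : Fin n → ℝ), ∑ j, (c₀ * u j + c₁ * v j + c₂ * w j) * H j
      = c₀ * (u ⬝ᵥ H) + c₁ * (v ⬝ᵥ H) + c₂ * (w ⬝ᵥ H) := fun c₀ c₁ c₂ u v w => by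
    simp only [dotProduct, add_mul, Finset.sum_add_distrib, Finset.mul_sum, mul_assoc]
  exact (Finset.sum_congr rfl fun j _ => congrArg (· * H j) (hg l j)).trans (key _ _ _ (a x l) _ _)

/-- The spray coefficients of a metric with `F² = f(α², β)`. -/
theorem sprayCoeff_alphaBeta (hΩ : IsOpen Ω)
    (hf : ∀ p ∈ Ω, HasFDerivAt (fun p : ℝ × ℝ => f p.1 p.2)
      (fA p.1 p.2 • ContinuousLinearMap.fst ℝ ℝ ℝ + fB p.1 p.2 • ContinuousLinearMap.snd ℝ ℝ ℝ) p)
    (hfA : ∀ p ∈ Ω, HasFDerivAt (fun p : ℝ × ℝ => fA p.1 p.2)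
      (fAA p.1 p.2 • ContinuousLinearMap.fst ℝ ℝ ℝ
        + fAB p.1 p.2 • ContinuousLinearMap.snd ℝ ℝ ℝ) p)
    (hfB : ∀ p ∈ Ω, HasFDerivAt (fun p : ℝ × ℝ => fB p.1 p.2)
      (fAB p.1 p.2 • ContinuousLinearMap.fst ℝ ℝ ℝ
        + fBB p.1 p.2 • ContinuousLinearMap.snd ℝ ℝ ℝ) p)
    {F : Coord n → Coord n → ℝ} (hF : ∀ u w : Coord n,
      F u w ^ 2 = f (w.ofLp ⬝ᵥ a u *ᵥ w.ofLp) (b u ⬝ᵥ w.ofLp))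
    (hsym : ∀ u, (a u).IsSymm) (hdet : IsUnit (a x).det)
    (ha : ∀ i j, DifferentiableAt ℝ (fun u => a u i j) x)
    (hb : ∀ i, DifferentiableAt ℝ (fun u => b u i) x) {y : Coord n} {A B b2 s0 r00 p q t : ℝ}
    (hA : y.ofLp ⬝ᵥ a x *ᵥ y.ofLp = A) (hB : b x ⬝ᵥ y.ofLp = B) (hmem : (A, B) ∈ Ω)
    (hb2 : normSq a b x = b2) (hs0 : sCovector a b x ⬝ᵥ y.ofLp = s0)
    (hr00 : rZeroZero a b x y = r00)
    (hom1 : 2 * A * fAA A B + B * fAB A B = 0) (hom2 : 2 * A * fAB A B + B * fBB A B = fB A B)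
    (hfA0 : fA A B ≠ 0)
    (hreg : fA A B * (fA A B + B * fAB A B + 1 / 2 * b2 * fBB A B)
      - 1 / 2 * fB A B * (2 * B * fAA A B + b2 * fAB A B) ≠ 0)
    (hp : 2 * fA A B * p = fB A B)
    (hq : fA A B * q + 2 * fAA A B * (q * A + t * B) + fAB A B * (p * s0 + q * B + t * b2)
      = 1 / 2 * fAB A B * r00)
    (ht : fA A B * t + fAB A B * (q * A + t * B) + 1 / 2 * fBB A B * (p * s0 + q * B + t * b2)
      = 1 / 4 * fBB A B * r00) (i : Fin n) :
    sprayCoeff F i x y = alphaSpray a x y i + p * ((a x)⁻¹ *ᵥ sMat a b x *ᵥ y.ofLp) i + q * y i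
      + t * raise a b i x := by
  set g := fundTensor F x y with hg
  have hgH := fundTensor_alphaBeta hΩ hf hfA hfB hF hsym hA hB hmem
  have hinv : (a x) * (a x)⁻¹ = 1 := mul_nonsing_inv _ hdet
  set bs := (a x)⁻¹ *ᵥ b x with hbs
  have habs : a x *ᵥ bs = b x := by rw [hbs, mulVec_mulVec, hinv, one_mulVec]
  have hbsa : ∀ H, bs ⬝ᵥ a x *ᵥ H = b x ⬝ᵥ H := fun H => by
    rw [dotProduct_mulVec_comm_of_isSymm (hsym x), habs, dotProduct_comm]
  have hb2' : b x ⬝ᵥ bs = b2 := by rw [← hb2, normSq_eq, dotProduct_comm]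
  -- For H in the kernel, contraction with y and b♯ gives a linear system for U = a(y, H) and V =
  -- β(H). `hfA0` and `hreg` force U = V = 0, and then aH = 0.
  have hgdet : IsUnit g.det := by
    rw [isUnit_iff_ne_zero]
    intro h0
    obtain ⟨H, hH0, hH⟩ := exists_mulVec_eq_zero_iff.2 h0
    apply hH0
    set U := y.ofLp ⬝ᵥ a x *ᵥ H with hU
    set V := b x ⬝ᵥ H with hV
    have hl : fA A B • (a x *ᵥ H) = (-(2 * fAA A B * U + fAB A B * V)) • (a x *ᵥ y.ofLp)
        + (-(fAB A B * U + 1 / 2 * fBB A B * V)) • b x := by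
      ext l
      have := hgH H l
      rw [← hg, hH] at this
      simp only [Pi.zero_apply, Pi.add_apply, Pi.smul_apply, smul_eq_mul] at this ⊢
      linear_combination -this
    have e1 := congrArg (fun z => y.ofLp ⬝ᵥ z) hl
    have e2 := congrArg (fun z => bs ⬝ᵥ z) hl
    simp only [dotProduct_add, dotProduct_smul, smul_eq_mul, hA, hbsa, hB, ← hU, ← hV,
      dotProduct_comm y.ofLp (b x), dotProduct_comm bs (b x), hb2'] at e1 e2
    -- Here enter the Euler relations: f_A has degree 0 and f_B degree 1 when A has degree 2 and B
    -- degree 1.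
    have e1' : fA A B * U + 1 / 2 * fB A B * V = 0 := by
      linear_combination e1 - U * hom1 - 1 / 2 * V * hom2
    have hVV : (fA A B * (fA A B + B * fAB A B + 1 / 2 * b2 * fBB A B)
      - 1 / 2 * fB A B * (2 * B * fAA A B + b2 * fAB A B)) * V = 0 := by
      linear_combination fA A B * e2 - (2 * B * fAA A B + b2 * fAB A B) * e1'
    have hV0 : V = 0 := (mul_eq_zero.1 hVV).resolve_left hreg
    have hU0 : U = 0 := by
      rw [hV0] at e1'
      exact (mul_eq_zero.1 (by linarith : fA A B * U = 0)).resolve_left hfA0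
    have haH : a x *ᵥ H = 0 := by
      rw [hU0, hV0] at hl
      have : fA A B • (a x *ᵥ H) = 0 := by rw [hl]; simp
      exact (smul_eq_zero.1 this).resolve_left hfA0
    have := congrArg (fun z => (a x)⁻¹ *ᵥ z) haH
    simpa [mulVec_mulVec, nonsing_inv_mul _ hdet] using this
  set G := alphaSpray a x y with hG
  set T := (a x)⁻¹ *ᵥ sMat a b x *ᵥ y.ofLp with hT
  -- The candidate spray. Comparing the coefficients of s_l0, ay and b in the spray equation gives
  -- exactly `hp`, `hq` and `ht`.
  set H : Fin n → ℝ := G + p • T + q • y.ofLp + t • bs with hH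
  set A0 := ∑ k, y k * ∑ i, ∑ j, pd (fun u => a u i j) k x * y i * y j with hA0
  have haT : a x *ᵥ T = sMat a b x *ᵥ y.ofLp := by
    rw [hT, mulVec_mulVec, hinv, one_mulVec]
  have hyaG : y.ofLp ⬝ᵥ a x *ᵥ G = 1 / 4 * A0 := by
    have e1 : ∑ l, y l * ∑ k, y k * ∑ j, pd (fun u => a u l j) k x * y j = A0 := by
      simp only [hA0, Finset.mul_sum]
      rw [Finset.sum_comm]
      exact Finset.sum_congr rfl fun j _ => Finset.sum_congr rfl fun k _ =>
        Finset.sum_congr rfl fun m _ => by ring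
    have : y.ofLp ⬝ᵥ a x *ᵥ G = ∑ l, y l * (1 / 2 * ∑ k, y k * ∑ j, pd (fun u => a u l j) k x * y j
        - 1 / 4 * ∑ j, ∑ k, pd (fun u => a u j k) l x * y j * y k) :=
      Finset.sum_congr rfl fun l _ => by rw [hG, mulVec_alphaSpray hdet]
    rw [this]
    have : ∀ l, y l * (1 / 2 * ∑ k, y k * ∑ j, pd (fun u => a u l j) k x * y j
        - 1 / 4 * ∑ j, ∑ k, pd (fun u => a u j k) l x * y j * y k)
        = 1 / 2 * (y l * ∑ k, y k * ∑ j, pd (fun u => a u l j) k x * y j)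
        - 1 / 4 * (y l * ∑ j, ∑ k, pd (fun u => a u j k) l x * y j * y k) := fun l => by ring
    simp_rw [this, Finset.sum_sub_distrib, ← Finset.mul_sum]
    rw [e1]
    ring
  have hbG := rZeroZero_eq_sub (a := a) (b := b) (x := x) y
  set B0 := ∑ k, y k * ∑ i, pd (fun u => b u i) k x * y i with hB0
  rw [hr00, ← hG] at hbG
  have hbT : b x ⬝ᵥ T = s0 := by
    rw [← hbsa, haT, dotProduct_mulVec, ← sCovector_eq, hs0]
  have hyaH : y.ofLp ⬝ᵥ a x *ᵥ H = 1 / 4 * A0 + q * A + t * B := by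
    simp only [hH, mulVec_add, mulVec_smul, dotProduct_add, dotProduct_smul, haT, habs, hyaG, hA,
      dotProduct_mulVec_self_of_antisymm sMat_transpose, dotProduct_comm y.ofLp (b x), hB,
      smul_eq_mul]
    ring
  have hbH : b x ⬝ᵥ H = b x ⬝ᵥ G + p * s0 + q * B + t * b2 := by
    simp only [hH, dotProduct_add, dotProduct_smul, hbT, hB, hb2', smul_eq_mul]
  have hX : ∀ l, (∑ k, pd (fun u => pd (fun w => F u w ^ 2) l y) k x * y k)
      - pd (fun u => F u y ^ 2) l x = 4 * (g *ᵥ H) l := by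
    intro l
    have hnear : ∀ᶠ u : Coord n in 𝓝 x, (y.ofLp ⬝ᵥ a u *ᵥ y.ofLp, b u ⬝ᵥ y.ofLp) ∈ Ω := by
      have : ContinuousAt (fun u : Coord n => (y.ofLp ⬝ᵥ a u *ᵥ y.ofLp, b u ⬝ᵥ y.ofLp)) x :=
        (differentiableAt_quadratic_left ha _).continuousAt.prodMk
          (differentiableAt_linear_left hb _).continuousAt
      exact this.preimage_mem_nhds (hΩ.mem_nhds (by simpa [hA, hB] using hmem))
    have hmem' : (y.ofLp ⬝ᵥ a x *ᵥ y.ofLp, b x ⬝ᵥ y.ofLp) ∈ Ω := by simpa [hA, hB] using hmem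
    have dA := differentiableAt_quadratic_left ha y.ofLp
    have dB := differentiableAt_linear_left hb y.ofLp
    have d1 := differentiableAt_comp₂ (hfA _ hmem') dA dB
    have d2 := differentiableAt_comp₂ (hfB _ hmem') dA dB
    have d3 : DifferentiableAt ℝ (fun u : Coord n => (a u *ᵥ y.ofLp) l) x := by
      simp only [mulVec, dotProduct]; fun_prop
    have e3 : ∀ k, pd (fun u : Coord n => (a u *ᵥ y.ofLp) l) k x
        = ∑ j, pd (fun u => a u l j) k x * y j := fun k =>
      pd_linear_left (b := fun u => a u l) (fun i => ha l i) y.ofLp k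
    have h1 : ∀ k, pd (fun u => pd (fun w => F u w ^ 2) l y) k x
        = (fAA A B * (∑ i, ∑ j, pd (fun u => a u i j) k x * y i * y j)
          + fAB A B * (∑ i, pd (fun u => b u i) k x * y i)) * (2 * (a x *ᵥ y.ofLp) l)
        + fA A B * (2 * ∑ j, pd (fun u => a u l j) k x * y j)
        + ((fAB A B * (∑ i, ∑ j, pd (fun u => a u i j) k x * y i * y j)
          + fBB A B * (∑ i, pd (fun u => b u i) k x * y i)) * b x l
        + fB A B * pd (fun u => b u l) k x) := by
      intro k
      rw [pd_congr (g := fun u => fA (y.ofLp ⬝ᵥ a u *ᵥ y.ofLp) (b u ⬝ᵥ y.ofLp)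
          * (2 * (a u *ᵥ y.ofLp) l) + fB (y.ofLp ⬝ᵥ a u *ᵥ y.ofLp) (b u ⬝ᵥ y.ofLp) * b u l)
        (by filter_upwards [hnear] with u hu using pd_sq_alphaBeta hf hF hsym hu l),
        pd_add (d1.fun_mul (d3.const_mul 2)) (d2.fun_mul (hb l)), pd_mul d1 (d3.const_mul 2),
        pd_mul d2 (hb l), pd_const_mul d3, e3, pd_comp₂ (hfA _ hmem') dA dB,
        pd_comp₂ (hfB _ hmem') dA dB, pd_quadratic_left ha, pd_linear_left hb]
      simp only [hA, hB]
    have h2 : pd (fun u => F u y ^ 2) l x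
        = fA A B * (∑ i, ∑ j, pd (fun u => a u i j) l x * y i * y j)
          + fB A B * (∑ i, pd (fun u => b u i) l x * y i) := by
      simp_rw [hF]
      rw [pd_comp₂ (hf _ hmem') dA dB, pd_quadratic_left ha, pd_linear_left hb]
      simp only [hA, hB]
    have h3 : ∑ k, pd (fun u => pd (fun w => F u w ^ 2) l y) k x * y k
        = (fAA A B * A0 + fAB A B * B0) * (2 * (a x *ᵥ y.ofLp) l)
          + 2 * fA A B * (∑ k, y k * ∑ j, pd (fun u => a u l j) k x * y j)
          + (fAB A B * A0 + fBB A B * B0) * b x l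
          + fB A B * ∑ k, pd (fun u => b u l) k x * y k := by
      have key : ∀ (z₁ z₂ z₃ z₄ : Fin n → ℝ) (c d c₁ c₂ c₃ c₄ c₅ : ℝ),
          ∑ k, ((c₁ * z₁ k + c₂ * z₂ k) * (2 * c) + c₄ * (2 * z₃ k)
            + ((c₂ * z₁ k + c₃ * z₂ k) * d + c₅ * z₄ k)) * y k
          = (c₁ * ∑ k, y k * z₁ k + c₂ * ∑ k, y k * z₂ k) * (2 * c) + 2 * c₄ * ∑ k, y k * z₃ k
            + (c₂ * ∑ k, y k * z₁ k + c₃ * ∑ k, y k * z₂ k) * d + c₅ * ∑ k, z₄ k * y k := by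
        intros
        simp only [Finset.mul_sum, Finset.sum_mul, ← Finset.sum_add_distrib]
        exact Finset.sum_congr rfl fun k _ => by ring
      simp_rw [h1]
      exact key _ _ _ _ _ _ _ _ _ _ _
    have h4 := mulVec_alphaSpray hdet y l
    have h5 : (sMat a b x *ᵥ y.ofLp) l = 1 / 2 * (∑ k, pd (fun u => b u l) k x * y k
        - ∑ i, pd (fun u => b u i) l x * y i) := by
      simp only [mulVec, dotProduct, sMat, of_apply, sTensor_eq hsym]
      rw [← Finset.sum_sub_distrib, Finset.mul_sum]
      exact Finset.sum_congr rfl fun j _ => by ring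
    have h6 : (a x *ᵥ H) l = (a x *ᵥ G) l + p * (sMat a b x *ᵥ y.ofLp) l
        + q * (a x *ᵥ y.ofLp) l + t * b x l := by
      simp only [hH, mulVec_add, mulVec_smul, haT, habs, Pi.add_apply, Pi.smul_apply, smul_eq_mul]
    rw [hg, hgH, h3, h2, hyaH, hbH, h6, hG, h4, h5]
    linear_combination (-(∑ k, pd (fun u => b u l) k x * y k
      - ∑ i, pd (fun u => b u i) l x * y i)) * hp - 4 * (a x *ᵥ y.ofLp) l * hq - 4 * b x l * ht
      - (2 * fAB A B * (a x *ᵥ y.ofLp) l + fBB A B * b x l) * hbG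
  have hfin : sprayCoeff F i x y = (g⁻¹ *ᵥ g *ᵥ H) i := by
    simp only [sprayCoeff, hX]
    rw [Finset.mul_sum]
    exact Finset.sum_congr rfl fun l _ => by ring
  rw [hfin, mulVec_mulVec, nonsing_inv_mul _ hgdet, one_mulVec]
  simp only [hH, Pi.add_apply, Pi.smul_apply, smul_eq_mul]
  rfl

end AlphaBeta

end Spray

/-! ### Explicit sprays of α, (α + β)²/α and α²/β. -/

section Examples

variable {a : Coord n → Matrix (Fin n) (Fin n) ℝ} {b : Coord n → Fin n → ℝ} {x : Coord n}

/-- The spray coefficients of a Riemannian metric. -/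
theorem sprayCoeff_alpha (hsym : ∀ u, (a u).IsSymm)
    (hnn : ∀ (u : Coord n) (w : Fin n → ℝ), 0 ≤ w ⬝ᵥ a u *ᵥ w) (hdet : IsUnit (a x).det)
    (ha : ∀ i j, DifferentiableAt ℝ (fun u => a u i j) x) {F : Coord n → Coord n → ℝ}
    (hF : ∀ u w : Coord n, F u w = Real.sqrt (w.ofLp ⬝ᵥ a u *ᵥ w.ofLp)) (y : Coord n)
    (i : Fin n) : sprayCoeff F i x y = alphaSpray a x y i := by
  have := sprayCoeff_alphaBeta (a := a) (b := fun _ => 0) (x := x) (f := fun A _ => A)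
    (fA := fun _ _ => 1) (fB := fun _ _ => 0) (fAA := fun _ _ => 0) (fAB := fun _ _ => 0)
    (fBB := fun _ _ => 0) (Ω := Set.univ) isOpen_univ
    (fun p _ => by simpa using hasFDerivAt_fst) (fun p _ => by simpa using hasFDerivAt_const _ _)
    (fun p _ => by simpa using hasFDerivAt_const _ _) (F := F)
    (fun u w => by rw [hF, Real.sq_sqrt (hnn _ _)]) hsym hdet ha (fun i => by fun_prop) (y := y)
    rfl rfl (Set.mem_univ _) rfl rfl rfl (by simp) (by simp) (by simp) (by simp) (p := 0) (by simp)
    (q := 0) (t := 0) (by simp) (by simp) i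
  simpa using this

theorem hasFDerivAt_div {E : Type*} [NormedAddCommGroup E] [NormedSpace ℝ E] {f g : E → ℝ}
    {f' g' : E →L[ℝ] ℝ} {p : E} (hf : HasFDerivAt f f' p) (hg : HasFDerivAt g g' p)
    (h : g p ≠ 0) :
    HasFDerivAt (fun q => f q / g q) ((1 / g p) • f' - (f p / g p ^ 2) • g') p := by
  have h1 : HasFDerivAt (fun q => (g q)⁻¹) _ p := (hasDerivAt_inv h).comp_hasFDerivAt p hg
  refine ((hf.fun_mul h1).congr_fderiv (ContinuousLinearMap.ext fun v => ?_)).congr_of_eventuallyEq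
    (Eventually.of_forall fun q => div_eq_mul_inv _ _)
  simp
  field_simp
  ring

/-- Base points with A > 0 are written as (c², B), so that √A becomes the variable c and later
identities are rational in c and B. -/
theorem hasFDerivAt_sqrt_fst {c : ℝ} (hc : 0 < c) (B : ℝ) :
    HasFDerivAt (fun p : ℝ × ℝ => Real.sqrt p.1)
      ((1 / (2 * c)) • ContinuousLinearMap.fst ℝ ℝ ℝ) (c ^ 2, B) := by
  have := (hasFDerivAt_fst (𝕜 := ℝ) (E := ℝ) (F := ℝ) (p := (c ^ 2, B))).sqrt (by positivity)
  simpa [Real.sqrt_sq hc.le] using this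

/-- This and the next two lemmas supply the first and second partial derivatives of f(A, B) = (√A +
B)⁴/A. -/
theorem hasFDerivAt_berwald {p : ℝ × ℝ} (hp : 0 < p.1) :
    HasFDerivAt (fun p : ℝ × ℝ => ((Real.sqrt p.1 + p.2) ^ 2 / Real.sqrt p.1) ^ 2)
      (((Real.sqrt p.1 + p.2) ^ 3 * (Real.sqrt p.1 - p.2) / p.1 ^ 2)
          • ContinuousLinearMap.fst ℝ ℝ ℝ
        + (4 * (Real.sqrt p.1 + p.2) ^ 3 / p.1) • ContinuousLinearMap.snd ℝ ℝ ℝ) p := by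
  obtain ⟨A, B⟩ := p
  obtain ⟨c, hc, rfl⟩ : ∃ c : ℝ, 0 < c ∧ c ^ 2 = A :=
    ⟨Real.sqrt A, Real.sqrt_pos.2 hp, Real.sq_sqrt (le_of_lt hp)⟩
  have hs := hasFDerivAt_sqrt_fst hc B
  have hd : HasFDerivAt (fun p : ℝ × ℝ => p.2) (ContinuousLinearMap.snd ℝ ℝ ℝ) (c ^ 2, B) :=
    hasFDerivAt_snd
  have h := (hasFDerivAt_div ((hs.fun_add hd).pow 2) hs
    (by simp [Real.sqrt_sq hc.le, hc.ne'])).pow 2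
  refine h.congr_fderiv
      (ContinuousLinearMap.ext fun ⟨u, v⟩ => ?_)
  simp [Real.sqrt_sq hc.le]
  field_simp
  ring

theorem hasFDerivAt_berwald_fst {p : ℝ × ℝ} (hp : 0 < p.1) :
    HasFDerivAt (fun p : ℝ × ℝ => (Real.sqrt p.1 + p.2) ^ 3 * (Real.sqrt p.1 - p.2) / p.1 ^ 2)
      ((p.2 * (Real.sqrt p.1 + p.2) ^ 2 * (2 * p.2 - Real.sqrt p.1) / p.1 ^ 3)
          • ContinuousLinearMap.fst ℝ ℝ ℝ
        + ((Real.sqrt p.1 + p.2) ^ 2 * (2 * Real.sqrt p.1 - 4 * p.2) / p.1 ^ 2)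
          • ContinuousLinearMap.snd ℝ ℝ ℝ) p := by
  obtain ⟨A, B⟩ := p
  obtain ⟨c, hc, rfl⟩ : ∃ c : ℝ, 0 < c ∧ c ^ 2 = A :=
    ⟨Real.sqrt A, Real.sqrt_pos.2 hp, Real.sq_sqrt (le_of_lt hp)⟩
  have hs := hasFDerivAt_sqrt_fst hc B
  have hd : HasFDerivAt (fun p : ℝ × ℝ => p.2) (ContinuousLinearMap.snd ℝ ℝ ℝ) (c ^ 2, B) :=
    hasFDerivAt_snd
  have hf : HasFDerivAt (fun p : ℝ × ℝ => p.1) (ContinuousLinearMap.fst ℝ ℝ ℝ) (c ^ 2, B) :=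
    hasFDerivAt_fst
  have h := hasFDerivAt_div (((hs.fun_add hd).pow 3).fun_mul (hs.fun_sub hd)) (hf.pow 2)
    (by positivity)
  refine h.congr_fderiv
      (ContinuousLinearMap.ext fun ⟨u, v⟩ => ?_)
  simp [Real.sqrt_sq hc.le]
  field_simp
  ring

theorem hasFDerivAt_berwald_snd {p : ℝ × ℝ} (hp : 0 < p.1) :
    HasFDerivAt (fun p : ℝ × ℝ => 4 * (Real.sqrt p.1 + p.2) ^ 3 / p.1)
      (((Real.sqrt p.1 + p.2) ^ 2 * (2 * Real.sqrt p.1 - 4 * p.2) / p.1 ^ 2)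
          • ContinuousLinearMap.fst ℝ ℝ ℝ
        + (12 * (Real.sqrt p.1 + p.2) ^ 2 / p.1) • ContinuousLinearMap.snd ℝ ℝ ℝ) p := by
  obtain ⟨A, B⟩ := p
  obtain ⟨c, hc, rfl⟩ : ∃ c : ℝ, 0 < c ∧ c ^ 2 = A :=
    ⟨Real.sqrt A, Real.sqrt_pos.2 hp, Real.sq_sqrt (le_of_lt hp)⟩
  have hs := hasFDerivAt_sqrt_fst hc B
  have hd : HasFDerivAt (fun p : ℝ × ℝ => p.2) (ContinuousLinearMap.snd ℝ ℝ ℝ) (c ^ 2, B) :=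
    hasFDerivAt_snd
  have hf : HasFDerivAt (fun p : ℝ × ℝ => p.1) (ContinuousLinearMap.fst ℝ ℝ ℝ) (c ^ 2, B) :=
    hasFDerivAt_fst
  have h := hasFDerivAt_div (((hs.fun_add hd).pow 3).const_mul 4) hf (by positivity)
  refine h.congr_fderiv
      (ContinuousLinearMap.ext fun ⟨u, v⟩ => ?_)
  simp [Real.sqrt_sq hc.le]
  field_simp
  ring

/-- The spray coefficients of `(α + β)² / α`. -/
theorem sprayCoeff_berwald (hsym : ∀ u, (a u).IsSymm) (hdet : IsUnit (a x).det)
    (ha : ∀ i j, DifferentiableAt ℝ (fun u => a u i j) x)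
    (hb : ∀ i, DifferentiableAt ℝ (fun u => b u i) x) {F : Coord n → Coord n → ℝ}
    (hF : ∀ u w : Coord n, F u w = (Real.sqrt (w.ofLp ⬝ᵥ a u *ᵥ w.ofLp) + b u ⬝ᵥ w.ofLp) ^ 2
      / Real.sqrt (w.ofLp ⬝ᵥ a u *ᵥ w.ofLp)) {y : Coord n} {c B b2 s0 r00 : ℝ} (hc : 0 < c)
    (hA : y.ofLp ⬝ᵥ a x *ᵥ y.ofLp = c ^ 2) (hB : b x ⬝ᵥ y.ofLp = B) (hBc : B ^ 2 < c ^ 2)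
    (hb2 : normSq a b x = b2) (hs0 : sCovector a b x ⬝ᵥ y.ofLp = s0)
    (hr00 : rZeroZero a b x y = r00) (hΔ : 0 < (1 + 2 * b2) * c ^ 2 - 3 * B ^ 2) (i : Fin n) :
    sprayCoeff F i x y = alphaSpray a x y i
      + 2 * c ^ 2 / (c - B) * ((a x)⁻¹ *ᵥ sMat a b x *ᵥ y.ofLp) i
      + (c - 2 * B) * (r00 - 4 * c ^ 2 / (c - B) * s0) / ((1 + 2 * b2) * c ^ 2 - 3 * B ^ 2) * y i
      + c ^ 2 * (r00 - 4 * c ^ 2 / (c - B) * s0) / ((1 + 2 * b2) * c ^ 2 - 3 * B ^ 2)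
        * raise a b i x := by
  have h1 : 0 < c - B := by nlinarith [abs_lt_of_sq_lt_sq hBc hc.le, neg_abs_le B, le_abs_self B]
  have h2 : 0 < c + B := by nlinarith [abs_lt_of_sq_lt_sq hBc hc.le, neg_abs_le B, le_abs_self B]
  have hsq : Real.sqrt (c ^ 2) = c := Real.sqrt_sq hc.le
  refine sprayCoeff_alphaBeta (a := a) (b := b) (x := x)
    (f := fun A B => ((Real.sqrt A + B) ^ 2 / Real.sqrt A) ^ 2)
    (fA := fun A B => (Real.sqrt A + B) ^ 3 * (Real.sqrt A - B) / A ^ 2)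
    (fB := fun A B => 4 * (Real.sqrt A + B) ^ 3 / A)
    (fAA := fun A B => B * (Real.sqrt A + B) ^ 2 * (2 * B - Real.sqrt A) / A ^ 3)
    (fAB := fun A B => (Real.sqrt A + B) ^ 2 * (2 * Real.sqrt A - 4 * B) / A ^ 2)
    (fBB := fun A B => 12 * (Real.sqrt A + B) ^ 2 / A)
    (Ω := {p | 0 < p.1}) (isOpen_lt continuous_const continuous_fst)
    (fun p hp => hasFDerivAt_berwald hp) (fun p hp => hasFDerivAt_berwald_fst hp)
    (fun p hp => hasFDerivAt_berwald_snd hp) (F := F)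
    (fun u w => by rw [hF]) hsym hdet ha hb hA hB (by simpa using pow_pos hc 2) hb2 hs0 hr00
    ?_ ?_ ?_ ?_ ?_ ?_ ?_ i
  all_goals simp only [hsq]
  · field_simp; ring
  · field_simp; ring
  · positivity
  -- The regularity determinant factors through Δ, so it is positive for ‖β‖ < 1.
  · have : (c + B) ^ 3 * (c - B) / (c ^ 2) ^ 2 * ((c + B) ^ 3 * (c - B) / (c ^ 2) ^ 2
        + B * ((c + B) ^ 2 * (2 * c - 4 * B) / (c ^ 2) ^ 2)
        + 1 / 2 * b2 * (12 * (c + B) ^ 2 / c ^ 2))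
        - 1 / 2 * (4 * (c + B) ^ 3 / c ^ 2) * (2 * B * (B * (c + B) ^ 2 * (2 * B - c) / (c ^ 2) ^ 3)
        + b2 * ((c + B) ^ 2 * (2 * c - 4 * B) / (c ^ 2) ^ 2))
        = (c + B) ^ 6 * ((1 + 2 * b2) * c ^ 2 - 3 * B ^ 2) / c ^ 8 := by
      field_simp; ring
    rw [this]
    positivity
  · field_simp; norm_num
  all_goals
    -- Δ is kept as an opaque denominator until fractions are cleared.
    obtain ⟨D, hD⟩ : ∃ D, D = (1 + 2 * b2) * c ^ 2 - 3 * B ^ 2 := ⟨_, rfl⟩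
    rw [← hD] at hΔ ⊢
    field_simp
    rw [hD]
    ring

/-- The spray coefficients of `α² / β`. -/
theorem sprayCoeff_kropina (hsym : ∀ u, (a u).IsSymm)
    (hnn : ∀ (u : Coord n) (w : Fin n → ℝ), 0 ≤ w ⬝ᵥ a u *ᵥ w) (hdet : IsUnit (a x).det)
    (ha : ∀ i j, DifferentiableAt ℝ (fun u => a u i j) x)
    (hb : ∀ i, DifferentiableAt ℝ (fun u => b u i) x) {F : Coord n → Coord n → ℝ}
    (hF : ∀ u w : Coord n, F u w = Real.sqrt (w.ofLp ⬝ᵥ a u *ᵥ w.ofLp) ^ 2 / (b u ⬝ᵥ w.ofLp))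
    {y : Coord n} {A B b2 s0 r00 : ℝ} (hA0 : 0 < A)
    (hA : y.ofLp ⬝ᵥ a x *ᵥ y.ofLp = A) (hB : b x ⬝ᵥ y.ofLp = B) (hB0 : 0 < B)
    (hb2 : normSq a b x = b2) (hb20 : 0 < b2) (hs0 : sCovector a b x ⬝ᵥ y.ofLp = s0)
    (hr00 : rZeroZero a b x y = r00) (i : Fin n) :
    sprayCoeff F i x y = alphaSpray a x y i
      + -A / (2 * B) * ((a x)⁻¹ *ᵥ sMat a b x *ᵥ y.ofLp) i
      + -(s0 + B / A * r00) / b2 * y i + (r00 + A / B * s0) / (2 * b2) * raise a b i x := by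
  refine sprayCoeff_alphaBeta (a := a) (b := b) (x := x)
    (f := fun A B => (A / B) ^ 2) (fA := fun A B => 2 * A / B ^ 2)
    (fB := fun A B => -2 * A ^ 2 / B ^ 3) (fAA := fun A B => 2 / B ^ 2)
    (fAB := fun A B => -4 * A / B ^ 3) (fBB := fun A B => 6 * A ^ 2 / B ^ 4)
    (Ω := {p | 0 < p.2}) (isOpen_lt continuous_const continuous_snd)
    ?_ ?_ ?_ (F := F)
    (fun u w => by rw [hF, Real.sq_sqrt (hnn _ _)]) hsym hdet ha hb hA hB hB0 hb2 hs0 hr00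
    ?_ ?_ ?_ ?_ ?_ ?_ ?_ i
  · rintro ⟨A, B⟩ (hp : 0 < B)
    have hf : HasFDerivAt (fun p : ℝ × ℝ => p.1) (ContinuousLinearMap.fst ℝ ℝ ℝ) (A, B) :=
      hasFDerivAt_fst
    have hd : HasFDerivAt (fun p : ℝ × ℝ => p.2) (ContinuousLinearMap.snd ℝ ℝ ℝ) (A, B) :=
      hasFDerivAt_snd
    refine ((hasFDerivAt_div hf hd hp.ne').pow 2).congr_fderiv
      (ContinuousLinearMap.ext fun ⟨u, v⟩ => ?_)
    simp
    field_simp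
    ring
  · rintro ⟨A, B⟩ (hp : 0 < B)
    have hf : HasFDerivAt (fun p : ℝ × ℝ => p.1) (ContinuousLinearMap.fst ℝ ℝ ℝ) (A, B) :=
      hasFDerivAt_fst
    have hd : HasFDerivAt (fun p : ℝ × ℝ => p.2) (ContinuousLinearMap.snd ℝ ℝ ℝ) (A, B) :=
      hasFDerivAt_snd
    refine (hasFDerivAt_div (hf.const_mul 2) (hd.pow 2) (by positivity)).congr_fderiv
      (ContinuousLinearMap.ext fun ⟨u, v⟩ => ?_)
    simp
    field_simp
    ring
  · rintro ⟨A, B⟩ (hp : 0 < B)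
    have hf : HasFDerivAt (fun p : ℝ × ℝ => p.1) (ContinuousLinearMap.fst ℝ ℝ ℝ) (A, B) :=
      hasFDerivAt_fst
    have hd : HasFDerivAt (fun p : ℝ × ℝ => p.2) (ContinuousLinearMap.snd ℝ ℝ ℝ) (A, B) :=
      hasFDerivAt_snd
    refine (hasFDerivAt_div ((hf.pow 2).const_mul (-2)) (hd.pow 3) (by positivity)).congr_fderiv
      (ContinuousLinearMap.ext fun ⟨u, v⟩ => ?_)
    simp
    field_simp
    ring
  · field_simp; ring
  · field_simp; ring
  · positivity
  -- For the Kropina metric the determinant is a monomial, nonzero because b² > 0.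
  · have : 2 * A / B ^ 2 * (2 * A / B ^ 2 + B * (-4 * A / B ^ 3)
        + 1 / 2 * b2 * (6 * A ^ 2 / B ^ 4))
        - 1 / 2 * (-2 * A ^ 2 / B ^ 3) * (2 * B * (2 / B ^ 2) + b2 * (-4 * A / B ^ 3))
        = 2 * b2 * A ^ 3 / B ^ 6 := by
      field_simp; ring
    rw [this]
    positivity
  · field_simp
  · field_simp; ring
  · field_simp; ring

end Examples

/-! ### Pointwise linear algebra: Cauchy–Schwarz, and the wedge identities forcing s_ij = 0 and r_00
= 2τΔ. -/

section Algebra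

variable {m S R : Matrix (Fin n) (Fin n) ℝ} {b : Fin n → ℝ}

theorem isUnit_det_of_pos (hpos : ∀ v : Fin n → ℝ, v ≠ 0 → 0 < v ⬝ᵥ m *ᵥ v) :
    IsUnit m.det := by
  rw [isUnit_iff_ne_zero]
  intro h0
  obtain ⟨H, hH0, hH⟩ := exists_mulVec_eq_zero_iff.2 h0
  have := hpos H hH0
  simp [hH] at this

theorem mulVec_inv_mulVec (hpos : ∀ v : Fin n → ℝ, v ≠ 0 → 0 < v ⬝ᵥ m *ᵥ v)
    (v : Fin n → ℝ) : m *ᵥ m⁻¹ *ᵥ v = v := by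
  rw [mulVec_mulVec, mul_nonsing_inv _ (isUnit_det_of_pos hpos), one_mulVec]

theorem inv_mulVec_dotProduct (hm : m.IsSymm)
    (hpos : ∀ v : Fin n → ℝ, v ≠ 0 → 0 < v ⬝ᵥ m *ᵥ v) (v w : Fin n → ℝ) :
    (m⁻¹ *ᵥ v) ⬝ᵥ m *ᵥ w = v ⬝ᵥ w := by
  rw [dotProduct_mulVec_comm_of_isSymm hm, mulVec_inv_mulVec hpos, dotProduct_comm]

theorem normSq_pos (hpos : ∀ v : Fin n → ℝ, v ≠ 0 → 0 < v ⬝ᵥ m *ᵥ v) (hb : b ≠ 0) :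
    0 < (m⁻¹ *ᵥ b) ⬝ᵥ b := by
  have h1 : m⁻¹ *ᵥ b ≠ 0 := fun h => hb <| by
    rw [← mulVec_inv_mulVec hpos b, h, mulVec_zero]
  have := hpos _ h1
  rwa [mulVec_inv_mulVec hpos] at this

/-- The Cauchy–Schwarz inequality. -/
theorem dotProduct_sq_le (hm : m.IsSymm)
    (hpos : ∀ v : Fin n → ℝ, v ≠ 0 → 0 < v ⬝ᵥ m *ᵥ v) (hb : b ≠ 0) (v : Fin n → ℝ) :
    (b ⬝ᵥ v) ^ 2 ≤ ((m⁻¹ *ᵥ b) ⬝ᵥ b) * (v ⬝ᵥ m *ᵥ v) := by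
  have hb2 := normSq_pos hpos hb
  set bs := m⁻¹ *ᵥ b with hbs
  set b2 := bs ⬝ᵥ b with hb2'
  have h1 : bs ⬝ᵥ m *ᵥ v = b ⬝ᵥ v := inv_mulVec_dotProduct hm hpos b v
  have h2 : m *ᵥ bs = b := mulVec_inv_mulVec hpos b
  have hnn : ∀ w : Fin n → ℝ, 0 ≤ w ⬝ᵥ m *ᵥ w := fun w => by
    by_cases hw : w = 0
    · simp [hw]
    · exact (hpos w hw).le
  have h3 := hnn (b2 • v - (b ⬝ᵥ v) • bs)
  have h4 : (b2 • v - (b ⬝ᵥ v) • bs) ⬝ᵥ m *ᵥ (b2 • v - (b ⬝ᵥ v) • bs)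
      = b2 * (b2 * (v ⬝ᵥ m *ᵥ v) - (b ⬝ᵥ v) ^ 2) := by
    simp only [mulVec_sub, mulVec_smul, dotProduct_sub, sub_dotProduct, smul_dotProduct,
      dotProduct_smul, h1, h2, ← hb2', dotProduct_comm v b, smul_eq_mul]
    ring
  rw [h4] at h3
  nlinarith [nonneg_of_mul_nonneg_right h3 hb2]

/-- Δ = (A − B²) + 2(b²A − B²): the first bracket is positive since ‖β‖ < 1, the second nonnegative
by Cauchy–Schwarz. -/
theorem delta_pos (hm : m.IsSymm)
    (hpos : ∀ v : Fin n → ℝ, v ≠ 0 → 0 < v ⬝ᵥ m *ᵥ v) (hb : b ≠ 0)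
    (hlt : ∀ v : Fin n → ℝ, v ≠ 0 → (b ⬝ᵥ v) ^ 2 < v ⬝ᵥ m *ᵥ v) {v : Fin n → ℝ} (hv : v ≠ 0) :
    0 < (1 + 2 * ((m⁻¹ *ᵥ b) ⬝ᵥ b)) * (v ⬝ᵥ m *ᵥ v) - 3 * (b ⬝ᵥ v) ^ 2 := by
  nlinarith [dotProduct_sq_le hm hpos hb v, hlt v hv]

/-- At v = b♯ the hypothesis reads (b²)² < b². -/
theorem normSq_lt_one (hpos : ∀ v : Fin n → ℝ, v ≠ 0 → 0 < v ⬝ᵥ m *ᵥ v) (hb : b ≠ 0)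
    (hlt : ∀ v : Fin n → ℝ, v ≠ 0 → (b ⬝ᵥ v) ^ 2 < v ⬝ᵥ m *ᵥ v) :
    (m⁻¹ *ᵥ b) ⬝ᵥ b < 1 := by
  have h1 : m⁻¹ *ᵥ b ≠ 0 := fun h => hb <| by
    rw [← mulVec_inv_mulVec hpos b, h, mulVec_zero]
  have h2 := hlt _ h1
  rw [mulVec_inv_mulVec hpos, dotProduct_comm b] at h2
  nlinarith [normSq_pos hpos hb]

/-- A vector proportional to `v` and orthogonal to it, up to a given multiple of `v`. -/
theorem smul_eq_of_wedge_eq_zero {W v z : Fin n → ℝ} (h : ∀ i j, W i * v j = W j * v i) :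
    (z ⬝ᵥ v) • W = (z ⬝ᵥ W) • v := by
  ext i
  simp only [Pi.smul_apply, smul_eq_mul, dotProduct, Finset.sum_mul]
  exact Finset.sum_congr rfl fun j _ => by linear_combination z j * h i j

/-- The vector ΔT − 2As_0 b♯ is a multiple of v. Since T is orthogonal to v, pairing with v
identifies the multiple as −2s_0B. Pairing with b then gives s_0(A − B²) = 0, so s_0 = 0 and ΔT = 0.
-/
theorem antisymm_eq_zero_of_wedge_eq_zero (hm : m.IsSymm)
    (hpos : ∀ v : Fin n → ℝ, v ≠ 0 → 0 < v ⬝ᵥ m *ᵥ v) (hb : b ≠ 0)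
    (hlt : ∀ v : Fin n → ℝ, v ≠ 0 → (b ⬝ᵥ v) ^ 2 < v ⬝ᵥ m *ᵥ v) (hS : Sᵀ = -S)
    (h : ∀ (v : Fin n → ℝ) (i j : Fin n),
      (((1 + 2 * ((m⁻¹ *ᵥ b) ⬝ᵥ b)) * (v ⬝ᵥ m *ᵥ v) - 3 * (b ⬝ᵥ v) ^ 2) * (m⁻¹ *ᵥ S *ᵥ v) i
        - 2 * (v ⬝ᵥ m *ᵥ v) * (((m⁻¹ *ᵥ b) ᵥ* S) ⬝ᵥ v) * (m⁻¹ *ᵥ b) i) * v j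
      = (((1 + 2 * ((m⁻¹ *ᵥ b) ⬝ᵥ b)) * (v ⬝ᵥ m *ᵥ v) - 3 * (b ⬝ᵥ v) ^ 2) * (m⁻¹ *ᵥ S *ᵥ v) j
        - 2 * (v ⬝ᵥ m *ᵥ v) * (((m⁻¹ *ᵥ b) ᵥ* S) ⬝ᵥ v) * (m⁻¹ *ᵥ b) j) * v i) : S = 0 := by
  suffices hv : ∀ v : Fin n → ℝ, S *ᵥ v = 0 by
    ext i j
    have := congrFun (hv (Pi.single j 1)) i
    simpa using this
  intro v
  by_cases hv0 : v = 0
  · simp [hv0]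
  have hA := hpos v hv0
  have hAB := hlt v hv0
  have hΔ := delta_pos hm hpos hb hlt hv0
  have hbT : (m⁻¹ *ᵥ S *ᵥ v) ⬝ᵥ b = ((m⁻¹ *ᵥ b) ᵥ* S) ⬝ᵥ v := by
    conv_lhs => rw [← mulVec_inv_mulVec hpos b]
    rw [inv_mulVec_dotProduct hm hpos, ← dotProduct_mulVec, dotProduct_comm]
  have hyT : (m⁻¹ *ᵥ S *ᵥ v) ⬝ᵥ m *ᵥ v = 0 := by
    rw [inv_mulVec_dotProduct hm hpos, dotProduct_comm, dotProduct_mulVec_self_of_antisymm hS]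
  have hybs : (m⁻¹ *ᵥ b) ⬝ᵥ m *ᵥ v = b ⬝ᵥ v := inv_mulVec_dotProduct hm hpos b v
  set b2 := (m⁻¹ *ᵥ b) ⬝ᵥ b with hb2
  set A := v ⬝ᵥ m *ᵥ v with hA'
  set B := b ⬝ᵥ v with hB
  set s0 := ((m⁻¹ *ᵥ b) ᵥ* S) ⬝ᵥ v with hs0
  set Δ := (1 + 2 * b2) * A - 3 * B ^ 2 with hΔ'
  set W := Δ • (m⁻¹ *ᵥ S *ᵥ v) - (2 * A * s0) • (m⁻¹ *ᵥ b) with hW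
  have hWv : ∀ i j, W i * v j = W j * v i := fun i j => by
    have := h v i j
    simpa [hW] using this
  have h1 := smul_eq_of_wedge_eq_zero (z := m *ᵥ v) hWv
  have h2 : m *ᵥ v ⬝ᵥ W = -2 * A * s0 * B := by
    rw [hW, dotProduct_comm, sub_dotProduct, smul_dotProduct, smul_dotProduct, hyT, hybs]
    simp only [smul_eq_mul]
    ring
  rw [dotProduct_comm, ← hA', h2] at h1
  have h3 : W = (-2 * s0 * B) • v := by
    refine smul_right_injective _ hA.ne' ?_
    simp only
    rw [h1, smul_smul]
    congr 1
    ring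
  have h4 := congrArg (fun z => z ⬝ᵥ b) h3
  simp only [hW, sub_dotProduct, smul_dotProduct, hbT, ← hb2, dotProduct_comm v b, ← hB,
    smul_eq_mul] at h4
  have h5 : s0 * (A - B ^ 2) = 0 := by rw [hΔ'] at h4; linear_combination h4
  have h6 : s0 = 0 := (mul_eq_zero.1 h5).resolve_right (by linarith [hAB])
  have h7 : Δ • (m⁻¹ *ᵥ S *ᵥ v) = 0 := by
    rw [hW, h6] at h3
    simpa using h3
  have h8 := (smul_eq_zero.1 h7).resolve_left hΔ.ne'
  rw [← mulVec_inv_mulVec hpos (S *ᵥ v), h8, mulVec_zero]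

/-- The condition for a Kropina metric to be a Douglas metric, with an index raised. -/
theorem inv_mulVec_antisymm_eq (hm : m.IsSymm)
    (hpos : ∀ v : Fin n → ℝ, v ≠ 0 → 0 < v ⬝ᵥ m *ᵥ v) (hb : b ≠ 0) (hS : Sᵀ = -S)
    (h : ∀ v : Fin n → ℝ, v ≠ 0 → b ⬝ᵥ v = 0 → ∀ i j,
      ((m⁻¹ *ᵥ S *ᵥ v) i
        - (((m⁻¹ *ᵥ b) ᵥ* S) ⬝ᵥ v) / ((m⁻¹ *ᵥ b) ⬝ᵥ b) * (m⁻¹ *ᵥ b) i) * v j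
      = ((m⁻¹ *ᵥ S *ᵥ v) j
        - (((m⁻¹ *ᵥ b) ᵥ* S) ⬝ᵥ v) / ((m⁻¹ *ᵥ b) ⬝ᵥ b) * (m⁻¹ *ᵥ b) j) * v i)
    (v : Fin n → ℝ) :
    m⁻¹ *ᵥ S *ᵥ v = (1 / ((m⁻¹ *ᵥ b) ⬝ᵥ b)) • ((((m⁻¹ *ᵥ b) ᵥ* S) ⬝ᵥ v) • (m⁻¹ *ᵥ b)
      - (b ⬝ᵥ v) • (m⁻¹ *ᵥ ((m⁻¹ *ᵥ b) ᵥ* S))) := by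
  have hb2 := normSq_pos hpos hb
  set bs := m⁻¹ *ᵥ b with hbs
  set b2 := bs ⬝ᵥ b with hb2'
  set s := bs ᵥ* S with hs
  -- On the hyperplane b = 0 the vector W is both parallel and orthogonal to v, hence zero.
  have hortho : ∀ v : Fin n → ℝ, b ⬝ᵥ v = 0 → m⁻¹ *ᵥ S *ᵥ v = ((s ⬝ᵥ v) / b2) • bs := by
    intro v hv
    by_cases hv0 : v = 0
    · simp [hv0]
    set W := m⁻¹ *ᵥ S *ᵥ v - ((s ⬝ᵥ v) / b2) • bs with hW
    have h1 := smul_eq_of_wedge_eq_zero (W := W) (v := v) (z := m *ᵥ v) fun i j => by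
      simpa [hW] using h v hv0 hv i j
    have h2 : m *ᵥ v ⬝ᵥ W = 0 := by
      rw [dotProduct_comm, hW, sub_dotProduct, smul_dotProduct, inv_mulVec_dotProduct hm hpos,
        inv_mulVec_dotProduct hm hpos, hv, dotProduct_comm, dotProduct_mulVec_self_of_antisymm hS]
      simp
    rw [h2, zero_smul, dotProduct_comm] at h1
    exact sub_eq_zero.1 ((smul_eq_zero.1 h1).resolve_left (hpos v hv0).ne')
  -- A general v is cb♯ plus a vector in the hyperplane, and S b♯ = −s handles the first summand.
  set c := (b ⬝ᵥ v) / b2 with hc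
  have hd : b ⬝ᵥ (v - c • bs) = 0 := by
    rw [dotProduct_sub, dotProduct_smul, dotProduct_comm b bs, ← hb2', hc, smul_eq_mul,
      div_mul_cancel₀ _ hb2.ne', sub_self]
  have h1 := hortho _ hd
  have hSbs : S *ᵥ bs = -s := by
    rw [hs, ← neg_eq_iff_eq_neg, ← neg_mulVec, ← hS, mulVec_transpose]
  have hsbs : s ⬝ᵥ bs = 0 := by
    rw [hs, ← dotProduct_mulVec, dotProduct_mulVec_self_of_antisymm hS]
  rw [mulVec_sub, mulVec_smul, hSbs, mulVec_sub, mulVec_smul, mulVec_neg, dotProduct_sub,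
    dotProduct_smul, hsbs, smul_zero, sub_zero] at h1
  rw [← sub_eq_zero] at h1 ⊢
  rw [← h1, hc]
  ext i
  simp
  ring

/-- The quadratic form `r₀₀` on the line `b♯ + t d`, for `d` orthogonal to `b♯`. -/
theorem quadratic_orthogonal_of_wedge_eq (hm : m.IsSymm)
    (hpos : ∀ v : Fin n → ℝ, v ≠ 0 → 0 < v ⬝ᵥ m *ᵥ v) (hb : b ≠ 0)
    (hlt : ∀ v : Fin n → ℝ, v ≠ 0 → (b ⬝ᵥ v) ^ 2 < v ⬝ᵥ m *ᵥ v) (hR : R.IsSymm)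
    {c : Fin n → Coord n → ℝ} (hc : ∀ i, PolyFun (c i))
    (h : ∀ (v : Coord n) (i j : Fin n),
      ((1 + 2 * ((m⁻¹ *ᵥ b) ⬝ᵥ b)) * (v.ofLp ⬝ᵥ m *ᵥ v.ofLp) - 3 * (b ⬝ᵥ v.ofLp) ^ 2)
        * (c i v * v j - c j v * v i)
      = (v.ofLp ⬝ᵥ m *ᵥ v.ofLp) * (v.ofLp ⬝ᵥ R *ᵥ v.ofLp)
        * ((m⁻¹ *ᵥ b) i * v j - (m⁻¹ *ᵥ b) j * v i))
    {d : Fin n → ℝ} (hd : b ⬝ᵥ d = 0) :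
    (m⁻¹ *ᵥ b) ⬝ᵥ R *ᵥ d = 0 ∧
    d ⬝ᵥ R *ᵥ d = ((m⁻¹ *ᵥ b) ⬝ᵥ R *ᵥ (m⁻¹ *ᵥ b))
        / (((m⁻¹ *ᵥ b) ⬝ᵥ b) * (1 - (m⁻¹ *ᵥ b) ⬝ᵥ b))
      * ((1 + 2 * ((m⁻¹ *ᵥ b) ⬝ᵥ b)) * (d ⬝ᵥ m *ᵥ d)) := by
  by_cases hd0 : d = 0
  · simp [hd0]
  have hb2 := normSq_pos hpos hb
  have hb1 := normSq_lt_one hpos hb hlt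
  have hmbs := mulVec_inv_mulVec hpos b
  have hbsd : (m⁻¹ *ᵥ b) ⬝ᵥ m *ᵥ d = 0 := by rw [inv_mulVec_dotProduct hm hpos, hd]
  have hD := hpos d hd0
  set bs := m⁻¹ *ᵥ b with hbs
  set b2 := bs ⬝ᵥ b with hb2'
  -- A nonzero d orthogonal to b♯ is not proportional to it, so some component of the wedge is
  -- nonzero.
  obtain ⟨i, j, hij⟩ : ∃ i j, bs i * d j - bs j * d i ≠ 0 := by
    by_contra! hcon
    have h1 := smul_eq_of_wedge_eq_zero (W := d) (v := bs) (z := b) fun i j => by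
      linear_combination hcon j i
    rw [hd, dotProduct_comm, zero_smul] at h1
    exact hd0 ((smul_eq_zero.1 h1).resolve_left hb2.ne')
  set κ := bs i * d j - bs j * d i with hκ
  set D := d ⬝ᵥ m *ᵥ d with hD'
  set r0 := bs ⬝ᵥ R *ᵥ bs with hr0
  set r1 := bs ⬝ᵥ R *ᵥ d with hr1
  set r2 := d ⬝ᵥ R *ᵥ d with hr2
  set δ0 := (1 + 2 * b2) * b2 - 3 * b2 ^ 2 with hδ0
  set δ2 := (1 + 2 * b2) * D with hδ2
  have hδ0pos : 0 < δ0 := by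
    have : δ0 = b2 * (1 - b2) := by rw [hδ0]; ring
    rw [this]; exact mul_pos hb2 (by linarith)
  have hδ2pos : 0 < δ2 := by positivity
  obtain ⟨P, hP⟩ := (((hc i).mul (PolyFun.coord j)).sub ((hc j).mul (PolyFun.coord i)))
    (WithLp.toLp 2 bs) (WithLp.toLp 2 d)
  have hpoly : (Polynomial.C δ0 + Polynomial.C δ2 * Polynomial.X ^ 2) * P
      = (Polynomial.C b2 + Polynomial.C D * Polynomial.X ^ 2)
        * (Polynomial.C r0 + Polynomial.C (2 * r1) * Polynomial.X
          + Polynomial.C r2 * Polynomial.X ^ 2) * (Polynomial.C κ * Polynomial.X) := by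
    refine Polynomial.funext fun t => ?_
    have h1 := h (WithLp.toLp 2 bs + t • WithLp.toLp 2 d) i j
    have hPt := hP t
    simp only at hPt
    rw [hPt] at h1
    have e1 : (bs + t • d) ⬝ᵥ m *ᵥ (bs + t • d) = b2 + D * t ^ 2 := by
      simp only [mulVec_add, mulVec_smul, dotProduct_add, add_dotProduct, smul_dotProduct,
        dotProduct_smul, hmbs, hbsd, ← hb2', dotProduct_comm d b, hd, ← hD', smul_eq_mul]
      ring
    have e2 : b ⬝ᵥ (bs + t • d) = b2 := by
      rw [dotProduct_add, dotProduct_smul, hd, dotProduct_comm]; simp [hb2']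
    have e3 : (bs + t • d) ⬝ᵥ R *ᵥ (bs + t • d) = r0 + 2 * r1 * t + r2 * t ^ 2 := by
      simp only [mulVec_add, mulVec_smul, dotProduct_add, add_dotProduct, smul_dotProduct,
        dotProduct_smul, dotProduct_mulVec_comm_of_isSymm hR d bs, ← hr0, ← hr1, ← hr2,
        smul_eq_mul]
      ring
    simp only [WithLp.ofLp_add, WithLp.ofLp_smul, e1, e2, e3, Pi.add_apply, Pi.smul_apply,
      smul_eq_mul] at h1
    simp only [Polynomial.eval_mul, Polynomial.eval_add, Polynomial.eval_C, Polynomial.eval_pow,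
      Polynomial.eval_X]
    rw [hδ0, hδ2, hκ]
    linear_combination h1
  -- On the line b♯ + td, Δ restricts to δ0 + δ2t², with roots ±iw. Evaluating at iw kills the left
  -- side.
  set w := Real.sqrt (δ0 / δ2) with hw
  have hw2 : w ^ 2 = δ0 / δ2 := Real.sq_sqrt (by positivity)
  have hw0 : w ≠ 0 := (Real.sqrt_pos.2 (by positivity)).ne'
  have hz := congrArg (fun Q => Polynomial.aeval ((w : ℂ) * Complex.I) Q) hpoly
  have hzz : ((w : ℂ) * Complex.I) ^ 2 = -(δ0 / δ2 : ℝ) := by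
    rw [mul_pow, Complex.I_sq, ← hw2]; push_cast; ring
  simp only [map_mul, map_add, map_pow, Polynomial.aeval_C, Polynomial.aeval_X, hzz,
    Complex.coe_algebraMap] at hz
  have hδC : (δ2 : ℂ) ≠ 0 := by exact_mod_cast hδ2pos.ne'
  have hzero : (δ0 : ℂ) + δ2 * -((δ0 / δ2 : ℝ) : ℂ) = 0 := by
    push_cast; field_simp; ring
  rw [hzero, zero_mul] at hz
  -- At a zero of Δ one has (1 + 2b²)A = 3B² with B = b² on this line, so A ≠ 0 there and r_00 must
  -- vanish. Real and imaginary parts give the two claims.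
  have hne1 : (b2 : ℂ) + D * -((δ0 / δ2 : ℝ) : ℂ) ≠ 0 := by
    have : b2 + D * -(δ0 / δ2) ≠ 0 := by
      have e : b2 + D * -(δ0 / δ2) = 3 * b2 ^ 2 / (1 + 2 * b2) := by
        rw [hδ0, hδ2]; field_simp; ring
      rw [e]; positivity
    exact_mod_cast this
  have hne2 : (κ : ℂ) * (w * Complex.I) ≠ 0 :=
    mul_ne_zero (by exact_mod_cast hij) (mul_ne_zero (by exact_mod_cast hw0) Complex.I_ne_zero)
  have hr := ((mul_eq_zero.1 ((mul_eq_zero.1 hz.symm).resolve_right hne2)).resolve_left hne1)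
  have him := congrArg Complex.im hr
  have hre := congrArg Complex.re hr
  have e : (r2 : ℂ) * -((δ0 / δ2 : ℝ) : ℂ) = ((r2 * -(δ0 / δ2) : ℝ) : ℂ) := by push_cast; ring
  rw [e] at him hre
  simp at him hre
  refine ⟨him.resolve_right hw0, ?_⟩
  have e' : b2 * (1 - b2) = δ0 := by rw [hδ0]; ring
  rw [e']
  field_simp at hre ⊢
  linarith

/-- Split v into a multiple of b♯ and an orthogonal part d. The mixed term of r_00 vanishes and its
value on d is a fixed multiple of Δ(d), the same multiple as on b♯, where Δ = b²(1 − b²). -/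
theorem exists_quadratic_eq_of_wedge_eq (hm : m.IsSymm)
    (hpos : ∀ v : Fin n → ℝ, v ≠ 0 → 0 < v ⬝ᵥ m *ᵥ v) (hb : b ≠ 0)
    (hlt : ∀ v : Fin n → ℝ, v ≠ 0 → (b ⬝ᵥ v) ^ 2 < v ⬝ᵥ m *ᵥ v) (hR : R.IsSymm)
    {c : Fin n → Coord n → ℝ} (hc : ∀ i, PolyFun (c i))
    (h : ∀ (v : Coord n) (i j : Fin n),
      ((1 + 2 * ((m⁻¹ *ᵥ b) ⬝ᵥ b)) * (v.ofLp ⬝ᵥ m *ᵥ v.ofLp) - 3 * (b ⬝ᵥ v.ofLp) ^ 2)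
        * (c i v * v j - c j v * v i)
      = (v.ofLp ⬝ᵥ m *ᵥ v.ofLp) * (v.ofLp ⬝ᵥ R *ᵥ v.ofLp)
        * ((m⁻¹ *ᵥ b) i * v j - (m⁻¹ *ᵥ b) j * v i)) :
    ∃ τ : ℝ, ∀ v : Fin n → ℝ, v ⬝ᵥ R *ᵥ v
      = 2 * τ * ((1 + 2 * ((m⁻¹ *ᵥ b) ⬝ᵥ b)) * (v ⬝ᵥ m *ᵥ v) - 3 * (b ⬝ᵥ v) ^ 2) := by
  have hb2 := normSq_pos hpos hb
  have hb1 := normSq_lt_one hpos hb hlt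
  have hmbs := mulVec_inv_mulVec hpos b
  have key := fun d hd => quadratic_orthogonal_of_wedge_eq hm hpos hb hlt hR hc h (d := d) hd
  have hbsm := inv_mulVec_dotProduct hm hpos b
  set bs := m⁻¹ *ᵥ b with hbs
  set b2 := bs ⬝ᵥ b with hb2'
  refine ⟨(bs ⬝ᵥ R *ᵥ bs) / (b2 * (1 - b2)) / 2, fun v => ?_⟩
  set l := (b ⬝ᵥ v) / b2 with hl
  have hB : b ⬝ᵥ v = l * b2 := by rw [hl, div_mul_cancel₀ _ hb2.ne']
  obtain ⟨d, hdv⟩ : ∃ d, v = l • bs + d := ⟨v - l • bs, by simp⟩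
  have hd : b ⬝ᵥ d = 0 := by
    have : d = v - l • bs := by rw [hdv]; simp
    rw [this, dotProduct_sub, dotProduct_smul, dotProduct_comm b bs, ← hb2', smul_eq_mul, hB,
      sub_self]
  obtain ⟨k1, k2⟩ := key d hd
  have e1 : v ⬝ᵥ m *ᵥ v = l ^ 2 * b2 + d ⬝ᵥ m *ᵥ d := by
    rw [hdv]
    simp only [mulVec_add, mulVec_smul, dotProduct_add, add_dotProduct, smul_dotProduct,
        dotProduct_smul, hmbs, hbsm, hd, ← hb2', dotProduct_comm d b, smul_eq_mul]
    ring
  have e2 : v ⬝ᵥ R *ᵥ v = l ^ 2 * (bs ⬝ᵥ R *ᵥ bs) + d ⬝ᵥ R *ᵥ d := by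
    rw [hdv]
    simp only [mulVec_add, mulVec_smul, dotProduct_add, add_dotProduct, smul_dotProduct,
        dotProduct_smul, dotProduct_mulVec_comm_of_isSymm hR d bs, k1, smul_eq_mul]
    ring
  have h1 : (1 - b2) ≠ 0 := by linarith
  rw [e1, e2, hB, k2]
  field_simp
  ring

/-- If the spray of `(α + β)² / α` is polynomial up to a multiple of `y` on an open set, then
`s_ij = 0` and `r₀₀ = 2 τ ((1 + 2 b²) α² - 3 β²)`. -/
theorem berwald_core (hn : 2 ≤ n) (hm : m.IsSymm)
    (hpos : ∀ v : Fin n → ℝ, v ≠ 0 → 0 < v ⬝ᵥ m *ᵥ v) (hb : b ≠ 0)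
    (hlt : ∀ v : Fin n → ℝ, v ≠ 0 → (b ⬝ᵥ v) ^ 2 < v ⬝ᵥ m *ᵥ v) (hR : R.IsSymm)
    (hS : Sᵀ = -S) {Ω : Set (Coord n)} (hΩ : IsOpen Ω) (hne : Ω.Nonempty)
    (hΩ0 : ∀ v ∈ Ω, v.ofLp ≠ 0) {f : Fin n → Coord n → ℝ} (hf : ∀ i, PolyFun (f i))
    {P : Coord n → ℝ}
    (h : ∀ v ∈ Ω, ∀ i, 2 * (v.ofLp ⬝ᵥ m *ᵥ v.ofLp)
          / (Real.sqrt (v.ofLp ⬝ᵥ m *ᵥ v.ofLp) - b ⬝ᵥ v.ofLp) * (m⁻¹ *ᵥ S *ᵥ v.ofLp) i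
        + (v.ofLp ⬝ᵥ m *ᵥ v.ofLp) * (v.ofLp ⬝ᵥ R *ᵥ v.ofLp - 4 * (v.ofLp ⬝ᵥ m *ᵥ v.ofLp)
            / (Real.sqrt (v.ofLp ⬝ᵥ m *ᵥ v.ofLp) - b ⬝ᵥ v.ofLp)
              * (((m⁻¹ *ᵥ b) ᵥ* S) ⬝ᵥ v.ofLp))
          / ((1 + 2 * ((m⁻¹ *ᵥ b) ⬝ᵥ b)) * (v.ofLp ⬝ᵥ m *ᵥ v.ofLp) - 3 * (b ⬝ᵥ v.ofLp) ^ 2)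
          * (m⁻¹ *ᵥ b) i
        = f i v + P v * v i) :
    S = 0 ∧ ∃ τ : ℝ, ∀ v : Fin n → ℝ, v ⬝ᵥ R *ᵥ v
      = 2 * τ * ((1 + 2 * ((m⁻¹ *ᵥ b) ⬝ᵥ b)) * (v ⬝ᵥ m *ᵥ v) - 3 * (b ⬝ᵥ v) ^ 2) := by
  set bs := m⁻¹ *ᵥ b with hbs
  set b2 := bs ⬝ᵥ b with hb2
  set s := bs ᵥ* S with hs
  have pA := PolyFun.quadratic m
  have pB := PolyFun.linear b
  have pR := PolyFun.quadratic R
  have ps := PolyFun.linear s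
  have pT : ∀ i, PolyFun (fun v : Coord n => (m⁻¹ *ᵥ S *ᵥ v.ofLp) i) := fun i => by
    simp_rw [mulVec_mulVec]
    exact PolyFun.mulVec (m⁻¹ * S) i
  have pΔ := ((PolyFun.const (n := n) (1 + 2 * b2)).mul pA).sub
    ((PolyFun.const (n := n) 3).mul (pB.pow 2))
  have hS0 : S = 0 := by
    refine antisymm_eq_zero_of_wedge_eq_zero hm hpos hb hlt hS fun v i j => ?_
    -- With 1/(√A − B) = (√A + B)/(A − B²), multiplication by (A − B²)Δ and wedging with y, the
    -- hypothesis becomes U + √A·V = 0. `pV` and `pU` are the polynomial components before wedging;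
    -- V is 2A times the expression wanted here.
    by_cases hv0 : v = 0
    · simp [hv0]
    have hA := hpos v hv0
    have pV : ∀ i, PolyFun (fun v : Coord n => 2 * (v.ofLp ⬝ᵥ m *ᵥ v.ofLp)
        * ((1 + 2 * b2) * (v.ofLp ⬝ᵥ m *ᵥ v.ofLp) - 3 * (b ⬝ᵥ v.ofLp) ^ 2)
          * (m⁻¹ *ᵥ S *ᵥ v.ofLp) i
        - 4 * (v.ofLp ⬝ᵥ m *ᵥ v.ofLp) ^ 2 * (s ⬝ᵥ v.ofLp) * bs i) := fun i =>
      ((((PolyFun.const 2).mul pA).mul pΔ).mul (pT i)).sub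
        ((((PolyFun.const 4).mul (pA.pow 2)).mul ps).mul (PolyFun.const _))
    have pU : ∀ i, PolyFun (fun v : Coord n => 2 * (v.ofLp ⬝ᵥ m *ᵥ v.ofLp) * (b ⬝ᵥ v.ofLp)
          * ((1 + 2 * b2) * (v.ofLp ⬝ᵥ m *ᵥ v.ofLp) - 3 * (b ⬝ᵥ v.ofLp) ^ 2)
            * (m⁻¹ *ᵥ S *ᵥ v.ofLp) i
        + (v.ofLp ⬝ᵥ m *ᵥ v.ofLp) * ((v.ofLp ⬝ᵥ R *ᵥ v.ofLp)
            * (v.ofLp ⬝ᵥ m *ᵥ v.ofLp - (b ⬝ᵥ v.ofLp) ^ 2)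
          - 4 * (v.ofLp ⬝ᵥ m *ᵥ v.ofLp) * (b ⬝ᵥ v.ofLp) * (s ⬝ᵥ v.ofLp)) * bs i
        - (v.ofLp ⬝ᵥ m *ᵥ v.ofLp - (b ⬝ᵥ v.ofLp) ^ 2)
          * ((1 + 2 * b2) * (v.ofLp ⬝ᵥ m *ᵥ v.ofLp) - 3 * (b ⬝ᵥ v.ofLp) ^ 2) * f i v) := fun i =>
      ((((((PolyFun.const 2).mul pA).mul pB).mul pΔ).mul (pT i)).add
        ((pA.mul ((pR.mul (pA.sub (pB.pow 2))).sub
          ((((PolyFun.const 4).mul pA).mul pB).mul ps))).mul (PolyFun.const _))).sub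
        (((pA.sub (pB.pow 2)).mul pΔ).mul (hf i))
    have key := PolyFun.eq_zero_of_add_sqrt_mul_eq_zero hn
      (((pU i).mul (PolyFun.coord j)).sub ((pU j).mul (PolyFun.coord i)))
      (((pV i).mul (PolyFun.coord j)).sub ((pV j).mul (PolyFun.coord i))) hm hpos hΩ hne hΩ0 ?_
      (WithLp.toLp 2 v)
    · simp only at key
      refine mul_left_cancel₀ (mul_ne_zero two_ne_zero hA.ne') ?_
      linear_combination key
    · intro w hw
      have hAw := hpos _ (hΩ0 w hw)
      have hABw := hlt _ (hΩ0 w hw)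
      have hΔw := delta_pos hm hpos hb hlt (hΩ0 w hw)
      have hi := h w hw i
      have hj := h w hw j
      rw [← hbs, ← hb2] at hΔw
      obtain ⟨c, hc⟩ : ∃ c, c = Real.sqrt (w.ofLp ⬝ᵥ m *ᵥ w.ofLp) := ⟨_, rfl⟩
      have hc0 : 0 < c := by rw [hc]; exact Real.sqrt_pos.2 hAw
      have hcA : w.ofLp ⬝ᵥ m *ᵥ w.ofLp = c ^ 2 := by rw [hc, Real.sq_sqrt hAw.le]
      rw [← hc] at hi hj ⊢
      rw [hcA] at hi hj hΔw hABw ⊢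
      generalize b ⬝ᵥ w.ofLp = B at *
      generalize w.ofLp ⬝ᵥ R *ᵥ w.ofLp = r at *
      generalize s ⬝ᵥ w.ofLp = s0 at *
      generalize (m⁻¹ *ᵥ S *ᵥ w.ofLp) i = Ti at *
      generalize (m⁻¹ *ᵥ S *ᵥ w.ofLp) j = Tj at *
      have h1 : c - B ≠ 0 := by
        nlinarith [abs_lt_of_sq_lt_sq hABw hc0.le, neg_abs_le B, le_abs_self B]
      obtain ⟨Δ, hΔ⟩ : ∃ Δ, Δ = (1 + 2 * b2) * c ^ 2 - 3 * B ^ 2 := ⟨_, rfl⟩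
      rw [← hΔ] at hi hj hΔw ⊢
      have hi' : (2 * c ^ 2 * (c + B) * Δ * Ti
          + c ^ 2 * (r * (c ^ 2 - B ^ 2) - 4 * c ^ 2 * (c + B) * s0) * bs i)
          = (c ^ 2 - B ^ 2) * Δ * (f i w + P w * w i) := by
        rw [← hi]; field_simp; ring
      have hj' : (2 * c ^ 2 * (c + B) * Δ * Tj
          + c ^ 2 * (r * (c ^ 2 - B ^ 2) - 4 * c ^ 2 * (c + B) * s0) * bs j)
          = (c ^ 2 - B ^ 2) * Δ * (f j w + P w * w j) := by
        rw [← hj]; field_simp; ring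
      linear_combination w j * hi' - w i * hj'
  -- With S = 0 no root is left: wedging with y gives an identity between polynomials, which extends
  -- from Ω to all vectors.
  refine ⟨hS0, exists_quadratic_eq_of_wedge_eq hm hpos hb hlt hR hf fun v i j => ?_⟩
  refine PolyFun.eq_of_eq_on_isOpen
    (pΔ.mul (((hf i).mul (PolyFun.coord j)).sub ((hf j).mul (PolyFun.coord i))))
    ((pA.mul pR).mul (((PolyFun.const _).mul (PolyFun.coord j)).sub
      ((PolyFun.const _).mul (PolyFun.coord i)))) hΩ hne (fun w hw => ?_) v
  have hΔw := delta_pos hm hpos hb hlt (hΩ0 w hw)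
  rw [← hbs, ← hb2] at hΔw
  have hi := h w hw i
  have hj := h w hw j
  simp only [hS0, zero_mulVec, mulVec_zero, vecMul_zero, zero_dotProduct, hs, Pi.zero_apply,
    mul_zero, sub_zero, zero_add] at hi hj
  generalize (1 + 2 * b2) * (w.ofLp ⬝ᵥ m *ᵥ w.ofLp) - 3 * (b ⬝ᵥ w.ofLp) ^ 2 = Δ at *
  field_simp at hi hj
  linear_combination w i * hj - w j * hi

end Algebra

/-! ### Metrics at a point of a chart, half-spaces, and (*) split into its symmetric and
antisymmetric parts. -/

section Local

/-- A family of symmetric matrices which is a differentiable metric at `x`. -/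
structure IsMetricAt (a : Coord n → Matrix (Fin n) (Fin n) ℝ) (x : Coord n) : Prop where
  symm : ∀ u, (a u).IsSymm
  nonneg : ∀ (u : Coord n) (w : Fin n → ℝ), 0 ≤ w ⬝ᵥ a u *ᵥ w
  pos : ∀ v : Fin n → ℝ, v ≠ 0 → 0 < v ⬝ᵥ a x *ᵥ v
  diff : ∀ i j, DifferentiableAt ℝ (fun u => a u i j) x

variable {a : Coord n → Matrix (Fin n) (Fin n) ℝ} {b : Coord n → Fin n → ℝ} {x : Coord n}
  {F : Coord n → Coord n → ℝ}

/-- The matrix of the quadratic form `(1/2) Γⁱ_jk yʲ yᵏ`. -/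
def sprayMat (a : Coord n → Matrix (Fin n) (Fin n) ℝ) (x : Coord n) (i : Fin n) :
    Matrix (Fin n) (Fin n) ℝ := (1 / 2 : ℝ) • Matrix.of fun j k => christoffel a i j k x

theorem alphaSpray_eq (y : Coord n) (i : Fin n) :
    alphaSpray a x y i = y.ofLp ⬝ᵥ sprayMat a x i *ᵥ y.ofLp := by
  rw [sprayMat, smul_mulVec, dotProduct_smul, dotProduct_quadratic_eq_sum]
  rfl

theorem isOpen_halfSpace (b : Fin n → ℝ) : IsOpen {v : Coord n | 0 < b ⬝ᵥ v.ofLp} :=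
  isOpen_lt continuous_const (contDiff_linear b).continuous

theorem convex_halfSpace (b : Fin n → ℝ) : Convex ℝ {v : Coord n | 0 < b ⬝ᵥ v.ofLp} := by
  refine convex_halfSpace_gt (f := fun v : Coord n => b ⬝ᵥ v.ofLp) ⟨fun v w => ?_, fun c v => ?_⟩ 0
  · simp [dotProduct_add]
  · simp [dotProduct_smul]

theorem halfSpace_nonempty {b : Fin n → ℝ} (hb : b ≠ 0) :
    {v : Coord n | 0 < b ⬝ᵥ v.ofLp}.Nonempty :=
  ⟨WithLp.toLp 2 b, by simpa using (dotProduct_self_star_pos_iff (v := b)).2 hb⟩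

theorem ne_zero_of_mem_halfSpace {b : Fin n → ℝ} {v : Coord n} (hv : 0 < b ⬝ᵥ v.ofLp) :
    v.ofLp ≠ 0 := fun h => by simp [h] at hv

/-- The right side of (*) is symmetric in i and j, so the antisymmetric part says s_ij = 0, while
the symmetric part is recovered from its quadratic form by polarization. -/
theorem sMat_eq_zero_and_rZeroZero_iff {τ : ℝ} (hsym : (a x).IsSymm) :
    (∀ i j, covDeriv a b i j x
      = 2 * τ * ((1 + 2 * normSq a b x) * a x i j - 3 * b x i * b x j)) ↔
    sMat a b x = 0 ∧ ∀ v : Fin n → ℝ, v ⬝ᵥ rMat a b x *ᵥ v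
      = 2 * τ * ((1 + 2 * normSq a b x) * (v ⬝ᵥ a x *ᵥ v) - 3 * (b x ⬝ᵥ v) ^ 2) := by
  set N : Matrix (Fin n) (Fin n) ℝ :=
    (2 * τ) • ((1 + 2 * normSq a b x) • a x - (3 : ℝ) • vecMulVec (b x) (b x)) with hN
  have hNs : N.IsSymm := by
    ext i j
    simp only [hN, vecMulVec_apply, hsym.apply i j, transpose_apply, Matrix.smul_apply,
      Matrix.sub_apply, smul_eq_mul]
    ring
  have hNq : ∀ v : Fin n → ℝ, v ⬝ᵥ N *ᵥ v
      = 2 * τ * ((1 + 2 * normSq a b x) * (v ⬝ᵥ a x *ᵥ v) - 3 * (b x ⬝ᵥ v) ^ 2) := fun v => by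
    simp only [hN, smul_mulVec, sub_mulVec, dotProduct_smul, dotProduct_sub, smul_eq_mul,
      vecMulVec_mulVec, dotProduct_comm v (b x)]
    simp only [op_smul_eq_smul, smul_eq_mul]
    ring
  simp_rw [← hNq]
  have hNe : ∀ i j, N i j = 2 * τ * ((1 + 2 * normSq a b x) * a x i j - 3 * b x i * b x j) :=
    fun i j => by
      simp only [hN, vecMulVec_apply, Matrix.smul_apply, Matrix.sub_apply, smul_eq_mul]
      ring
  simp_rw [← hNe]
  constructor
  · intro h
    have hR : rMat a b x = N := by
      ext i j
      simp only [rMat, of_apply, rTensor, h, hNs.apply i j]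
      ring
    refine ⟨?_, fun v => by rw [hR]⟩
    ext i j
    simp only [sMat, of_apply, sTensor, h, hNs.apply i j, Matrix.zero_apply]
    ring
  · rintro ⟨hS, hR⟩ i j
    have h1 : covDeriv a b i j x = rMat a b x i j + sMat a b x i j := by
      simp only [rMat, sMat, of_apply, rTensor, sTensor]; ring
    have hpol : ∀ {M : Matrix (Fin n) (Fin n) ℝ}, M.IsSymm → 2 * M i j
        = (Pi.single i 1 + Pi.single j 1) ⬝ᵥ M *ᵥ (Pi.single i 1 + Pi.single j 1)
          - Pi.single i 1 ⬝ᵥ M *ᵥ Pi.single i 1 - Pi.single j 1 ⬝ᵥ M *ᵥ Pi.single j 1 := by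
      intro M hM
      simp only [mulVec_add, dotProduct_add, add_dotProduct]
      simp [hM.apply i j]
      ring
    have h2 := hpol (rMat_isSymm (a := a) (b := b) (x := x))
    rw [hR, hR, hR, ← hpol hNs] at h2
    rw [h1, hS, Matrix.zero_apply]
    linarith

/-! ### The metric (α + β)²/α at a point. -/

section Berwald

/-- The hypotheses on `F = (α + β)² / α` at the point `x`. -/
structure IsBerwaldAt (a : Coord n → Matrix (Fin n) (Fin n) ℝ) (b : Coord n → Fin n → ℝ)
    (F : Coord n → Coord n → ℝ) (x : Coord n) : Prop extends IsMetricAt a x where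
  eq : ∀ u w : Coord n, F u w
    = (Real.sqrt (w.ofLp ⬝ᵥ a u *ᵥ w.ofLp) + b u ⬝ᵥ w.ofLp) ^ 2
      / Real.sqrt (w.ofLp ⬝ᵥ a u *ᵥ w.ofLp)
  diff_form : ∀ i, DifferentiableAt ℝ (fun u => b u i) x
  form_ne : b x ≠ 0
  lt : ∀ v : Fin n → ℝ, v ≠ 0 → (b x ⬝ᵥ v) ^ 2 < v ⬝ᵥ a x *ᵥ v

theorem sprayCoeff_berwald' (ha : IsBerwaldAt a b F x) {v : Coord n} (hv : v.ofLp ≠ 0) (i : Fin n) :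
    sprayCoeff F i x v = alphaSpray a x v i
      + 2 * (v.ofLp ⬝ᵥ a x *ᵥ v.ofLp) / (Real.sqrt (v.ofLp ⬝ᵥ a x *ᵥ v.ofLp) - b x ⬝ᵥ v.ofLp)
        * ((a x)⁻¹ *ᵥ sMat a b x *ᵥ v.ofLp) i
      + (Real.sqrt (v.ofLp ⬝ᵥ a x *ᵥ v.ofLp) - 2 * (b x ⬝ᵥ v.ofLp))
        * (v.ofLp ⬝ᵥ rMat a b x *ᵥ v.ofLp - 4 * (v.ofLp ⬝ᵥ a x *ᵥ v.ofLp)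
            / (Real.sqrt (v.ofLp ⬝ᵥ a x *ᵥ v.ofLp) - b x ⬝ᵥ v.ofLp)
              * ((((a x)⁻¹ *ᵥ b x) ᵥ* sMat a b x) ⬝ᵥ v.ofLp))
        / ((1 + 2 * (((a x)⁻¹ *ᵥ b x) ⬝ᵥ b x)) * (v.ofLp ⬝ᵥ a x *ᵥ v.ofLp)
          - 3 * (b x ⬝ᵥ v.ofLp) ^ 2) * v i
      + (v.ofLp ⬝ᵥ a x *ᵥ v.ofLp)
        * (v.ofLp ⬝ᵥ rMat a b x *ᵥ v.ofLp - 4 * (v.ofLp ⬝ᵥ a x *ᵥ v.ofLp)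
            / (Real.sqrt (v.ofLp ⬝ᵥ a x *ᵥ v.ofLp) - b x ⬝ᵥ v.ofLp)
              * ((((a x)⁻¹ *ᵥ b x) ᵥ* sMat a b x) ⬝ᵥ v.ofLp))
        / ((1 + 2 * (((a x)⁻¹ *ᵥ b x) ⬝ᵥ b x)) * (v.ofLp ⬝ᵥ a x *ᵥ v.ofLp)
          - 3 * (b x ⬝ᵥ v.ofLp) ^ 2) * ((a x)⁻¹ *ᵥ b x) i := by
  have hA := ha.pos _ hv
  have hsq := Real.sq_sqrt hA.le
  have h := sprayCoeff_berwald ha.symm (isUnit_det_of_pos ha.pos) ha.diff ha.diff_form ha.eq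
    (y := v)
    (Real.sqrt_pos.2 hA) hsq.symm rfl (by rw [hsq]; exact ha.lt _ hv) rfl rfl rfl
    (by rw [hsq]; exact delta_pos (ha.symm x) ha.pos ha.form_ne ha.lt hv) i
  rw [h, hsq, rZeroZero_eq]
  rfl

theorem sqrt_sub_ne_zero (ha : IsBerwaldAt a b F x) {v : Coord n} (hv : v.ofLp ≠ 0) :
    Real.sqrt (v.ofLp ⬝ᵥ a x *ᵥ v.ofLp) - b x ⬝ᵥ v.ofLp ≠ 0 := by
  have h1 := ha.lt _ hv
  have hA := ha.pos _ hv
  rw [← Real.sq_sqrt hA.le] at h1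
  have h2 := abs_lt_of_sq_lt_sq h1 (Real.sqrt_nonneg _)
  exact (sub_pos.2 ((le_abs_self _).trans_lt h2)).ne'

/-- Smoothness at every nonzero vector, in particular across the boundary of the Kropina domain, is
what rules out poles in a projectively related Kropina spray. -/
theorem contDiffOn_sprayCoeff_berwald (ha : IsBerwaldAt a b F x) (i : Fin n) :
    ContDiffOn ℝ ∞ (sprayCoeff F i x) {v | v.ofLp ≠ 0} := by
  have hA : ContDiffOn ℝ ∞ (fun v : Coord n => v.ofLp ⬝ᵥ a x *ᵥ v.ofLp) {v | v.ofLp ≠ 0} :=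
    (contDiff_quadratic _).contDiffOn
  have hR : ContDiffOn ℝ ∞ (fun v : Coord n => v.ofLp ⬝ᵥ rMat a b x *ᵥ v.ofLp)
    {v | v.ofLp ≠ 0} := (contDiff_quadratic _).contDiffOn
  have hG : ContDiffOn ℝ ∞ (fun v : Coord n => v.ofLp ⬝ᵥ sprayMat a x i *ᵥ v.ofLp)
    {v | v.ofLp ≠ 0} := (contDiff_quadratic _).contDiffOn
  have hB : ContDiffOn ℝ ∞ (fun v : Coord n => b x ⬝ᵥ v.ofLp) {v | v.ofLp ≠ 0} :=
    (contDiff_linear _).contDiffOn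
  have hs : ContDiffOn ℝ ∞ (fun v : Coord n => (((a x)⁻¹ *ᵥ b x) ᵥ* sMat a b x) ⬝ᵥ v.ofLp)
    {v | v.ofLp ≠ 0} := (contDiff_linear _).contDiffOn
  have hT : ContDiffOn ℝ ∞ (fun v : Coord n => ((a x)⁻¹ *ᵥ sMat a b x *ᵥ v.ofLp) i)
      {v | v.ofLp ≠ 0} := by
    simp_rw [mulVec_mulVec]
    exact (contDiff_linear _).contDiffOn
  have hc : ContDiffOn ℝ ∞ (fun v : Coord n => Real.sqrt (v.ofLp ⬝ᵥ a x *ᵥ v.ofLp))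
    {v | v.ofLp ≠ 0} := hA.sqrt fun v hv => (ha.pos _ hv).ne'
  have hcB : ∀ v : Coord n, v ∈ {v : Coord n | v.ofLp ≠ 0} → _ :=
    fun v hv => sqrt_sub_ne_zero ha (v := v) hv
  have hΔ : ContDiffOn ℝ ∞ (fun v : Coord n => (1 + 2 * (((a x)⁻¹ *ᵥ b x) ⬝ᵥ b x))
      * (v.ofLp ⬝ᵥ a x *ᵥ v.ofLp) - 3 * (b x ⬝ᵥ v.ofLp) ^ 2) {v | v.ofLp ≠ 0} :=
    (contDiffOn_const.mul hA).sub (contDiffOn_const.mul (hB.pow 2))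
  have hΔ0 : ∀ v : Coord n, v ∈ {v : Coord n | v.ofLp ≠ 0} →
      (1 + 2 * (((a x)⁻¹ *ᵥ b x) ⬝ᵥ b x)) * (v.ofLp ⬝ᵥ a x *ᵥ v.ofLp)
        - 3 * (b x ⬝ᵥ v.ofLp) ^ 2 ≠ 0 :=
    fun v hv => (delta_pos (ha.symm x) ha.pos ha.form_ne ha.lt hv).ne'
  have hi : ContDiffOn ℝ ∞ (fun v : Coord n => v i) {v | v.ofLp ≠ 0} := by fun_prop
  have hr := hR.sub (((contDiffOn_const (c := (4 : ℝ)).mul hA).div (hc.sub hB) hcB).mul hs)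
  refine ContDiffOn.congr ?_ fun v hv => by
    rw [sprayCoeff_berwald' ha hv, alphaSpray_eq]
  exact ((hG.add (((contDiffOn_const.mul hA).div (hc.sub hB) hcB).mul hT)).add
    ((((hc.sub (contDiffOn_const.mul hB)).mul hr).div hΔ hΔ0).mul hi)).add
    (((hA.mul hr).div hΔ hΔ0).mul contDiffOn_const)

/-- A spray of `(α + β)² / α` which is polynomial up to multiples of `y` on a half-space. -/
theorem exists_covDeriv_eq_of_sprayCoeff_eq (ha : IsBerwaldAt a b F x) (hn : 2 ≤ n)
    {Ω : Set (Coord n)} (hΩ : IsOpen Ω)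
    (hne : Ω.Nonempty) (hΩ0 : ∀ v ∈ Ω, v.ofLp ≠ 0) {f : Fin n → Coord n → ℝ}
    (hf : ∀ i, PolyFun (f i)) {P : Coord n → ℝ}
    (h : ∀ v ∈ Ω, ∀ i, sprayCoeff F i x v = f i v + P v * v i) :
    ∃ τ : ℝ, ∀ i j, covDeriv a b i j x
      = 2 * τ * ((1 + 2 * normSq a b x) * a x i j - 3 * b x i * b x j) := by
  obtain ⟨hS, τ, hτ⟩ := berwald_core hn (ha.symm x) ha.pos ha.form_ne ha.lt rMat_isSymm
    sMat_transpose hΩ hne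
    hΩ0 (f := fun i v => f i v - v.ofLp ⬝ᵥ sprayMat a x i *ᵥ v.ofLp)
    (fun i => (hf i).sub (PolyFun.quadratic _))
    -- The y-term of the explicit spray is moved into the unknown multiple of y, as G_α is into the
    -- polynomial part.
    (P := fun v => P v - (Real.sqrt (v.ofLp ⬝ᵥ a x *ᵥ v.ofLp) - 2 * (b x ⬝ᵥ v.ofLp))
        * (v.ofLp ⬝ᵥ rMat a b x *ᵥ v.ofLp - 4 * (v.ofLp ⬝ᵥ a x *ᵥ v.ofLp)
            / (Real.sqrt (v.ofLp ⬝ᵥ a x *ᵥ v.ofLp) - b x ⬝ᵥ v.ofLp)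
              * ((((a x)⁻¹ *ᵥ b x) ᵥ* sMat a b x) ⬝ᵥ v.ofLp))
        / ((1 + 2 * (((a x)⁻¹ *ᵥ b x) ⬝ᵥ b x)) * (v.ofLp ⬝ᵥ a x *ᵥ v.ofLp)
          - 3 * (b x ⬝ᵥ v.ofLp) ^ 2))
    (fun v hv i => by
      have h1 := h v hv i
      rw [sprayCoeff_berwald' ha (hΩ0 v hv), alphaSpray_eq] at h1
      linear_combination h1)
  exact ⟨τ, (sMat_eq_zero_and_rZeroZero_iff (ha.symm x)).2 ⟨hS, hτ⟩⟩

/-- Here s_ij = 0 and r_00 = 2τΔ, so Δ cancels and the only nonpolynomial contribution is a multiple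
of y. -/
theorem sprayCoeff_berwald_of_covDeriv (ha : IsBerwaldAt a b F x) {τ : ℝ}
    (h : ∀ i j, covDeriv a b i j x
      = 2 * τ * ((1 + 2 * normSq a b x) * a x i j - 3 * b x i * b x j))
    {v : Coord n} (hv : v.ofLp ≠ 0) (i : Fin n) :
    sprayCoeff F i x v = alphaSpray a x v i
      + 2 * τ * (v.ofLp ⬝ᵥ a x *ᵥ v.ofLp) * raise a b i x
      + 2 * τ * (Real.sqrt (v.ofLp ⬝ᵥ a x *ᵥ v.ofLp) - 2 * (b x ⬝ᵥ v.ofLp)) * v i := by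
  obtain ⟨hS, hR⟩ := (sMat_eq_zero_and_rZeroZero_iff (ha.symm x)).1 h
  have hΔ := (delta_pos (ha.symm x) ha.pos ha.form_ne ha.lt hv).ne'
  rw [sprayCoeff_berwald' ha hv, hS, hR, normSq_eq]
  generalize (1 + 2 * (((a x)⁻¹ *ᵥ b x) ⬝ᵥ b x)) * (v.ofLp ⬝ᵥ a x *ᵥ v.ofLp)
    - 3 * (b x ⬝ᵥ v.ofLp) ^ 2 = Δ at *
  simp only [zero_mulVec, mulVec_zero, vecMul_zero, zero_dotProduct, Pi.zero_apply, mul_zero,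
    sub_zero, add_zero, show raise a b i x = ((a x)⁻¹ *ᵥ b x) i from rfl]
  field_simp
  ring

theorem douglasTensor_berwald_eq_zero (ha : IsBerwaldAt a b F x) {τ : ℝ}
    (h : ∀ i j, covDeriv a b i j x
      = 2 * τ * ((1 + 2 * normSq a b x) * a x i j - 3 * b x i * b x j))
    {v : Coord n} (hv : v.ofLp ≠ 0) (i j k l : Fin n) : douglasTensor F i j k l x v = 0 := by
  have hopen : IsOpen {v : Coord n | v.ofLp ≠ 0} := by
    have : {v : Coord n | v.ofLp ≠ 0} = {0}ᶜ := by ext v; simp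
    rw [this]; exact isOpen_compl_singleton
  refine douglasTensor_eq_zero (Ω := {v | v.ofLp ≠ 0}) hopen
    (q := fun i => sprayMat a x i + (2 * τ * raise a b i x) • a x)
    (P := fun v => 2 * τ * (Real.sqrt (v.ofLp ⬝ᵥ a x *ᵥ v.ofLp) - 2 * (b x ⬝ᵥ v.ofLp)))
    (fun v hv => ?_) (fun v _ t ht => ?_) (fun v hv i => ?_) hv i j k l
  · exact ((((differentiable_quadratic (a x) v).sqrt (ha.pos _ hv).ne').sub
      ((differentiable_linear (b x) v).const_mul 2)).const_mul (2 * τ)).differentiableWithinAt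
  · have : (t • v).ofLp ⬝ᵥ a x *ᵥ (t • v).ofLp = t ^ 2 * (v.ofLp ⬝ᵥ a x *ᵥ v.ofLp) := by
      simp [mulVec_smul]; ring
    rw [this, Real.sqrt_mul (sq_nonneg t), Real.sqrt_sq ht.le]
    simp
    ring
  · rw [sprayCoeff_berwald_of_covDeriv ha h hv, alphaSpray_eq, add_mulVec,
      dotProduct_add, smul_mulVec, dotProduct_smul, smul_eq_mul]
    ring

end Berwald

end Local

/-! ### The Kropina metric at a point; Douglas conditions for both metrics. -/

section Kropina

variable {a : Coord n → Matrix (Fin n) (Fin n) ℝ} {b : Coord n → Fin n → ℝ} {x : Coord n}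
  {F : Coord n → Coord n → ℝ}

theorem isOpen_ofLp_ne_zero : IsOpen {v : Coord n | v.ofLp ≠ 0} := by
  have : {v : Coord n | v.ofLp ≠ 0} = {0}ᶜ := by ext v; simp
  rw [this]; exact isOpen_compl_singleton

/-- The hypotheses on `F = α² / β` at the point `x`. -/
structure IsKropinaAt (a : Coord n → Matrix (Fin n) (Fin n) ℝ) (b : Coord n → Fin n → ℝ)
    (F : Coord n → Coord n → ℝ) (x : Coord n) : Prop extends IsMetricAt a x where
  eq : ∀ u w : Coord n, F u w = Real.sqrt (w.ofLp ⬝ᵥ a u *ᵥ w.ofLp) ^ 2 / (b u ⬝ᵥ w.ofLp)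
  diff_form : ∀ i, DifferentiableAt ℝ (fun u => b u i) x
  form_ne : b x ≠ 0

/-- The condition `s_ij = (b_i s_j - b_j s_i) / b²`, with the index `i` raised. -/
def KropinaCond (a : Coord n → Matrix (Fin n) (Fin n) ℝ) (b : Coord n → Fin n → ℝ)
    (x : Coord n) : Prop :=
  ∀ (v : Fin n → ℝ) (i : Fin n), ((a x)⁻¹ *ᵥ sMat a b x *ᵥ v) i
    = ((sCovector a b x ⬝ᵥ v) * raise a b i x - (b x ⬝ᵥ v) * raise a (sCovector a b) i x)
      / normSq a b x

/-- The factor of `y` in the spray coefficients of a Kropina metric. -/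
def kropinaFactor (a : Coord n → Matrix (Fin n) (Fin n) ℝ) (b : Coord n → Fin n → ℝ)
    (x v : Coord n) : ℝ :=
  -(sCovector a b x ⬝ᵥ v.ofLp
    + (b x ⬝ᵥ v.ofLp) / (v.ofLp ⬝ᵥ a x *ᵥ v.ofLp) * rZeroZero a b x v) / normSq a b x

/-- The quadratic part of the spray coefficients of a Kropina metric of Douglas type. -/
def kropinaMat (a : Coord n → Matrix (Fin n) (Fin n) ℝ) (b : Coord n → Fin n → ℝ)
    (x : Coord n) (i : Fin n) : Matrix (Fin n) (Fin n) ℝ :=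
  (1 / (2 * normSq a b x)) • (raise a (sCovector a b) i x • a x + raise a b i x • rMat a b x)

theorem kropinaMat_apply (v : Coord n) (i : Fin n) :
    v.ofLp ⬝ᵥ kropinaMat a b x i *ᵥ v.ofLp = 1 / (2 * normSq a b x)
      * ((v.ofLp ⬝ᵥ a x *ᵥ v.ofLp) * raise a (sCovector a b) i x
        + rZeroZero a b x v * raise a b i x) := by
  rw [kropinaMat, smul_mulVec, dotProduct_smul, add_mulVec, dotProduct_add, smul_mulVec,
    smul_mulVec, dotProduct_smul, dotProduct_smul, rZeroZero_eq]
  simp only [smul_eq_mul]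
  ring

theorem sprayCoeff_kropina' (ha : IsKropinaAt a b F x) {v : Coord n} (hv : 0 < b x ⬝ᵥ v.ofLp)
    (i : Fin n) : sprayCoeff F i x v = alphaSpray a x v i
      + -(v.ofLp ⬝ᵥ a x *ᵥ v.ofLp) / (2 * (b x ⬝ᵥ v.ofLp))
        * ((a x)⁻¹ *ᵥ sMat a b x *ᵥ v.ofLp) i
      + kropinaFactor a b x v * v i
      + (rZeroZero a b x v + (v.ofLp ⬝ᵥ a x *ᵥ v.ofLp) / (b x ⬝ᵥ v.ofLp)
        * (sCovector a b x ⬝ᵥ v.ofLp)) / (2 * normSq a b x) * raise a b i x :=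
  sprayCoeff_kropina ha.symm ha.nonneg (isUnit_det_of_pos ha.pos) ha.diff ha.diff_form ha.eq
    (ha.pos _ (ne_zero_of_mem_halfSpace hv)) rfl rfl hv rfl (normSq_pos ha.pos ha.form_ne) rfl rfl i

theorem differentiableOn_kropinaFactor (ha : IsKropinaAt a b F x) :
    ContDiffOn ℝ ∞ (kropinaFactor a b x) {v | 0 < b x ⬝ᵥ v.ofLp} := by
  have hR : ContDiffOn ℝ ∞ (rZeroZero a b x) {v : Coord n | 0 < b x ⬝ᵥ v.ofLp} :=
    (contDiff_quadratic (rMat a b x)).contDiffOn.congr fun v _ => rZeroZero_eq a b x v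
  exact (((contDiff_linear _).contDiffOn.add (((contDiff_linear _).contDiffOn.div
    (contDiff_quadratic _).contDiffOn fun v hv =>
      (ha.pos _ (ne_zero_of_mem_halfSpace hv)).ne').mul hR)).neg).div_const _

theorem contDiffOn_sprayCoeff_kropina (ha : IsKropinaAt a b F x) (i : Fin n) :
    ContDiffOn ℝ ∞ (sprayCoeff F i x) {v | 0 < b x ⬝ᵥ v.ofLp} := by
  have hR : ContDiffOn ℝ ∞ (rZeroZero a b x) {v : Coord n | 0 < b x ⬝ᵥ v.ofLp} :=
    (contDiff_quadratic (rMat a b x)).contDiffOn.congr fun v _ => rZeroZero_eq a b x v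
  have hA : ContDiffOn ℝ ∞ (fun v : Coord n => v.ofLp ⬝ᵥ a x *ᵥ v.ofLp)
    {v : Coord n | 0 < b x ⬝ᵥ v.ofLp} := (contDiff_quadratic _).contDiffOn
  have hB : ContDiffOn ℝ ∞ (fun v : Coord n => b x ⬝ᵥ v.ofLp)
    {v : Coord n | 0 < b x ⬝ᵥ v.ofLp} := (contDiff_linear _).contDiffOn
  have hG : ContDiffOn ℝ ∞ (fun v : Coord n => v.ofLp ⬝ᵥ sprayMat a x i *ᵥ v.ofLp)
    {v : Coord n | 0 < b x ⬝ᵥ v.ofLp} := (contDiff_quadratic _).contDiffOn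
  have hs : ContDiffOn ℝ ∞ (fun v : Coord n => sCovector a b x ⬝ᵥ v.ofLp)
    {v : Coord n | 0 < b x ⬝ᵥ v.ofLp} := (contDiff_linear _).contDiffOn
  have hT : ContDiffOn ℝ ∞ (fun v : Coord n => ((a x)⁻¹ *ᵥ sMat a b x *ᵥ v.ofLp) i)
      {v : Coord n | 0 < b x ⬝ᵥ v.ofLp} := by
    simp_rw [mulVec_mulVec]
    exact (contDiff_linear _).contDiffOn
  have hi : ContDiffOn ℝ ∞ (fun v : Coord n => v i) {v : Coord n | 0 < b x ⬝ᵥ v.ofLp} := by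
    fun_prop
  refine ContDiffOn.congr ?_ fun v hv => by
    rw [sprayCoeff_kropina' ha hv, alphaSpray_eq]
  exact ((hG.add ((hA.neg.div (contDiffOn_const.mul hB)
    fun v hv => (mul_pos two_pos hv).ne').mul hT)).add
    ((differentiableOn_kropinaFactor ha).mul hi)).add
    (((hR.add ((hA.div hB fun v hv => (ne_of_gt hv)).mul hs)).div_const _).mul contDiffOn_const)

/-- The condition on `s_ij` necessary for the spray of a Kropina metric to extend continuously,
up to multiples of `y`, to the nonzero vectors with `β = 0`. -/
theorem kropinaCond_of_sprayCoeff_eq (ha : IsKropinaAt a b F x) {R : Fin n → Coord n → ℝ}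
    (hR : ∀ i, ContinuousOn (R i) {v | v.ofLp ≠ 0}) {P : Coord n → ℝ}
    (h : ∀ v : Coord n, 0 < b x ⬝ᵥ v.ofLp → ∀ i, sprayCoeff F i x v = R i v + P v * v i) :
    KropinaCond a b x := by
  have hb2 : 0 < normSq a b x := normSq_pos ha.pos ha.form_ne
  have key := inv_mulVec_antisymm_eq (ha.symm x) ha.pos ha.form_ne
    (sMat_transpose (a := a) (b := b) (x := x)) ?_
  · intro v i
    rw [key v]
    simp only [Pi.smul_apply, Pi.sub_apply, smul_eq_mul, normSq_eq,
      show raise a b i x = ((a x)⁻¹ *ᵥ b x) i from rfl, sCovector_eq,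
      show raise a (sCovector a b) i x = ((a x)⁻¹ *ᵥ (((a x)⁻¹ *ᵥ b x) ᵥ* sMat a b x)) i from rfl]
    ring
  intro v₀ hv₀ hBv i j
  set X : Fin n → Coord n → ℝ := fun i v => ((a x)⁻¹ *ᵥ sMat a b x *ᵥ v.ofLp) i
    - (sCovector a b x ⬝ᵥ v.ofLp) / normSq a b x * raise a b i x with hX
  set Y : Fin n → Coord n → ℝ := fun i v => v.ofLp ⬝ᵥ sprayMat a x i *ᵥ v.ofLp
    + (v.ofLp ⬝ᵥ rMat a b x *ᵥ v.ofLp) / (2 * normSq a b x) * raise a b i x - R i v with hY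
  -- The spray identity times β, wedged with y: the pole becomes regular and both unknown multiples
  -- of y disappear. Hence Φ = 0 on β > 0, and by continuity at nonzero vectors with β = 0, where
  -- only the X-term survives.
  set Φ : Coord n → ℝ := fun v => (v.ofLp ⬝ᵥ a x *ᵥ v.ofLp) / 2 * (X i v * v j - X j v * v i)
    - (b x ⬝ᵥ v.ofLp) * (Y i v * v j - Y j v * v i) with hΦ
  have hΦ0 : ∀ v : Coord n, 0 < b x ⬝ᵥ v.ofLp → Φ v = 0 := by
    intro v hv
    have hb2' := hb2.ne'
    have e : ∀ i, (v.ofLp ⬝ᵥ a x *ᵥ v.ofLp) / 2 * X i v - (b x ⬝ᵥ v.ofLp) * Y i v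
        = (b x ⬝ᵥ v.ofLp) * (kropinaFactor a b x v - P v) * v i := by
      intro i
      have h1 := h v hv i
      rw [sprayCoeff_kropina' ha hv, alphaSpray_eq, rZeroZero_eq] at h1
      have h2 : R i v = _ - P v * v i := eq_sub_of_add_eq h1.symm
      simp only [hX, hY]
      rw [h2]
      field_simp
      ring
    simp only [hΦ]
    linear_combination v j * e i - v i * e j
  have hXc : ∀ i, Continuous (X i) := fun i => by
    have h1 : Continuous (fun v : Coord n => ((a x)⁻¹ *ᵥ sMat a b x *ᵥ v.ofLp) i) := by
      simp_rw [mulVec_mulVec]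
      exact (contDiff_linear _).continuous
    exact h1.sub (((contDiff_linear _).continuous.div_const _).mul continuous_const)
  have hv₀' : (WithLp.toLp 2 v₀).ofLp ≠ 0 := hv₀
  have hYc : ∀ i, ContinuousAt (Y i) (WithLp.toLp 2 v₀) := fun i =>
    ((contDiff_quadratic _).continuous.continuousAt.add
      (((contDiff_quadratic _).continuous.continuousAt.div_const _).mul continuousAt_const)).sub
      ((hR i).continuousAt (isOpen_ofLp_ne_zero.mem_nhds hv₀'))
  have hΦc : ContinuousAt Φ (WithLp.toLp 2 v₀) := by
    have hc : ∀ i, ContinuousAt (fun v : Coord n => v i) (WithLp.toLp 2 v₀) := fun i => by fun_prop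
    exact (((contDiff_quadratic _).continuous.continuousAt.div_const _).mul
      (((hXc i).continuousAt.mul (hc j)).sub ((hXc j).continuousAt.mul (hc i)))).sub
      ((contDiff_linear _).continuous.continuousAt.mul
        (((hYc i).mul (hc j)).sub ((hYc j).mul (hc i))))
  -- Moving along the components of b enters the half-space, as b·b > 0.
  have hline : Tendsto (fun t : ℝ => WithLp.toLp 2 v₀ + t • WithLp.toLp 2 (b x))
      (𝓝[>] 0) (𝓝 (WithLp.toLp 2 v₀)) := by
    have : ContinuousAt
        (fun t : ℝ => (WithLp.toLp 2 v₀ + t • WithLp.toLp 2 (b x) : Coord n)) 0 := by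
      fun_prop
    simpa [ContinuousAt] using this.tendsto.mono_left nhdsWithin_le_nhds
  have hzero : Φ (WithLp.toLp 2 v₀) = 0 := by
    refine tendsto_nhds_unique (hΦc.tendsto.comp hline) (tendsto_const_nhds.congr' ?_)
    filter_upwards [self_mem_nhdsWithin] with t ht
    refine (hΦ0 _ ?_).symm
    have hbb : 0 < b x ⬝ᵥ b x := by
      simpa using (dotProduct_self_star_pos_iff (v := b x)).2 ha.form_ne
    simpa [dotProduct_add, dotProduct_smul, hBv] using mul_pos ht hbb
  simp only [hΦ, hBv, zero_mul, sub_zero] at hzero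
  have := (mul_eq_zero.1 hzero).resolve_left (half_pos (ha.pos _ hv₀)).ne'
  exact sub_eq_zero.1 this

/-- The terms with α²s_0/β in the coefficients of T and b♯ cancel, leaving the quadratic form
`kropinaMat`. -/
theorem sprayCoeff_kropina_of_cond (ha : IsKropinaAt a b F x) (hc : KropinaCond a b x)
    {v : Coord n} (hv : 0 < b x ⬝ᵥ v.ofLp) (i : Fin n) :
    sprayCoeff F i x v = v.ofLp ⬝ᵥ (sprayMat a x i + kropinaMat a b x i) *ᵥ v.ofLp
      + kropinaFactor a b x v * v i := by
  have hb2 : normSq a b x ≠ 0 := (normSq_pos ha.pos ha.form_ne).ne'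
  rw [sprayCoeff_kropina' ha hv, hc, add_mulVec, dotProduct_add, kropinaMat_apply, alphaSpray_eq]
  field_simp
  ring

theorem douglasTensor_kropina_eq_zero (ha : IsKropinaAt a b F x) (hc : KropinaCond a b x)
    {v : Coord n} (hv : 0 < b x ⬝ᵥ v.ofLp) (i j k l : Fin n) :
    douglasTensor F i j k l x v = 0 := by
  refine douglasTensor_eq_zero (Ω := {v : Coord n | 0 < b x ⬝ᵥ v.ofLp}) (isOpen_halfSpace _)
    ((differentiableOn_kropinaFactor ha).differentiableOn (by simp)) (fun v hv t ht => ?_)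
    (fun v hv i => sprayCoeff_kropina_of_cond ha hc hv i) hv i j k l
  have hA := (ha.pos _ (ne_zero_of_mem_halfSpace hv)).ne'
  have hb2 : normSq a b x ≠ 0 := (normSq_pos ha.pos ha.form_ne).ne'
  simp only [kropinaFactor, rZeroZero_eq, WithLp.ofLp_smul, mulVec_smul, dotProduct_smul,
    smul_dotProduct, smul_eq_mul]
  field_simp

/-- A polynomial is continuous across β = 0, so the extension criterion applies. -/
theorem kropinaCond_of_douglas (ha : IsKropinaAt a b F x)
    (h : ∀ v : Coord n, 0 < b x ⬝ᵥ v.ofLp → ∀ i j k l, douglasTensor F i j k l x v = 0) :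
    KropinaCond a b x := by
  obtain ⟨q, c, c₀, P, hq⟩ := exists_quadratic_of_douglasTensor_eq_zero (isOpen_halfSpace (b x))
    (convex_halfSpace _) (contDiffOn_sprayCoeff_kropina ha) h
  refine kropinaCond_of_sprayCoeff_eq ha (fun i => Continuous.continuousOn ?_) hq
  exact ((contDiff_quadratic _).continuous.add (contDiff_linear _).continuous).add
    continuous_const

theorem exists_covDeriv_eq_of_douglas (hn : 2 ≤ n) (ha : IsBerwaldAt a b F x)
    (h : ∀ v : Coord n, v.ofLp ≠ 0 → ∀ i j k l, douglasTensor F i j k l x v = 0) :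
    ∃ τ : ℝ, ∀ i j, covDeriv a b i j x
      = 2 * τ * ((1 + 2 * normSq a b x) * a x i j - 3 * b x i * b x j) := by
  -- Integration needs a convex domain, so it is done on the half-space β > 0 inside the nonzero
  -- vectors.
  obtain ⟨q, c, c₀, P, hq⟩ := exists_quadratic_of_douglasTensor_eq_zero (isOpen_halfSpace (b x))
    (convex_halfSpace _) (fun i => (contDiffOn_sprayCoeff_berwald ha i).mono
      fun v hv => ne_zero_of_mem_halfSpace hv) fun v hv => h v (ne_zero_of_mem_halfSpace hv)
  exact exists_covDeriv_eq_of_sprayCoeff_eq ha hn (isOpen_halfSpace _)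
    (halfSpace_nonempty ha.form_ne) (fun v hv => ne_zero_of_mem_halfSpace hv)
    (fun i => ((PolyFun.quadratic (q i)).add (PolyFun.linear (c i))).add (PolyFun.const (c₀ i))) hq

/-- Quadratic forms `Qⁱ` with `Qⁱ(v) vʲ = Qʲ(v) vⁱ` are given by a linear form. -/
theorem quadratic_eq_linear_mul {Q : Fin n → Matrix (Fin n) (Fin n) ℝ}
    (h : ∀ (v : Coord n) (i j : Fin n),
      (v.ofLp ⬝ᵥ Q i *ᵥ v.ofLp) * v j = (v.ofLp ⬝ᵥ Q j *ᵥ v.ofLp) * v i) (v : Coord n)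
    (i : Fin n) : v.ofLp ⬝ᵥ Q i *ᵥ v.ofLp = ((fun k => Q k k k) ⬝ᵥ v.ofLp) * v i := by
  set c : Fin n → ℝ := fun k => ∑ m, (Q m + (Q m)ᵀ) m k with hc
  have hn : (n : ℝ) + 1 ≠ 0 := by positivity
  have key : ∀ (v : Coord n) (i : Fin n),
      ((n : ℝ) + 1) * (v.ofLp ⬝ᵥ Q i *ᵥ v.ofLp) = (c ⬝ᵥ v.ofLp) * v i := by
    intro v i
    -- Differentiate Q^i v^j = Q^j v^i in the j-th variable and sum over j. Euler's identity gives
    -- (2 + n)Q^i = c(v)v^i + Q^i, and the basis vectors identify c with (n + 1)Q^k_kk.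
    have h1 : ∀ j, ((Q i + (Q i)ᵀ) *ᵥ v.ofLp) j * v j + v.ofLp ⬝ᵥ Q i *ᵥ v.ofLp
        = ((Q j + (Q j)ᵀ) *ᵥ v.ofLp) j * v i
          + (v.ofLp ⬝ᵥ Q j *ᵥ v.ofLp) * if i = j then 1 else 0 := by
      intro j
      have h2 := congrArg (fun f => pd f j v) (funext fun v => h v i j)
      simp only at h2
      rw [pd_mul (differentiable_quadratic _ _) (differentiableAt_coord _ _),
        pd_mul (differentiable_quadratic _ _) (differentiableAt_coord _ _), pd_quadratic,
        pd_quadratic, pd_coord, pd_coord] at h2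
      simpa using h2
    have h2 := Finset.sum_congr (rfl : (Finset.univ : Finset (Fin n)) = _) fun j _ => h1 j
    simp only [Finset.sum_add_distrib, Finset.sum_const, Finset.card_univ, Fintype.card_fin,
      nsmul_eq_mul, mul_ite, mul_one, mul_zero, Finset.sum_ite_eq, Finset.mem_univ, if_true,
      ← Finset.sum_mul] at h2
    have h3 : ∑ j, ((Q i + (Q i)ᵀ) *ᵥ v.ofLp) j * v j = 2 * (v.ofLp ⬝ᵥ Q i *ᵥ v.ofLp) := by
      have e1 : ∑ j, ((Q i + (Q i)ᵀ) *ᵥ v.ofLp) j * v j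
        = ((Q i + (Q i)ᵀ) *ᵥ v.ofLp) ⬝ᵥ v.ofLp := rfl
      rw [e1, add_mulVec, add_dotProduct, mulVec_transpose, ← dotProduct_mulVec,
        dotProduct_comm]
      ring
    have h4 : ∑ j, ((Q j + (Q j)ᵀ) *ᵥ v.ofLp) j = c ⬝ᵥ v.ofLp := by
      simp only [hc, mulVec, dotProduct, Finset.sum_mul]
      exact Finset.sum_comm
    rw [h3, h4] at h2
    linear_combination h2
  have hck : ∀ k, c k = (n + 1) * Q k k k := fun k => by
    have := key (EuclideanSpace.single k 1) k
    simp at this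
    linarith
  have hcc : c ⬝ᵥ v.ofLp = (n + 1) * ((fun k => Q k k k) ⬝ᵥ v.ofLp) := by
    simp only [dotProduct, hck, Finset.mul_sum, mul_assoc]
  have := key v i
  rw [hcc] at this
  refine mul_left_cancel₀ hn ?_
  linear_combination this

/-! ### Comparison of the two sprays and the local form of θ. -/

section Pair

variable {a' : Coord n → Matrix (Fin n) (Fin n) ℝ} {b' : Coord n → Fin n → ℝ}
  {F' : Coord n → Coord n → ℝ}

/-- The matrix of the quadratic form which has to be of the form `θ yⁱ`. -/
def relationMat (a : Coord n → Matrix (Fin n) (Fin n) ℝ) (b : Coord n → Fin n → ℝ)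
    (a' : Coord n → Matrix (Fin n) (Fin n) ℝ) (b' : Coord n → Fin n → ℝ) (τ : ℝ)
    (x : Coord n) (i : Fin n) : Matrix (Fin n) (Fin n) ℝ :=
  sprayMat a x i - sprayMat a' x i - kropinaMat a' b' x i + (2 * τ * raise a b i x) • a x

theorem relationMat_apply (τ : ℝ) (v : Coord n) (i : Fin n) :
    v.ofLp ⬝ᵥ relationMat a b a' b' τ x i *ᵥ v.ofLp
      = alphaSpray a x v i - alphaSpray a' x v i - 1 / (2 * normSq a' b' x)
          * ((v.ofLp ⬝ᵥ a' x *ᵥ v.ofLp) * raise a' (sCovector a' b') i x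
            + rZeroZero a' b' x v * raise a' b' i x)
        + 2 * τ * (v.ofLp ⬝ᵥ a x *ᵥ v.ofLp) * raise a b i x := by
  rw [relationMat, add_mulVec, sub_mulVec, sub_mulVec, dotProduct_add, dotProduct_sub,
    dotProduct_sub, kropinaMat_apply, alphaSpray_eq, alphaSpray_eq, smul_mulVec, dotProduct_smul,
    smul_eq_mul]
  ring

/-- The spray of (α + β)²/α plays the role of the continuous extension, so no polynomiality is
needed yet. -/
theorem kropinaCond_of_projectivelyRelated (ha : IsBerwaldAt a b F x)
    (ha' : IsKropinaAt a' b' F' x) {P : Coord n → ℝ}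
    (h : ∀ v : Coord n, 0 < b' x ⬝ᵥ v.ofLp → ∀ i,
      sprayCoeff F i x v = sprayCoeff F' i x v + P v * v i) : KropinaCond a' b' x :=
  kropinaCond_of_sprayCoeff_eq ha' (R := fun i => sprayCoeff F i x) (P := fun v => -P v)
    (fun i => (contDiffOn_sprayCoeff_berwald ha i).continuousOn)
    fun v hv i => by rw [h v hv i]; ring

/-- The Kropina spray is already known to be quadratic modulo y, and this passes to the related
metric on the half-space β̄ > 0. -/
theorem exists_covDeriv_eq_of_projectivelyRelated (hn : 2 ≤ n) (ha : IsBerwaldAt a b F x)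
    (ha' : IsKropinaAt a' b' F' x) {P : Coord n → ℝ}
    (h : ∀ v : Coord n, 0 < b' x ⬝ᵥ v.ofLp → ∀ i,
      sprayCoeff F i x v = sprayCoeff F' i x v + P v * v i) :
    ∃ τ : ℝ, ∀ i j, covDeriv a b i j x
      = 2 * τ * ((1 + 2 * normSq a b x) * a x i j - 3 * b x i * b x j) := by
  have hc := kropinaCond_of_projectivelyRelated ha ha' h
  refine exists_covDeriv_eq_of_sprayCoeff_eq ha hn (isOpen_halfSpace (b' x))
    (halfSpace_nonempty ha'.form_ne) (fun v hv => ne_zero_of_mem_halfSpace hv)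
    (f := fun i v => v.ofLp ⬝ᵥ (sprayMat a' x i + kropinaMat a' b' x i) *ᵥ v.ofLp)
    (P := fun v => kropinaFactor a' b' x v + P v)
    (fun i => PolyFun.quadratic _) fun v hv i => ?_
  rw [h v hv, sprayCoeff_kropina_of_cond ha' hc hv]
  ring

/-- Both normal forms combined: all that can obstruct proportionality to y is the quadratic form of
`relationMat`. It serves both directions of (b). -/
theorem sprayCoeff_sub_eq (ha : IsBerwaldAt a b F x) (ha' : IsKropinaAt a' b' F' x)
    (hc : KropinaCond a' b' x) {τ : ℝ} (hτ : ∀ i j, covDeriv a b i j x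
      = 2 * τ * ((1 + 2 * normSq a b x) * a x i j - 3 * b x i * b x j))
    {v : Coord n} (hv : 0 < b' x ⬝ᵥ v.ofLp) (i : Fin n) :
    sprayCoeff F i x v - sprayCoeff F' i x v
      = v.ofLp ⬝ᵥ relationMat a b a' b' τ x i *ᵥ v.ofLp
        + (2 * τ * (Real.sqrt (v.ofLp ⬝ᵥ a x *ᵥ v.ofLp) - 2 * (b x ⬝ᵥ v.ofLp))
          - kropinaFactor a' b' x v) * v i := by
  rw [sprayCoeff_kropina_of_cond ha' hc hv,
    sprayCoeff_berwald_of_covDeriv ha hτ (ne_zero_of_mem_halfSpace hv), relationMat_apply,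
    add_mulVec, dotProduct_add, kropinaMat_apply, alphaSpray_eq (a := a'), alphaSpray_eq]
  ring

/-- The one-form `θ` in coordinates. -/
theorem relationMat_eq_of_projectivelyRelated (ha : IsBerwaldAt a b F x)
    (ha' : IsKropinaAt a' b' F' x) {P : Coord n → ℝ}
    (h : ∀ v : Coord n, 0 < b' x ⬝ᵥ v.ofLp → ∀ i,
      sprayCoeff F i x v = sprayCoeff F' i x v + P v * v i)
    {τ : ℝ} (hτ : ∀ i j, covDeriv a b i j x
      = 2 * τ * ((1 + 2 * normSq a b x) * a x i j - 3 * b x i * b x j)) (v : Coord n)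
    (i : Fin n) : v.ofLp ⬝ᵥ relationMat a b a' b' τ x i *ᵥ v.ofLp
      = ((fun k => relationMat a b a' b' τ x k k k) ⬝ᵥ v.ofLp) * v i := by
  have hc := kropinaCond_of_projectivelyRelated ha ha' h
  refine quadratic_eq_linear_mul (fun v i j => ?_) v i
  refine PolyFun.eq_of_eq_on_isOpen ((PolyFun.quadratic _).mul (PolyFun.coord j))
    ((PolyFun.quadratic _).mul (PolyFun.coord i)) (isOpen_halfSpace (b' x))
    (halfSpace_nonempty ha'.form_ne) (fun v hv => ?_) v
  have hi := sprayCoeff_sub_eq ha ha' hc hτ hv i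
  have hj := sprayCoeff_sub_eq ha ha' hc hτ hv j
  rw [h v hv] at hi hj
  linear_combination v i * hj - v j * hi

/-- Expresses the local θ on the half-space through P, τ, α, β and the Kropina factor, all scalars
on the tangent bundle. This yields its transformation law without transforming `relationMat`. -/
theorem linear_eq_of_projectivelyRelated (ha : IsBerwaldAt a b F x)
    (ha' : IsKropinaAt a' b' F' x) {P : Coord n → ℝ}
    (h : ∀ v : Coord n, 0 < b' x ⬝ᵥ v.ofLp → ∀ i,
      sprayCoeff F i x v = sprayCoeff F' i x v + P v * v i)
    {τ : ℝ} (hτ : ∀ i j, covDeriv a b i j x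
      = 2 * τ * ((1 + 2 * normSq a b x) * a x i j - 3 * b x i * b x j)) {v : Coord n}
    (hv : 0 < b' x ⬝ᵥ v.ofLp) :
    (fun k => relationMat a b a' b' τ x k k k) ⬝ᵥ v.ofLp
      = P v - (2 * τ * (Real.sqrt (v.ofLp ⬝ᵥ a x *ᵥ v.ofLp) - 2 * (b x ⬝ᵥ v.ofLp))
          - kropinaFactor a' b' x v) := by
  have hc := kropinaCond_of_projectivelyRelated ha ha' h
  obtain ⟨i, hi⟩ : ∃ i, v i ≠ 0 := by
    by_contra! hcon
    exact ne_zero_of_mem_halfSpace hv (funext hcon)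
  have h1 := sprayCoeff_sub_eq ha ha' hc hτ hv i
  rw [h v hv, relationMat_eq_of_projectivelyRelated ha ha' h hτ] at h1
  refine mul_right_cancel₀ hi ?_
  linear_combination -h1

end Pair

end Kropina

/-! ### Behaviour of the local expressions under a change of coordinates. -/

section Transition

theorem fderiv_linear_comp {b : Coord n → Fin n → ℝ} {φ f : Coord n → Coord n} {x : Coord n}
    (hb : ∀ i, DifferentiableAt ℝ (fun z => b z i) (φ x)) (hφ : DifferentiableAt ℝ φ x)
    (hf : DifferentiableAt ℝ f x) (l : Coord n) :
    fderiv ℝ (fun u => b (φ u) ⬝ᵥ (f u).ofLp) x l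
      = b (φ x) ⬝ᵥ (fderiv ℝ f x l).ofLp
        + fderiv ℝ (fun z => b z ⬝ᵥ (f x).ofLp) (φ x) (fderiv ℝ φ x l) := by
  have h1 : ∀ i, HasFDerivAt (fun u => b (φ u) i) _ x := fun i =>
    (hb i).hasFDerivAt.comp x hφ.hasFDerivAt
  have h2 : ∀ i, HasFDerivAt (fun u => f u i)
      ((EuclideanSpace.proj i : Coord n →L[ℝ] ℝ).comp (fderiv ℝ f x)) x := fun i =>
    (EuclideanSpace.proj i : Coord n →L[ℝ] ℝ).hasFDerivAt.comp x hf.hasFDerivAt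
  have h3 : HasFDerivAt (fun u => b (φ u) ⬝ᵥ (f u).ofLp) _ x :=
    HasFDerivAt.fun_sum fun i _ => (h1 i).fun_mul (h2 i)
  have h4 : HasFDerivAt (fun z => b z ⬝ᵥ (f x).ofLp) _ (φ x) :=
    HasFDerivAt.fun_sum fun i _ => (hb i).hasFDerivAt.mul_const (f x i)
  rw [h3.fderiv, h4.fderiv]
  simp [Finset.sum_add_distrib, dotProduct]

/-- The linear version is applied twice, with the other vector argument frozen each time. -/
theorem fderiv_bilinear_comp {a : Coord n → Matrix (Fin n) (Fin n) ℝ}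
    {φ f g : Coord n → Coord n} {x : Coord n}
    (ha : ∀ i j, DifferentiableAt ℝ (fun z => a z i j) (φ x)) (hφ : DifferentiableAt ℝ φ x)
    (hf : DifferentiableAt ℝ f x) (hg : DifferentiableAt ℝ g x) (l : Coord n) :
    fderiv ℝ (fun u => (f u).ofLp ⬝ᵥ a (φ u) *ᵥ (g u).ofLp) x l
      = (fderiv ℝ f x l).ofLp ⬝ᵥ a (φ x) *ᵥ (g x).ofLp
        + (f x).ofLp ⬝ᵥ a (φ x) *ᵥ (fderiv ℝ g x l).ofLp
        + fderiv ℝ (fun z => (f x).ofLp ⬝ᵥ a z *ᵥ (g x).ofLp) (φ x) (fderiv ℝ φ x l) := by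
  have hgj : ∀ j, DifferentiableAt ℝ (fun u => g u j) x := fun j => by fun_prop
  have h1 : ∀ i, DifferentiableAt ℝ (fun u => (a (φ u) *ᵥ (g u).ofLp) i) x := fun i => by
    simp only [mulVec, dotProduct]
    exact DifferentiableAt.fun_sum fun j _ => ((ha i j).comp x hφ).fun_mul (hgj j)
  have h2 : ∀ i, DifferentiableAt ℝ (fun z => ((f x).ofLp ᵥ* a z) i) (φ x) := fun i => by
    simp only [vecMul, dotProduct]
    fun_prop
  have e1 : (fun u => (f u).ofLp ⬝ᵥ a (φ u) *ᵥ (g u).ofLp)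
      = fun u => (a (φ u) *ᵥ (g u).ofLp) ⬝ᵥ (f u).ofLp :=
    funext fun u => dotProduct_comm _ _
  have e2 : (fun z => (a (φ z) *ᵥ (g z).ofLp) ⬝ᵥ (f x).ofLp)
      = fun z => ((f x).ofLp ᵥ* a (φ z)) ⬝ᵥ (g z).ofLp :=
    funext fun z => by rw [dotProduct_comm, dotProduct_mulVec]
  rw [e1]
  refine (fderiv_linear_comp (b := fun u => a (φ u) *ᵥ (g u).ofLp) (φ := id) h1
    differentiableAt_id hf l).trans ?_
  rw [id, e2, fderiv_linear_comp (b := fun z => (f x).ofLp ᵥ* a z) h2 hφ hg]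
  simp only [← dotProduct_mulVec, fderiv_id, ContinuousLinearMap.id_apply]
  rw [dotProduct_comm (a (φ x) *ᵥ _)]
  ring

/-- Directional derivatives replace indices, so that the pullback formula for the metric can be
substituted directly. -/
theorem dotProduct_mulVec_alphaSpray {a : Coord n → Matrix (Fin n) (Fin n) ℝ} {x : Coord n}
    (hdet : IsUnit (a x).det) (ha : ∀ i j, DifferentiableAt ℝ (fun u => a u i j) x)
    (y l : Coord n) : l.ofLp ⬝ᵥ a x *ᵥ alphaSpray a x y
      = 1 / 2 * fderiv ℝ (fun u => l.ofLp ⬝ᵥ a u *ᵥ y.ofLp) x y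
        - 1 / 4 * fderiv ℝ (fun u => y.ofLp ⬝ᵥ a u *ᵥ y.ofLp) x l := by
  have h1 : ∀ k, pd (fun u => l.ofLp ⬝ᵥ a u *ᵥ y.ofLp) k x
      = ∑ i, l i * ∑ j, pd (fun u => a u i j) k x * y j := fun k => by
    simp only [dotProduct, mulVec]
    rw [pd_sum _ fun i _ => by fun_prop]
    refine Finset.sum_congr rfl fun i _ => ?_
    rw [pd_const_mul (by fun_prop), pd_sum _ fun i _ => by fun_prop]
    simp_rw [fun j => pd_mul_const (ha i j) (y j) k]
  rw [fderiv_eq_sum_pd, fderiv_eq_sum_pd]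
  simp_rw [h1, pd_quadratic_left ha]
  have e : l.ofLp ⬝ᵥ a x *ᵥ alphaSpray a x y = ∑ i, l i * (1 / 2 * ∑ k, y k *
      ∑ j, pd (fun u => a u i j) k x * y j
        - 1 / 4 * ∑ j, ∑ k, pd (fun u => a u j k) i x * y j * y k) :=
    Finset.sum_congr rfl fun i _ => by rw [mulVec_alphaSpray hdet]
  rw [e]
  have e2 : ∀ i, l i * (1 / 2 * ∑ k, y k * ∑ j, pd (fun u => a u i j) k x * y j
      - 1 / 4 * ∑ j, ∑ k, pd (fun u => a u j k) i x * y j * y k)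
      = 1 / 2 * (l i * ∑ k, y k * ∑ j, pd (fun u => a u i j) k x * y j)
      - 1 / 4 * ((∑ j, ∑ k, pd (fun u => a u j k) i x * y j * y k) * l i) := fun i => by ring
  simp_rw [e2, Finset.sum_sub_distrib, ← Finset.mul_sum]
  congr 2
  simp only [Finset.mul_sum, Finset.sum_mul]
  rw [Finset.sum_comm]
  exact Finset.sum_congr rfl fun j _ => Finset.sum_congr rfl fun k _ =>
    Finset.sum_congr rfl fun m _ => by ring

theorem dotProduct_sMat_mulVec {a : Coord n → Matrix (Fin n) (Fin n) ℝ}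
    {b : Coord n → Fin n → ℝ} {x : Coord n} (hsym : ∀ u, (a u).IsSymm)
    (hb : ∀ i, DifferentiableAt ℝ (fun u => b u i) x) (v w : Coord n) :
    v.ofLp ⬝ᵥ sMat a b x *ᵥ w.ofLp
      = 1 / 2 * (fderiv ℝ (fun u => b u ⬝ᵥ v.ofLp) x w
        - fderiv ℝ (fun u => b u ⬝ᵥ w.ofLp) x v) := by
  rw [fderiv_eq_sum_pd, fderiv_eq_sum_pd]
  simp_rw [pd_linear_left hb]
  simp only [dotProduct, mulVec, sMat, of_apply, sTensor_eq hsym, Finset.mul_sum, Finset.sum_mul]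
  rw [Finset.sum_comm (f := fun j i => pd (fun u => b u i) j x * v i * w j),
    ← Finset.sum_sub_distrib, Finset.mul_sum]
  refine Finset.sum_congr rfl fun j _ => ?_
  rw [← Finset.sum_sub_distrib, Finset.mul_sum]
  exact Finset.sum_congr rfl fun k _ => by ring

variable {a a' : Coord n → Matrix (Fin n) (Fin n) ℝ} {b b' : Coord n → Fin n → ℝ}
  {φ : Coord n → Coord n} {x : Coord n}

/-- The data `(a, b)` at `x` are the pullback of `(a', b')` at `φ x`. -/
structure IsPullbackAt (a : Coord n → Matrix (Fin n) (Fin n) ℝ) (b : Coord n → Fin n → ℝ)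
    (a' : Coord n → Matrix (Fin n) (Fin n) ℝ) (b' : Coord n → Fin n → ℝ)
    (φ : Coord n → Coord n) (x : Coord n) : Prop where
  metric : IsMetricAt a x
  metric' : IsMetricAt a' (φ x)
  form : ∀ i, DifferentiableAt ℝ (fun u => b u i) x
  form' : ∀ i, DifferentiableAt ℝ (fun u => b' u i) (φ x)
  smooth : ContDiffAt ℝ ∞ φ x
  surj : Function.Surjective (fderiv ℝ φ x)
  metric_eq : ∀ᶠ u in 𝓝 x, ∀ v w : Coord n, v.ofLp ⬝ᵥ a u *ᵥ w.ofLp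
    = (fderiv ℝ φ u v).ofLp ⬝ᵥ a' (φ u) *ᵥ (fderiv ℝ φ u w).ofLp
  form_eq : ∀ᶠ u in 𝓝 x, ∀ v : Coord n, b u ⬝ᵥ v.ofLp = b' (φ u) ⬝ᵥ (fderiv ℝ φ u v).ofLp

namespace IsPullbackAt

/-- Surjectivity of Dφ allows testing against z − w itself, where definiteness of a' decides. -/
theorem eq_of_dotProduct (h : IsPullbackAt a b a' b' φ x) {z w : Fin n → ℝ}
    (hzw : ∀ l : Coord n, (fderiv ℝ φ x l).ofLp ⬝ᵥ a' (φ x) *ᵥ z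
      = (fderiv ℝ φ x l).ofLp ⬝ᵥ a' (φ x) *ᵥ w) : z = w := by
  by_contra hne
  obtain ⟨l, hl⟩ := h.surj (WithLp.toLp 2 (z - w))
  have h1 := hzw l
  have h2 := h.metric'.pos (z - w) (sub_ne_zero.2 hne)
  rw [hl] at h1
  rw [mulVec_sub, dotProduct_sub] at h2
  simp only at h1
  linarith

theorem fderiv_raise (h : IsPullbackAt a b a' b' φ x) :
    (fderiv ℝ φ x (WithLp.toLp 2 ((a x)⁻¹ *ᵥ b x))).ofLp = (a' (φ x))⁻¹ *ᵥ b' (φ x) := by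
  refine h.eq_of_dotProduct fun l => ?_
  have h1 := h.metric_eq.self_of_nhds l (WithLp.toLp 2 ((a x)⁻¹ *ᵥ b x))
  rw [← h1, mulVec_inv_mulVec h.metric'.pos, dotProduct_comm _ (b' _),
    ← h.form_eq.self_of_nhds l]
  simp only
  rw [mulVec_inv_mulVec h.metric.pos, dotProduct_comm]

theorem normSq_eq (h : IsPullbackAt a b a' b' φ x) : normSq a b x = normSq a' b' (φ x) := by
  rw [ProjFinsler.normSq_eq, ProjFinsler.normSq_eq, dotProduct_comm, ← h.fderiv_raise,
    dotProduct_comm _ (b' _)]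
  exact h.form_eq.self_of_nhds (WithLp.toLp 2 ((a x)⁻¹ *ᵥ b x))

theorem differentiableAt_fderiv (h : IsPullbackAt a b a' b' φ x) :
    DifferentiableAt ℝ (fderiv ℝ φ) x :=
  (h.smooth.fderiv_right (m := ∞) (by simp)).differentiableAt (by simp)

theorem differentiableAt (h : IsPullbackAt a b a' b' φ x) : DifferentiableAt ℝ φ x :=
  h.smooth.differentiableAt (by simp)

theorem hasFDerivAt_fderiv_apply (h : IsPullbackAt a b a' b' φ x) (v : Coord n) :
    HasFDerivAt (fun u => fderiv ℝ φ u v) ((fderiv ℝ (fderiv ℝ φ) x).flip v) x := by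
  have := h.differentiableAt_fderiv.hasFDerivAt.clm_apply (hasFDerivAt_const v x)
  refine this.congr_fderiv (ContinuousLinearMap.ext fun w => by simp)

theorem fderiv_fderiv_comm (h : IsPullbackAt a b a' b' φ x) (v w : Coord n) :
    fderiv ℝ (fderiv ℝ φ) x v w = fderiv ℝ (fderiv ℝ φ) x w v :=
  (h.smooth.isSymmSndFDerivAt (by simpa using ENat.LEInfty.out)).eq v w

theorem fderiv_form (h : IsPullbackAt a b a' b' φ x) (v w : Coord n) :
    fderiv ℝ (fun u => b u ⬝ᵥ v.ofLp) x w
      = b' (φ x) ⬝ᵥ (fderiv ℝ (fderiv ℝ φ) x w v).ofLp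
        + fderiv ℝ (fun z => b' z ⬝ᵥ (fderiv ℝ φ x v).ofLp) (φ x) (fderiv ℝ φ x w) := by
  have e : (fun u => b u ⬝ᵥ v.ofLp) =ᶠ[𝓝 x] fun u => b' (φ u) ⬝ᵥ (fderiv ℝ φ u v).ofLp := by
    filter_upwards [h.form_eq] with u hu using hu v
  rw [e.fderiv_eq, fderiv_linear_comp h.form' h.differentiableAt
    (h.hasFDerivAt_fderiv_apply v).differentiableAt, (h.hasFDerivAt_fderiv_apply v).fderiv]
  rfl

theorem fderiv_metric (h : IsPullbackAt a b a' b' φ x) (v w l : Coord n) :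
    fderiv ℝ (fun u => v.ofLp ⬝ᵥ a u *ᵥ w.ofLp) x l
      = (fderiv ℝ (fderiv ℝ φ) x l v).ofLp ⬝ᵥ a' (φ x) *ᵥ (fderiv ℝ φ x w).ofLp
        + (fderiv ℝ φ x v).ofLp ⬝ᵥ a' (φ x) *ᵥ (fderiv ℝ (fderiv ℝ φ) x l w).ofLp
        + fderiv ℝ (fun z => (fderiv ℝ φ x v).ofLp ⬝ᵥ a' z *ᵥ (fderiv ℝ φ x w).ofLp) (φ x)
          (fderiv ℝ φ x l) := by
  have e : (fun u => v.ofLp ⬝ᵥ a u *ᵥ w.ofLp) =ᶠ[𝓝 x]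
      fun u => (fderiv ℝ φ u v).ofLp ⬝ᵥ a' (φ u) *ᵥ (fderiv ℝ φ u w).ofLp := by
    filter_upwards [h.metric_eq] with u hu using hu v w
  rw [e.fderiv_eq, fderiv_bilinear_comp h.metric'.diff h.differentiableAt
    (h.hasFDerivAt_fderiv_apply v).differentiableAt
    (h.hasFDerivAt_fderiv_apply w).differentiableAt, (h.hasFDerivAt_fderiv_apply v).fderiv,
    (h.hasFDerivAt_fderiv_apply w).fderiv]
  rfl

/-- The terms with second derivatives of φ are symmetric and drop out of the antisymmetrization. -/
theorem sMat_eq (h : IsPullbackAt a b a' b' φ x) (v w : Coord n) :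
    v.ofLp ⬝ᵥ sMat a b x *ᵥ w.ofLp
      = (fderiv ℝ φ x v).ofLp ⬝ᵥ sMat a' b' (φ x) *ᵥ (fderiv ℝ φ x w).ofLp := by
  rw [dotProduct_sMat_mulVec h.metric.symm h.form, dotProduct_sMat_mulVec h.metric'.symm h.form',
    h.fderiv_form, h.fderiv_form, h.fderiv_fderiv_comm v w]
  ring

theorem sCovector_eq (h : IsPullbackAt a b a' b' φ x) (v : Coord n) :
    sCovector a b x ⬝ᵥ v.ofLp = sCovector a' b' (φ x) ⬝ᵥ (fderiv ℝ φ x v).ofLp := by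
  rw [ProjFinsler.sCovector_eq, ProjFinsler.sCovector_eq, ← dotProduct_mulVec,
    ← dotProduct_mulVec, ← h.fderiv_raise]
  exact h.sMat_eq (WithLp.toLp 2 ((a x)⁻¹ *ᵥ b x)) v

/-- The spray is not a tensor: its inhomogeneous term ½D²φ(y, y) comes from differentiating the
pullback formula for the metric. -/
theorem fderiv_alphaSpray (h : IsPullbackAt a b a' b' φ x) (y : Coord n) :
    (fderiv ℝ φ x (WithLp.toLp 2 (alphaSpray a x y))).ofLp
      = alphaSpray a' (φ x) (fderiv ℝ φ x y)
        + (1 / 2 : ℝ) • (fderiv ℝ (fderiv ℝ φ) x y y).ofLp := by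
  refine h.eq_of_dotProduct fun l => ?_
  have h1 := h.metric_eq.self_of_nhds l (WithLp.toLp 2 (alphaSpray a x y))
  rw [← h1, mulVec_add, dotProduct_add, mulVec_smul, dotProduct_smul,
    dotProduct_mulVec_alphaSpray (isUnit_det_of_pos h.metric'.pos) h.metric'.diff]
  simp only
  rw [dotProduct_mulVec_alphaSpray (isUnit_det_of_pos h.metric.pos) h.metric.diff,
    h.fderiv_metric, h.fderiv_metric, h.fderiv_fderiv_comm y l,
    dotProduct_mulVec_comm_of_isSymm (h.metric'.symm (φ x)) (fderiv ℝ φ x y).ofLp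
      (fderiv ℝ (fderiv ℝ φ) x l y).ofLp, smul_eq_mul]
  ring

/-- The D²φ term in the derivative of β along y cancels the one carried by the spray. -/
theorem rZeroZero_eq (h : IsPullbackAt a b a' b' φ x) (y : Coord n) :
    rZeroZero a b x y = rZeroZero a' b' (φ x) (fderiv ℝ φ x y) := by
  have key : ∀ {a : Coord n → Matrix (Fin n) (Fin n) ℝ} {b : Coord n → Fin n → ℝ} {x : Coord n},
      (∀ i, DifferentiableAt ℝ (fun u => b u i) x) → ∀ y : Coord n, rZeroZero a b x y
        = fderiv ℝ (fun u => b u ⬝ᵥ y.ofLp) x y - 2 * (b x ⬝ᵥ alphaSpray a x y) := by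
    intro a b x hb y
    rw [rZeroZero_eq_sub, fderiv_eq_sum_pd]
    simp_rw [pd_linear_left hb, mul_comm]
  have h1 := h.form_eq.self_of_nhds (WithLp.toLp 2 (alphaSpray a x y))
  rw [h.fderiv_alphaSpray, dotProduct_add, dotProduct_smul, smul_eq_mul] at h1
  simp only at h1
  rw [key h.form, key h.form', h.fderiv_form, h1]
  ring

end IsPullbackAt

end Transition

/-! ### Metrics, forms and tangent vectors in charts of the maximal atlas. -/

section Chart

theorem clm_eq_dotProduct (L : Coord n →L[ℝ] ℝ) (v : Coord n) :
    L v = (fun i => L (EuclideanSpace.single i 1)) ⬝ᵥ v.ofLp := by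
  conv_lhs => rw [← (EuclideanSpace.basisFun (Fin n) ℝ).sum_repr v]
  simp [dotProduct, mul_comm]

theorem eventually_transition {M : Type*} [TopologicalSpace M]
    {e e₂ : OpenPartialHomeomorph M (Coord n)} {u : Coord n} (hu : u ∈ e.target)
    (hu₂ : e.symm u ∈ e₂.source) :
    ∀ᶠ w in 𝓝 u, w ∈ e.target ∧ e.symm w ∈ e₂.source :=
  (e.open_target.eventually_mem hu).and
    ((e.continuousAt_symm hu).eventually (e₂.open_source.eventually_mem hu₂))

variable {M : Type*} [TopologicalSpace M] [ChartedSpace (Coord n) M]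
  {e e₂ : OpenPartialHomeomorph M (Coord n)}

theorem mdifferentiable_of_mem (he : e ∈ IsManifold.maximalAtlas (𝓡 n) ∞ M) :
    e.MDifferentiable (𝓡 n) (𝓡 n) :=
  ⟨(contMDiffOn_of_mem_maximalAtlas he).mdifferentiableOn (by simp),
    (contMDiffOn_symm_of_mem_maximalAtlas he).mdifferentiableOn (by simp)⟩

theorem contDiffAt_transition (he : e ∈ IsManifold.maximalAtlas (𝓡 n) ∞ M)
    (he₂ : e₂ ∈ IsManifold.maximalAtlas (𝓡 n) ∞ M) {u : Coord n} (hu : u ∈ e.target)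
    (hu₂ : e.symm u ∈ e₂.source) : ContDiffAt ℝ ∞ (e₂ ∘ e.symm) u :=
  contMDiffAt_iff_contDiffAt.1 ((contMDiffAt_of_mem_maximalAtlas he₂ hu₂).comp u
    (contMDiffAt_symm_of_mem_maximalAtlas he hu))

theorem mfderiv_symm_bijective (he : e ∈ IsManifold.maximalAtlas (𝓡 n) ∞ M) {u : Coord n}
    (hu : u ∈ e.target) : Function.Bijective (mfderiv (𝓡 n) (𝓡 n) e.symm u) :=
  (mdifferentiable_of_mem he).symm.mfderiv_bijective hu

/-- The chain rule for e.symm = e₂.symm ∘ (e₂ ∘ e.symm). The two sides lie in tangent spaces at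
points that are only propositionally equal, so they are compared in the model space. -/
theorem mfderiv_symm_transition (he : e ∈ IsManifold.maximalAtlas (𝓡 n) ∞ M)
    (he₂ : e₂ ∈ IsManifold.maximalAtlas (𝓡 n) ∞ M) {u : Coord n} (hu : u ∈ e.target)
    (hu₂ : e.symm u ∈ e₂.source) (v : Coord n) :
    (show Coord n from mfderiv (𝓡 n) (𝓡 n) e.symm u v)
      = mfderiv (𝓡 n) (𝓡 n) e₂.symm (e₂ (e.symm u)) (fderiv ℝ (e₂ ∘ e.symm) u v) := by
  have h1 : e.symm =ᶠ[𝓝 u] e₂.symm ∘ (e₂ ∘ e.symm) := by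
    filter_upwards [eventually_transition hu hu₂] with w hw
    exact (e₂.left_inv hw.2).symm
  have hd := (contDiffAt_transition he he₂ hu hu₂).differentiableAt (by simp)
  have h2 := mfderiv_comp u (I' := 𝓡 n) (g := e₂.symm) (f := e₂ ∘ e.symm)
    ((mdifferentiable_of_mem he₂).mdifferentiableAt_symm (e₂.map_source hu₂))
    hd.mdifferentiableAt
  have h3 := h1.mfderiv_eq (I := 𝓡 n) (I' := 𝓡 n)
  rw [mfderiv_eq_fderiv] at h2
  exact congrArg (fun L : Coord n →L[ℝ] Coord n => L v) (h3.trans h2)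

theorem mfderiv_symm_ne_zero (he : e ∈ IsManifold.maximalAtlas (𝓡 n) ∞ M) {u : Coord n}
    (hu : u ∈ e.target) {v : Coord n} (hv : v.ofLp ≠ 0) :
    mfderiv (𝓡 n) (𝓡 n) e.symm u v ≠ 0 := fun h =>
  hv (by
    have h1 : v = 0 := (mfderiv_symm_bijective he hu).1 (h.trans (map_zero _).symm)
    rw [h1]; rfl)

theorem inChart_transition (he : e ∈ IsManifold.maximalAtlas (𝓡 n) ∞ M)
    (he₂ : e₂ ∈ IsManifold.maximalAtlas (𝓡 n) ∞ M) {u : Coord n} (hu : u ∈ e.target)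
    (hu₂ : e.symm u ∈ e₂.source) (F : ∀ x : M, TangentSpace (𝓡 n) x → ℝ) (v : Coord n) :
    inChart e F u v = inChart e₂ F (e₂ (e.symm u)) (fderiv ℝ (e₂ ∘ e.symm) u v) :=
  congrArg₂ (fun (x : M) (y : Coord n) => F x y) (e₂.left_inv hu₂).symm
    (mfderiv_symm_transition he he₂ hu hu₂ v)

theorem surjective_fderiv_transition (he : e ∈ IsManifold.maximalAtlas (𝓡 n) ∞ M)
    (he₂ : e₂ ∈ IsManifold.maximalAtlas (𝓡 n) ∞ M) {u : Coord n} (hu : u ∈ e.target)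
    (hu₂ : e.symm u ∈ e₂.source) : Function.Surjective (fderiv ℝ (e₂ ∘ e.symm) u) := fun w => by
  obtain ⟨v, hv⟩ := (mfderiv_symm_bijective he hu).2
    (show TangentSpace (𝓡 n) (e.symm u) from
      (show Coord n from mfderiv (𝓡 n) (𝓡 n) e₂.symm (e₂ (e.symm u)) w))
  exact ⟨v, (mfderiv_symm_bijective he₂ (e₂.map_source hu₂)).1
    ((mfderiv_symm_transition he he₂ hu hu₂ v).symm.trans hv)⟩

variable [IsManifold (𝓡 n) ∞ M]

theorem formCoeff_dotProduct (β : OneForm n M) (u v : Coord n) :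
    formCoeff e β u ⬝ᵥ v.ofLp = inChart e (formFn β) u v :=
  (clm_eq_dotProduct ((show TangentSpace (𝓡 n) (e.symm u) →L[ℝ] ℝ from β (e.symm u)).comp
    (mfderiv (𝓡 n) (𝓡 n) e.symm u)) v).symm

theorem dotProduct_metricCoeff (α : Metric n M) (u v w : Coord n) :
    v.ofLp ⬝ᵥ metricCoeff e α u *ᵥ w.ofLp = α.inner (e.symm u)
      (mfderiv (𝓡 n) (𝓡 n) e.symm u v) (mfderiv (𝓡 n) (𝓡 n) e.symm u w) := by
  have h1 := clm_eq_dotProduct ((α.inner (e.symm u) (mfderiv (𝓡 n) (𝓡 n) e.symm u w)).comp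
    (mfderiv (𝓡 n) (𝓡 n) e.symm u)) v
  rw [α.symm]
  refine Eq.trans ?_ h1.symm
  rw [dotProduct_comm]
  congr 1
  funext i
  refine ((clm_eq_dotProduct ((α.inner (e.symm u)
    (mfderiv (𝓡 n) (𝓡 n) e.symm u (EuclideanSpace.single i 1))).comp
      (mfderiv (𝓡 n) (𝓡 n) e.symm u)) w).symm).trans (α.symm _ _ _)

theorem inChart_alphaFn (α : Metric n M) (u v : Coord n) :
    inChart e (alphaFn α) u v = Real.sqrt (v.ofLp ⬝ᵥ metricCoeff e α u *ᵥ v.ofLp) := by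
  rw [dotProduct_metricCoeff]; rfl

theorem contMDiffOn_mfderiv_symm (he : e ∈ IsManifold.maximalAtlas (𝓡 n) ∞ M) (v : Coord n) :
    ContMDiffOn (𝓡 n) (𝓡 n).tangent ∞
      (fun u => (⟨e.symm u, mfderiv (𝓡 n) (𝓡 n) e.symm u v⟩ : TangentBundle (𝓡 n) M)) e.target := by
  have h1 := (contMDiffOn_symm_of_mem_maximalAtlas he).contMDiffOn_tangentMapWithin (m := ∞)
    (by simp) e.open_target.uniqueMDiffOn
  have h2 : ContMDiff (𝓡 n) (𝓡 n).tangent ∞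
      (fun u : Coord n => (⟨u, v⟩ : TangentBundle (𝓡 n) (Coord n))) :=
    contMDiff_vectorSpace_iff_contDiff.2 contDiff_const
  refine (h1.comp h2.contMDiffOn (s := e.target) fun u hu => hu).congr fun u hu => ?_
  simp only [Function.comp, tangentMapWithin]
  rw [mfderivWithin_of_isOpen e.open_target hu]

theorem contDiffOn_formCoeff (he : e ∈ IsManifold.maximalAtlas (𝓡 n) ∞ M) (β : OneForm n M)
    (i : Fin n) : ContDiffOn ℝ ∞ (fun u => formCoeff e β u i) e.target := by
  have h1 := (β.contMDiff.comp_contMDiffOn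
    (contMDiffOn_symm_of_mem_maximalAtlas he)).clm_bundle_apply
    (contMDiffOn_mfderiv_symm he (EuclideanSpace.single i 1))
  rw [← contMDiffOn_iff_contDiffOn]
  intro u hu
  exact (Bundle.contMDiffWithinAt_totalSpace.1 (h1 u hu)).2

theorem contDiffOn_metricCoeff (he : e ∈ IsManifold.maximalAtlas (𝓡 n) ∞ M) (α : Metric n M)
    (i j : Fin n) : ContDiffOn ℝ ∞ (fun u => metricCoeff e α u i j) e.target := by
  have h0 := α.contMDiff.comp_contMDiffOn (contMDiffOn_symm_of_mem_maximalAtlas he)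
  have h1 := ContMDiffOn.clm_bundle_apply₂ (F₃ := ℝ) (E₃ := Bundle.Trivial M ℝ) h0
    (contMDiffOn_mfderiv_symm he (EuclideanSpace.single i 1))
    (contMDiffOn_mfderiv_symm he (EuclideanSpace.single j 1))
  rw [← contMDiffOn_iff_contDiffOn]
  intro u hu
  exact (Bundle.contMDiffWithinAt_totalSpace.1 (h1 u hu)).2

theorem isMetricAt_metricCoeff (he : e ∈ IsManifold.maximalAtlas (𝓡 n) ∞ M) (α : Metric n M)
    {u : Coord n} (hu : u ∈ e.target) : IsMetricAt (metricCoeff e α) u where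
  symm u := Matrix.IsSymm.ext fun i j => α.symm _ _ _
  nonneg u w := by
    rw [show w = (WithLp.toLp 2 w : Coord n).ofLp from rfl, dotProduct_metricCoeff]
    by_cases h : mfderiv (𝓡 n) (𝓡 n) e.symm u (WithLp.toLp 2 w) = 0
    -- Off the chart target the derivative of e.symm may kill nonzero vectors, so only nonnegativity
    -- is available at every u.
    · rw [h]; simp
    · exact (α.pos _ _ h).le
  pos v hv := by
    rw [show v = (WithLp.toLp 2 v : Coord n).ofLp from rfl, dotProduct_metricCoeff]
    exact α.pos _ _ (mfderiv_symm_ne_zero he hu hv)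
  diff i j := ((contDiffOn_metricCoeff he α i j).contDiffAt
    (e.open_target.mem_nhds hu)).differentiableAt (by simp)

theorem differentiableAt_formCoeff (he : e ∈ IsManifold.maximalAtlas (𝓡 n) ∞ M)
    (β : OneForm n M) {u : Coord n} (hu : u ∈ e.target) (i : Fin n) :
    DifferentiableAt ℝ (fun u => formCoeff e β u i) u :=
  ((contDiffOn_formCoeff he β i).contDiffAt (e.open_target.mem_nhds hu)).differentiableAt (by simp)

theorem formCoeff_ne_zero (he : e ∈ IsManifold.maximalAtlas (𝓡 n) ∞ M) {β : OneForm n M}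
    (hβ : ∀ x, β x ≠ 0) {u : Coord n} (hu : u ∈ e.target) : formCoeff e β u ≠ 0 := fun h =>
  hβ (e.symm u) (ContinuousLinearMap.ext fun y => by
    obtain ⟨v, rfl⟩ := (mfderiv_symm_bijective he hu).2 y
    have h1 := formCoeff_dotProduct (e := e) β u v
    rw [h, zero_dotProduct] at h1
    exact h1.symm)

theorem isBerwaldAt_berwaldFn (he : e ∈ IsManifold.maximalAtlas (𝓡 n) ∞ M) {α : Metric n M}
    {β : OneForm n M} (hβ : ∀ x, β x ≠ 0)
    (hαβ : ∀ (x : M) (y : TangentSpace (𝓡 n) x), y ≠ 0 → |formFn β x y| < alphaFn α x y)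
    {u : Coord n} (hu : u ∈ e.target) :
    IsBerwaldAt (metricCoeff e α) (formCoeff e β) (inChart e (berwaldFn α β)) u where
  toIsMetricAt := isMetricAt_metricCoeff he α hu
  eq u w := by rw [← inChart_alphaFn, formCoeff_dotProduct]; rfl
  diff_form := differentiableAt_formCoeff he β hu
  form_ne := formCoeff_ne_zero he hβ hu
  lt v hv := by
    have h1 := hαβ (e.symm u) _ (mfderiv_symm_ne_zero he hu (v := WithLp.toLp 2 v) hv)
    rw [show v = (WithLp.toLp 2 v : Coord n).ofLp from rfl, dotProduct_metricCoeff,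
      formCoeff_dotProduct, ← sq_abs]
    exact (Real.lt_sqrt (abs_nonneg _)).1 h1

theorem isKropinaAt_kropinaFn (he : e ∈ IsManifold.maximalAtlas (𝓡 n) ∞ M) (α : Metric n M)
    {β : OneForm n M} (hβ : ∀ x, β x ≠ 0) {u : Coord n} (hu : u ∈ e.target) :
    IsKropinaAt (metricCoeff e α) (formCoeff e β) (inChart e (kropinaFn α β)) u where
  toIsMetricAt := isMetricAt_metricCoeff he α hu
  eq u w := by rw [← inChart_alphaFn, formCoeff_dotProduct]; rfl
  diff_form := differentiableAt_formCoeff he β hu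
  form_ne := formCoeff_ne_zero he hβ hu

theorem isPullbackAt_transition (he : e ∈ IsManifold.maximalAtlas (𝓡 n) ∞ M)
    (he₂ : e₂ ∈ IsManifold.maximalAtlas (𝓡 n) ∞ M) {u : Coord n} (hu : u ∈ e.target)
    (hu₂ : e.symm u ∈ e₂.source) (α : Metric n M) (β : OneForm n M) :
    IsPullbackAt (metricCoeff e α) (formCoeff e β) (metricCoeff e₂ α) (formCoeff e₂ β)
      (e₂ ∘ e.symm) u where
  metric := isMetricAt_metricCoeff he α hu
  metric' := isMetricAt_metricCoeff he₂ α (e₂.map_source hu₂)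
  form := differentiableAt_formCoeff he β hu
  form' := differentiableAt_formCoeff he₂ β (e₂.map_source hu₂)
  smooth := contDiffAt_transition he he₂ hu hu₂
  surj := surjective_fderiv_transition he he₂ hu hu₂
  metric_eq := by
    filter_upwards [eventually_transition hu hu₂] with w hw v v'
    rw [dotProduct_metricCoeff, dotProduct_metricCoeff]
    exact congr (congrArg₂ (fun (x : M) (y : Coord n) (z : Coord n) => α.inner x y z)
      (e₂.left_inv hw.2).symm (mfderiv_symm_transition he he₂ hw.1 hw.2 v))
      (mfderiv_symm_transition he he₂ hw.1 hw.2 v')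
  form_eq := by
    filter_upwards [eventually_transition hu hu₂] with w hw v
    rw [formCoeff_dotProduct, formCoeff_dotProduct]
    exact inChart_transition he he₂ hw.1 hw.2 _ v

end Chart

/-! ### Smooth dependence of the local tensors on the base point. -/

section Smoothness

variable {a : Coord n → Matrix (Fin n) (Fin n) ℝ} {b : Coord n → Fin n → ℝ} {Ω : Set (Coord n)}

theorem contDiffOn_det (ha : ∀ i j, ContDiffOn ℝ ∞ (fun u => a u i j) Ω) :
    ContDiffOn ℝ ∞ (fun u => (a u).det) Ω := by
  simp only [det_apply]
  exact ContDiffOn.sum fun σ _ => (contDiffOn_prod fun i _ => ha _ _).const_smul _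

theorem contDiffOn_inv (ha : ∀ i j, ContDiffOn ℝ ∞ (fun u => a u i j) Ω)
    (hdet : ∀ u ∈ Ω, IsUnit (a u).det) (i j : Fin n) :
    ContDiffOn ℝ ∞ (fun u => (a u)⁻¹ i j) Ω := by
  simp only [inv_def, Ring.inverse_eq_inv', Matrix.smul_apply, smul_eq_mul, adjugate_apply]
  refine ((contDiffOn_det ha).inv fun u hu => (hdet u hu).ne_zero).mul
    (contDiffOn_det fun k l => ?_)
  by_cases h : k = j
  · subst h; simpa using contDiffOn_const
  · simpa [updateRow_ne h] using ha k l

theorem contDiffOn_christoffel (hΩ : IsOpen Ω) (ha : ∀ i j, ContDiffOn ℝ ∞ (fun u => a u i j) Ω)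
    (hdet : ∀ u ∈ Ω, IsUnit (a u).det) (k i j : Fin n) :
    ContDiffOn ℝ ∞ (christoffel a k i j) Ω :=
  contDiffOn_const.mul (ContDiffOn.sum fun l _ => (contDiffOn_inv ha hdet k l).mul
    (((contDiffOn_pd hΩ (ha l j) i).add (contDiffOn_pd hΩ (ha l i) j)).sub
      (contDiffOn_pd hΩ (ha i j) l)))

theorem contDiffOn_covDeriv (hΩ : IsOpen Ω) (ha : ∀ i j, ContDiffOn ℝ ∞ (fun u => a u i j) Ω)
    (hdet : ∀ u ∈ Ω, IsUnit (a u).det) (hb : ∀ i, ContDiffOn ℝ ∞ (fun u => b u i) Ω)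
    (i j : Fin n) : ContDiffOn ℝ ∞ (covDeriv a b i j) Ω :=
  (contDiffOn_pd hΩ (hb i) j).sub (ContDiffOn.sum fun k _ =>
    (contDiffOn_christoffel hΩ ha hdet k i j).mul (hb k))

theorem contDiffOn_raise (ha : ∀ i j, ContDiffOn ℝ ∞ (fun u => a u i j) Ω)
    (hdet : ∀ u ∈ Ω, IsUnit (a u).det) (hb : ∀ i, ContDiffOn ℝ ∞ (fun u => b u i) Ω) (i : Fin n) :
    ContDiffOn ℝ ∞ (raise a b i) Ω :=
  ContDiffOn.sum fun j _ => (contDiffOn_inv ha hdet i j).mul (hb j)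

theorem contDiffOn_normSq (ha : ∀ i j, ContDiffOn ℝ ∞ (fun u => a u i j) Ω)
    (hdet : ∀ u ∈ Ω, IsUnit (a u).det) (hb : ∀ i, ContDiffOn ℝ ∞ (fun u => b u i) Ω) :
    ContDiffOn ℝ ∞ (normSq a b) Ω :=
  ContDiffOn.sum fun i _ => (contDiffOn_raise ha hdet hb i).mul (hb i)

theorem contDiffOn_rTensor (hΩ : IsOpen Ω) (ha : ∀ i j, ContDiffOn ℝ ∞ (fun u => a u i j) Ω)
    (hdet : ∀ u ∈ Ω, IsUnit (a u).det) (hb : ∀ i, ContDiffOn ℝ ∞ (fun u => b u i) Ω)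
    (i j : Fin n) : ContDiffOn ℝ ∞ (rTensor a b i j) Ω :=
  contDiffOn_const.mul ((contDiffOn_covDeriv hΩ ha hdet hb i j).add
    (contDiffOn_covDeriv hΩ ha hdet hb j i))

theorem contDiffOn_sTensor (hΩ : IsOpen Ω) (ha : ∀ i j, ContDiffOn ℝ ∞ (fun u => a u i j) Ω)
    (hdet : ∀ u ∈ Ω, IsUnit (a u).det) (hb : ∀ i, ContDiffOn ℝ ∞ (fun u => b u i) Ω)
    (i j : Fin n) : ContDiffOn ℝ ∞ (sTensor a b i j) Ω :=
  contDiffOn_const.mul ((contDiffOn_covDeriv hΩ ha hdet hb i j).sub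
    (contDiffOn_covDeriv hΩ ha hdet hb j i))

theorem contDiffOn_rZeroZero (hΩ : IsOpen Ω) (ha : ∀ i j, ContDiffOn ℝ ∞ (fun u => a u i j) Ω)
    (hdet : ∀ u ∈ Ω, IsUnit (a u).det) (hb : ∀ i, ContDiffOn ℝ ∞ (fun u => b u i) Ω)
    (v : Coord n) : ContDiffOn ℝ ∞ (fun u => rZeroZero a b u v) Ω :=
  ContDiffOn.sum fun i _ => ContDiffOn.sum fun j _ =>
    ((contDiffOn_rTensor hΩ ha hdet hb i j).mul contDiffOn_const).mul contDiffOn_const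

theorem contDiffOn_sCovector (hΩ : IsOpen Ω) (ha : ∀ i j, ContDiffOn ℝ ∞ (fun u => a u i j) Ω)
    (hdet : ∀ u ∈ Ω, IsUnit (a u).det) (hb : ∀ i, ContDiffOn ℝ ∞ (fun u => b u i) Ω)
    (j : Fin n) : ContDiffOn ℝ ∞ (fun u => sCovector a b u j) Ω :=
  ContDiffOn.sum fun i _ => (contDiffOn_raise ha hdet hb i).mul
    (contDiffOn_sTensor hΩ ha hdet hb i j)

theorem contDiffOn_relationMat {a' : Coord n → Matrix (Fin n) (Fin n) ℝ}
    {b' : Coord n → Fin n → ℝ} {τ : Coord n → ℝ} (hΩ : IsOpen Ω)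
    (ha : ∀ i j, ContDiffOn ℝ ∞ (fun u => a u i j) Ω)
    (hdet : ∀ u ∈ Ω, IsUnit (a u).det) (hb : ∀ i, ContDiffOn ℝ ∞ (fun u => b u i) Ω)
    (ha' : ∀ i j, ContDiffOn ℝ ∞ (fun u => a' u i j) Ω)
    (hdet' : ∀ u ∈ Ω, IsUnit (a' u).det) (hb' : ∀ i, ContDiffOn ℝ ∞ (fun u => b' u i) Ω)
    (hne : ∀ u ∈ Ω, normSq a' b' u ≠ 0) (hτ : ContDiffOn ℝ ∞ τ Ω) (i j k : Fin n) :
    ContDiffOn ℝ ∞ (fun u => relationMat a b a' b' (τ u) u i j k) Ω :=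
  (((contDiffOn_const.mul (contDiffOn_christoffel hΩ ha hdet i j k)).sub
    (contDiffOn_const.mul (contDiffOn_christoffel hΩ ha' hdet' i j k))).sub
    ((contDiffOn_const.div (contDiffOn_const.mul (contDiffOn_normSq ha' hdet' hb'))
      fun u hu => mul_ne_zero two_ne_zero (hne u hu)).mul
      (((contDiffOn_raise ha' hdet' (contDiffOn_sCovector hΩ ha' hdet' hb') i).mul (ha' j k)).add
        ((contDiffOn_raise ha' hdet' hb' i).mul (contDiffOn_rTensor hΩ ha' hdet' hb' j k))))).add
    (((contDiffOn_const.mul hτ).mul (contDiffOn_raise ha hdet hb i)).mul (ha j k))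

end Smoothness

/-! ### Invariance of the Kropina factor and of τ. -/

section Pullback

variable {a a' : Coord n → Matrix (Fin n) (Fin n) ℝ} {b b' : Coord n → Fin n → ℝ}
  {φ : Coord n → Coord n} {x : Coord n}

theorem IsPullbackAt.kropinaFactor_eq (h : IsPullbackAt a b a' b' φ x) (v : Coord n) :
    kropinaFactor a b x v = kropinaFactor a' b' (φ x) (fderiv ℝ φ x v) := by
  rw [kropinaFactor, kropinaFactor, h.normSq_eq, h.sCovector_eq, h.rZeroZero_eq,
    h.form_eq.self_of_nhds, h.metric_eq.self_of_nhds]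

/-- In r_00 = 2τΔ both r_00 and Δ are invariant and Δ > 0 at a nonzero vector, so τ is determined.
The vector used, with components b_i, is just a convenient nonzero one. -/
theorem IsPullbackAt.covDeriv_factor_unique (h : IsPullbackAt a b a' b' φ x) (hb : b x ≠ 0)
    (hlt : ∀ v : Fin n → ℝ, v ≠ 0 → (b x ⬝ᵥ v) ^ 2 < v ⬝ᵥ a x *ᵥ v) {τ τ' : ℝ}
    (hτ : ∀ i j, covDeriv a b i j x
      = 2 * τ * ((1 + 2 * normSq a b x) * a x i j - 3 * b x i * b x j))
    (hτ' : ∀ i j, covDeriv a' b' i j (φ x)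
      = 2 * τ' * ((1 + 2 * normSq a' b' (φ x)) * a' (φ x) i j - 3 * b' (φ x) i * b' (φ x) j)) :
    τ = τ' := by
  have h1 := ((sMat_eq_zero_and_rZeroZero_iff (h.metric.symm x)).1 hτ).2 (b x)
  have h2 := ((sMat_eq_zero_and_rZeroZero_iff (h.metric'.symm _)).1 hτ').2
    (fderiv ℝ φ x (WithLp.toLp 2 (b x))).ofLp
  have h3 := h.rZeroZero_eq (WithLp.toLp 2 (b x))
  have hpos := delta_pos (h.metric.symm x) h.metric.pos hb hlt hb
  rw [ProjFinsler.rZeroZero_eq, ProjFinsler.rZeroZero_eq, h2, ← h.normSq_eq,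
    ← h.metric_eq.self_of_nhds,
    ← h.form_eq.self_of_nhds] at h3
  rw [← ProjFinsler.normSq_eq] at hpos
  have h4 := h1.symm.trans h3
  exact mul_left_cancel₀ two_ne_zero (mul_right_cancel₀ hpos.ne' h4)

end Pullback

/-! ### Global functions and one-forms from compatible local expressions. -/

section Gluing

variable {M : Type*} [TopologicalSpace M] [ChartedSpace (Coord n) M] [IsManifold (𝓡 n) ∞ M]

/-- Local expressions that agree on chart overlaps define a function of tangent vectors. -/
theorem exists_inChart_eq {k : OpenPartialHomeomorph M (Coord n) → Coord n → Coord n → ℝ}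
    (hk : ∀ e ∈ IsManifold.maximalAtlas (𝓡 n) ∞ M, ∀ e₂ ∈ IsManifold.maximalAtlas (𝓡 n) ∞ M,
      ∀ u ∈ e.target, e.symm u ∈ e₂.source → ∀ v : Coord n,
        k e u v = k e₂ (e₂ (e.symm u)) (fderiv ℝ (e₂ ∘ e.symm) u v)) :
    ∃ K : ∀ x : M, TangentSpace (𝓡 n) x → ℝ, ∀ e ∈ IsManifold.maximalAtlas (𝓡 n) ∞ M,
      ∀ u ∈ e.target, ∀ v : Coord n, inChart e K u v = k e u v := by
  -- Evaluate in the preferred chart at each point; the compatibility hypothesis carries the value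
  -- to any other chart.
  refine ⟨fun x y => k (chartAt (Coord n) x) (chartAt (Coord n) x x)
    (mfderiv (𝓡 n) (𝓡 n) (chartAt (Coord n) x) x y), fun e he u hu v => ?_⟩
  set x := e.symm u with hx
  have he₂ := IsManifold.chart_mem_maximalAtlas (I := 𝓡 n) (n := ∞) x
  have hx₂ := mem_chart_source (Coord n) x
  rw [hk e he _ he₂ u hu hx₂ v]
  have h1 := (mdifferentiable_of_mem he₂).comp_symm_deriv ((chartAt (Coord n) x).map_source hx₂)
  have h2 := mfderiv_symm_transition he he₂ hu hx₂ v
  have h3 := congrArg (fun L : Coord n →L[ℝ] Coord n =>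
    L (fderiv ℝ (chartAt (Coord n) x ∘ e.symm) u v)) h1
  exact congrArg (k (chartAt (Coord n) x) (chartAt (Coord n) x x))
    ((congrArg₂ (fun (z : M) (y : Coord n) =>
      (show Coord n from mfderiv (𝓡 n) (𝓡 n) (chartAt (Coord n) x) z y))
        ((chartAt (Coord n) x).left_inv hx₂).symm h2).trans h3)

theorem contMDiff_of_comp_symm {f : M → ℝ}
    (h : ∀ e ∈ IsManifold.maximalAtlas (𝓡 n) ∞ M, ContDiffOn ℝ ∞ (fun u => f (e.symm u)) e.target) :
    ContMDiff (𝓡 n) 𝓘(ℝ, ℝ) ∞ f := fun x => by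
  have he := IsManifold.chart_mem_maximalAtlas (I := 𝓡 n) (n := ∞) x
  have hx := mem_chart_source (Coord n) x
  have h1 := ((h _ he).contDiffAt ((chartAt (Coord n) x).open_target.mem_nhds
    ((chartAt (Coord n) x).map_source hx))).contMDiffAt.comp x
      (contMDiffAt_of_mem_maximalAtlas he hx)
  refine h1.congr_of_eventuallyEq ?_
  filter_upwards [(chartAt (Coord n) x).open_source.mem_nhds hx] with y hy
  simp [(chartAt (Coord n) x).left_inv hy]

/-- Smooth components that agree on chart overlaps define a smooth one-form. -/
theorem exists_oneForm {c : OpenPartialHomeomorph M (Coord n) → Coord n → Fin n → ℝ}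
    (hc : ∀ e ∈ IsManifold.maximalAtlas (𝓡 n) ∞ M, ∀ e₂ ∈ IsManifold.maximalAtlas (𝓡 n) ∞ M,
      ∀ u ∈ e.target, e.symm u ∈ e₂.source → ∀ v : Coord n,
        c e u ⬝ᵥ v.ofLp = c e₂ (e₂ (e.symm u)) ⬝ᵥ (fderiv ℝ (e₂ ∘ e.symm) u v).ofLp)
    (hs : ∀ e ∈ IsManifold.maximalAtlas (𝓡 n) ∞ M, ∀ i,
      ContDiffOn ℝ ∞ (fun u => c e u i) e.target) :
    ∃ θ : OneForm n M, ∀ e ∈ IsManifold.maximalAtlas (𝓡 n) ∞ M,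
      ∀ u ∈ e.target, ∀ v : Coord n, inChart e (formFn θ) u v = c e u ⬝ᵥ v.ofLp := by
  obtain ⟨K, hK⟩ := exists_inChart_eq (k := fun e u v => c e u ⬝ᵥ v.ofLp) hc
  have hlin : ∀ e ∈ IsManifold.maximalAtlas (𝓡 n) ∞ M, ∀ u ∈ e.target,
      ∃ L : TangentSpace (𝓡 n) (e.symm u) →L[ℝ] ℝ, ∀ y, L y = K (e.symm u) y := fun e he u hu => by
    refine ⟨(show TangentSpace (𝓡 n) (e (e.symm u)) →L[ℝ] ℝ from
      (∑ i, c e u i • (EuclideanSpace.proj i : Coord n →L[ℝ] ℝ))).comp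
        (mfderiv (𝓡 n) (𝓡 n) e (e.symm u)), fun y => ?_⟩
    obtain ⟨v, rfl⟩ := (mfderiv_symm_bijective he hu).2 y
    refine Eq.trans ?_ (hK e he u hu v).symm
    have h1 := congrArg (fun L : Coord n →L[ℝ] Coord n => L v)
      ((mdifferentiable_of_mem he).comp_symm_deriv hu)
    refine (congrArg (fun w : Coord n =>
      (∑ i, c e u i • (EuclideanSpace.proj i : Coord n →L[ℝ] ℝ)) w) h1).trans ?_
    simp [dotProduct]
    rfl
  have hlin' : ∀ x : M, ∃ L : TangentSpace (𝓡 n) x →L[ℝ] ℝ, ∀ y, L y = K x y := fun x => by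
    have hx := mem_chart_source (Coord n) x
    have h1 := hlin _ (IsManifold.chart_mem_maximalAtlas (I := 𝓡 n) (n := ∞) x) _
      ((chartAt (Coord n) x).map_source hx)
    rwa [(chartAt (Coord n) x).left_inv hx] at h1
  choose θ hθ using hlin'
  have hθK : ∀ e ∈ IsManifold.maximalAtlas (𝓡 n) ∞ M, ∀ u ∈ e.target, ∀ v : Coord n,
      θ (e.symm u) (mfderiv (𝓡 n) (𝓡 n) e.symm u v) = c e u ⬝ᵥ v.ofLp :=
    fun e he u hu v => (hθ _ _).trans (hK e he u hu v)
  refine ⟨⟨θ, fun x₀ => ?_⟩, hθK⟩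
  rw [contMDiffAt_hom_bundle]
  refine ⟨contMDiffAt_id, ?_⟩
  set e := chartAt (Coord n) x₀ with he_def
  have he : e ∈ IsManifold.maximalAtlas (𝓡 n) ∞ M := IsManifold.chart_mem_maximalAtlas x₀
  have hx : x₀ ∈ e.source := mem_chart_source (Coord n) x₀
  have h1 : ContDiffOn ℝ ∞ (fun u => ∑ i, c e u i • (EuclideanSpace.proj i : Coord n →L[ℝ] ℝ))
      e.target := ContDiffOn.sum fun i _ => (hs e he i).smul contDiffOn_const
  have h2 := (h1.contDiffAt (e.open_target.mem_nhds (e.map_source hx))).contMDiffAt.comp x₀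
      (contMDiffAt_of_mem_maximalAtlas he hx)
  refine h2.congr_of_eventuallyEq ?_
  filter_upwards [e.open_source.mem_nhds hx] with x hxe
  ext v
  -- The inverse trivialization of the tangent bundle is the derivative of e.symm, so in the
  -- trivialization θ is ∑ c_i dx^i, with smooth coefficients.
  have hsymm : (trivializationAt (Coord n) (TangentSpace (𝓡 n)) x₀).symmL ℝ x
      = mfderiv (𝓡 n) (𝓡 n) e.symm (e x) := by
    rw [TangentBundle.symmL_trivializationAt hxe]
    simp [mfderivWithin_univ, extChartAt]
    rfl
  have h3 := hθK e he (e x) (e.map_source hxe) v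
  have h4 : θ x (mfderiv (𝓡 n) (𝓡 n) e.symm (e x) v) = c e (e x) ⬝ᵥ v.ofLp :=
    (congrArg (fun z => (show Coord n → ℝ from θ z)
      (show Coord n from mfderiv (𝓡 n) (𝓡 n) e.symm (e x) v)) (e.left_inv hxe)).symm.trans h3
  simp [ContinuousLinearMap.inCoordinates, hsymm]

  exact h4

end Gluing

/-- Adding a large multiple of one half-space vector brings any v into the half-space, and linearity
removes the added part. Needed because θ is controlled only where β̄ > 0. -/
theorem eq_of_eq_on_halfSpace {b : Fin n → ℝ} (hb : b ≠ 0) {f g : Coord n → ℝ}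
    (hf : IsLinearMap ℝ f) (hg : IsLinearMap ℝ g)
    (h : ∀ v : Coord n, 0 < b ⬝ᵥ v.ofLp → f v = g v) (v : Coord n) : f v = g v := by
  obtain ⟨w, hw⟩ := halfSpace_nonempty hb
  have hw' : 0 < b ⬝ᵥ w.ofLp := hw
  have h1 := h (v + ((1 + |b ⬝ᵥ v.ofLp|) / (b ⬝ᵥ w.ofLp)) • w) (by
    rw [WithLp.ofLp_add, WithLp.ofLp_smul, dotProduct_add, dotProduct_smul, smul_eq_mul,
      div_mul_cancel₀ _ hw'.ne']
    linarith [neg_abs_le (b ⬝ᵥ v.ofLp)])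
  rw [hf.map_add, hg.map_add, hf.map_smul, hg.map_smul, h w hw] at h1
  exact add_right_cancel h1

theorem isLinearMap_dotProduct_comp (c : Fin n → ℝ) (L : Coord n →L[ℝ] Coord n) :
    IsLinearMap ℝ fun v : Coord n => c ⬝ᵥ (L v).ofLp :=
  ⟨fun v w => by simp [dotProduct_add], fun t v => by simp [dotProduct_smul]⟩

/-! ### Global statements (a) and (b). -/

section Main

variable {M : Type*} [TopologicalSpace M] [ChartedSpace (Coord n) M] [IsManifold (𝓡 n) ∞ M]
  {e : OpenPartialHomeomorph M (Coord n)} {α α' : Metric n M} {β β' : OneForm n M}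

theorem isUnit_det_metricCoeff (he : e ∈ IsManifold.maximalAtlas (𝓡 n) ∞ M) (α : Metric n M)
    {u : Coord n} (hu : u ∈ e.target) : IsUnit (metricCoeff e α u).det :=
  isUnit_det_of_pos (isMetricAt_metricCoeff he α hu).pos

theorem inChart_alphaFn_sq (he : e ∈ IsManifold.maximalAtlas (𝓡 n) ∞ M) (α : Metric n M)
    {u : Coord n} (hu : u ∈ e.target) (v : Coord n) :
    inChart e (alphaFn α) u v ^ 2 = v.ofLp ⬝ᵥ metricCoeff e α u *ᵥ v.ofLp := by
  rw [inChart_alphaFn, Real.sq_sqrt ((isMetricAt_metricCoeff he α hu).nonneg _ _)]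

theorem sprayCoeff_alphaFn (he : e ∈ IsManifold.maximalAtlas (𝓡 n) ∞ M) (α : Metric n M)
    {u : Coord n} (hu : u ∈ e.target) (v : Coord n) (i : Fin n) :
    sprayCoeff (inChart e (alphaFn α)) i u v = alphaSpray (metricCoeff e α) u v i :=
  sprayCoeff_alpha (isMetricAt_metricCoeff he α hu).symm (isMetricAt_metricCoeff he α hu).nonneg
    (isUnit_det_metricCoeff he α hu) (isMetricAt_metricCoeff he α hu).diff
    (fun u w => inChart_alphaFn α u w) v i

theorem mfderiv_symm_mem_kropinaDomain {u v : Coord n} :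
    mfderiv (𝓡 n) (𝓡 n) e.symm u v ∈ kropinaDomain β (e.symm u)
      ↔ 0 < formCoeff e β u ⬝ᵥ v.ofLp := by
  rw [formCoeff_dotProduct]; rfl

/-- Pointwise factors of the covariant derivative identity form a smooth function. -/
theorem exists_covDerivIdentity (hn : 0 < n) (hβ : ∀ x, β x ≠ 0)
    (hαβ : ∀ (x : M) (y : TangentSpace (𝓡 n) x), y ≠ 0 → |formFn β x y| < alphaFn α x y)
    (h : ∀ e ∈ IsManifold.maximalAtlas (𝓡 n) ∞ M, ∀ u ∈ e.target, ∃ t : ℝ, ∀ i j,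
      covDeriv (metricCoeff e α) (formCoeff e β) i j u
        = 2 * t * ((1 + 2 * normSq (metricCoeff e α) (formCoeff e β) u) * metricCoeff e α u i j
          - 3 * formCoeff e β u i * formCoeff e β u j)) :
    ∃ τ : M → ℝ, ContMDiff (𝓡 n) 𝓘(ℝ, ℝ) ∞ τ ∧ CovDerivIdentity α β τ := by
  choose! t ht using h
  -- The factor is glued as a function of tangent vectors constant in the fibre; τ is then read off
  -- at the zero vector.
  obtain ⟨K, hK⟩ := exists_inChart_eq (k := fun e u _ => t e u) fun e he e₂ he₂ u hu hu₂ _ =>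
    (isPullbackAt_transition he he₂ hu hu₂ α β).covDeriv_factor_unique
      (formCoeff_ne_zero he hβ hu) (isBerwaldAt_berwaldFn he hβ hαβ hu).lt
      (ht e he u hu) (ht e₂ he₂ _ (e₂.map_source hu₂))
  have hτ : ∀ e ∈ IsManifold.maximalAtlas (𝓡 n) ∞ M, ∀ u ∈ e.target,
      K (e.symm u) 0 = t e u := fun e he u hu => by
    rw [← hK e he u hu 0]
    exact congrArg (K (e.symm u)) (map_zero (mfderiv (𝓡 n) (𝓡 n) e.symm u)).symm
  refine ⟨fun x => K x 0, contMDiff_of_comp_symm fun e he => ?_, fun e he u hu => ?_⟩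
  -- A fixed nonzero coordinate vector gives τ = r_00/(2Δ) on the chart, a quotient of smooth
  -- functions with nonvanishing denominator.
  · set v : Coord n := EuclideanSpace.single ⟨0, hn⟩ 1 with hv_def
    have hv : v.ofLp ≠ 0 := fun h => by
      have := congrFun h ⟨0, hn⟩
      simp [hv_def] at this
    have ha := contDiffOn_metricCoeff he α
    have hb := contDiffOn_formCoeff he β
    have hdet := fun u (hu : u ∈ e.target) => isUnit_det_metricCoeff he α hu
    have hA : ContDiffOn ℝ ∞ (fun u => v.ofLp ⬝ᵥ metricCoeff e α u *ᵥ v.ofLp) e.target := by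
      simp only [dotProduct, mulVec]
      exact ContDiffOn.sum fun i _ => contDiffOn_const.mul
        (ContDiffOn.sum fun j _ => (ha i j).mul contDiffOn_const)
    have hB : ContDiffOn ℝ ∞ (fun u => formCoeff e β u ⬝ᵥ v.ofLp) e.target :=
      ContDiffOn.sum fun i _ => (hb i).mul contDiffOn_const
    have hpos : ∀ u ∈ e.target, 0 < (1 + 2 * normSq (metricCoeff e α) (formCoeff e β) u)
        * (v.ofLp ⬝ᵥ metricCoeff e α u *ᵥ v.ofLp) - 3 * (formCoeff e β u ⬝ᵥ v.ofLp) ^ 2 :=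
      fun u hu => by
        have h := isBerwaldAt_berwaldFn he hβ hαβ hu
        rw [normSq_eq]
        exact delta_pos (h.symm u) h.pos h.form_ne h.lt hv
    refine ((contDiffOn_rZeroZero e.open_target ha hdet hb v).div
      (contDiffOn_const.mul (((contDiffOn_const.add (contDiffOn_const.mul
        (contDiffOn_normSq ha hdet hb))).mul hA).sub (contDiffOn_const.mul (hB.pow 2))))
        fun u hu => mul_ne_zero two_ne_zero (hpos u hu).ne').congr fun u hu => ?_
    have h1 := ((sMat_eq_zero_and_rZeroZero_iff
      ((isMetricAt_metricCoeff he α hu).symm u)).1 (ht e he u hu)).2 v.ofLp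
    rw [← rZeroZero_eq] at h1
    rw [hτ e he u hu, Pi.div_apply, eq_div_iff (mul_ne_zero two_ne_zero (hpos u hu).ne'), h1]
    ring
  · simp only [hτ e he u hu]
    exact ht e he u hu

theorem isDouglas_berwaldFn_iff (hn : 2 ≤ n) (hβ : ∀ x, β x ≠ 0)
    (hαβ : ∀ (x : M) (y : TangentSpace (𝓡 n) x), y ≠ 0 → |formFn β x y| < alphaFn α x y) :
    IsDouglas (berwaldFn α β) nonzeroVec ↔
      ∃ τ : M → ℝ, ContMDiff (𝓡 n) 𝓘(ℝ, ℝ) ∞ τ ∧ CovDerivIdentity α β τ := by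
  constructor
  · exact fun h => exists_covDerivIdentity (by omega) hβ hαβ fun e he u hu =>
      exists_covDeriv_eq_of_douglas hn (isBerwaldAt_berwaldFn he hβ hαβ hu) fun v hv =>
        h e he u hu v (mfderiv_symm_ne_zero he hu hv)
  · rintro ⟨τ, -, hτ⟩ e he u hu v hv
    refine douglasTensor_berwald_eq_zero (isBerwaldAt_berwaldFn he hβ hαβ hu) (hτ e he u hu)
      fun h0 => hv ?_
    have h1 : v = 0 := (WithLp.ofLp_injective 2) h0
    rw [h1]
    exact map_zero _

theorem isDouglas_kropinaFn_iff (hβ' : ∀ x, β' x ≠ 0) :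
    IsDouglas (kropinaFn α' β') (kropinaDomain β') ↔
      ∀ e ∈ IsManifold.maximalAtlas (𝓡 n) ∞ M, ∀ u ∈ e.target,
        KropinaCond (metricCoeff e α') (formCoeff e β') u :=
  ⟨fun h e he u hu => kropinaCond_of_douglas (isKropinaAt_kropinaFn he α' hβ' hu) fun v hv =>
      h e he u hu v (mfderiv_symm_mem_kropinaDomain.2 hv),
    fun h e he u hu _ hv => douglasTensor_kropina_eq_zero (isKropinaAt_kropinaFn he α' hβ' hu)
      (h e he u hu) (mfderiv_symm_mem_kropinaDomain.1 hv)⟩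

/-- Moves all terms but θy^i to one side, so that the relation matches `quadratic_eq_linear_mul`. -/
theorem sprayRelation_iff {τ : M → ℝ} {θ : OneForm n M} : SprayRelation α β α' β' τ θ ↔
    ∀ e ∈ IsManifold.maximalAtlas (𝓡 n) ∞ M, ∀ u ∈ e.target, ∀ (v : Coord n) (i : Fin n),
      v.ofLp ⬝ᵥ relationMat (metricCoeff e α) (formCoeff e β) (metricCoeff e α')
        (formCoeff e β') (τ (e.symm u)) u i *ᵥ v.ofLp = inChart e (formFn θ) u v * v i := by
  refine forall₄_congr fun e he u hu => forall₂_congr fun v i => ?_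
  rw [sprayCoeff_alphaFn he α hu, sprayCoeff_alphaFn he α' hu, inChart_alphaFn_sq he α hu,
    inChart_alphaFn_sq he α' hu, relationMat_apply]
  constructor <;> intro h <;> linarith

theorem projectivelyRelated_iff (hn : 2 ≤ n) (hβ : ∀ x, β x ≠ 0) (hβ' : ∀ x, β' x ≠ 0)
    (hαβ : ∀ (x : M) (y : TangentSpace (𝓡 n) x), y ≠ 0 → |formFn β x y| < alphaFn α x y) :
    ProjectivelyRelated (berwaldFn α β) nonzeroVec (kropinaFn α' β') (kropinaDomain β') ↔
      IsDouglas (berwaldFn α β) nonzeroVec ∧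
      IsDouglas (kropinaFn α' β') (kropinaDomain β') ∧
      ∃ (τ : M → ℝ) (θ : OneForm n M), ContMDiff (𝓡 n) 𝓘(ℝ, ℝ) ∞ τ ∧
        CovDerivIdentity α β τ ∧ SprayRelation α β α' β' τ θ := by
  rw [isDouglas_berwaldFn_iff hn hβ hαβ, isDouglas_kropinaFn_iff hβ']
  constructor
  · rintro ⟨P, hP⟩
    have hrel : ∀ e ∈ IsManifold.maximalAtlas (𝓡 n) ∞ M, ∀ u ∈ e.target, ∀ v : Coord n,
        0 < formCoeff e β' u ⬝ᵥ v.ofLp → ∀ i, sprayCoeff (inChart e (berwaldFn α β)) i u v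
          = sprayCoeff (inChart e (kropinaFn α' β')) i u v + inChart e P u v * v i :=
      fun e he u hu v hv => hP e he u hu v
        ⟨mfderiv_symm_ne_zero he hu (ne_zero_of_mem_halfSpace hv),
          mfderiv_symm_mem_kropinaDomain.2 hv⟩
    obtain ⟨τ, hτs, hτ⟩ := exists_covDerivIdentity (by omega) hβ hαβ fun e he u hu =>
      exists_covDeriv_eq_of_projectivelyRelated hn (isBerwaldAt_berwaldFn he hβ hαβ hu)
        (isKropinaAt_kropinaFn he α' hβ' hu) (hrel e he u hu)
    refine ⟨⟨τ, hτs, hτ⟩, fun e he u hu => kropinaCond_of_projectivelyRelated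
      (isBerwaldAt_berwaldFn he hβ hαβ hu) (isKropinaAt_kropinaFn he α' hβ' hu)
        (hrel e he u hu), ?_⟩
    -- The components Q^k_kk of θ are explicit in the local data, hence smooth; compatibility is
    -- checked on the half-space only.
    have hθ := exists_oneForm (M := M) (c := fun e u k => relationMat (metricCoeff e α)
      (formCoeff e β) (metricCoeff e α') (formCoeff e β') (τ (e.symm u)) u k k k)
      (fun e he e₂ he₂ u hu hu₂ => eq_of_eq_on_halfSpace (formCoeff_ne_zero he hβ' hu)
        (isLinearMap_dotProduct_comp _ (ContinuousLinearMap.id ℝ _))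
        (isLinearMap_dotProduct_comp _ _) fun v hv => ?_)
      fun e he k => contDiffOn_relationMat e.open_target (contDiffOn_metricCoeff he α)
        (fun u hu => isUnit_det_metricCoeff he α hu) (contDiffOn_formCoeff he β)
        (contDiffOn_metricCoeff he α') (fun u hu => isUnit_det_metricCoeff he α' hu)
        (contDiffOn_formCoeff he β') (fun u hu => ?_)
        (contMDiffOn_iff_contDiffOn.1 (hτs.comp_contMDiffOn
          (contMDiffOn_symm_of_mem_maximalAtlas he))) k k k
    · obtain ⟨θ, hθ⟩ := hθ
      refine ⟨τ, θ, hτs, hτ, sprayRelation_iff.2 fun e he u hu v i => ?_⟩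
      rw [hθ e he u hu]
      exact relationMat_eq_of_projectivelyRelated (isBerwaldAt_berwaldFn he hβ hαβ hu)
        (isKropinaAt_kropinaFn he α' hβ' hu) (hrel e he u hu) (hτ e he u hu) v i
    · have hu' := e₂.map_source hu₂
      have h1 := isPullbackAt_transition he he₂ hu hu₂ α β
      have h2 := isPullbackAt_transition he he₂ hu hu₂ α' β'
      have hv₂ := hv
      rw [h2.form_eq.self_of_nhds] at hv₂
      have h3 := linear_eq_of_projectivelyRelated (isBerwaldAt_berwaldFn he hβ hαβ hu)
        (isKropinaAt_kropinaFn he α' hβ' hu) (hrel e he u hu) (hτ e he u hu) hv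
      have h4 := linear_eq_of_projectivelyRelated (isBerwaldAt_berwaldFn he₂ hβ hαβ hu')
        (isKropinaAt_kropinaFn he₂ α' hβ' hu') (hrel e₂ he₂ _ hu') (hτ e₂ he₂ _ hu') hv₂
      refine h3.trans (Eq.trans ?_ h4.symm)
      rw [h2.kropinaFactor_eq, h1.metric_eq.self_of_nhds, h1.form_eq.self_of_nhds,
        inChart_transition he he₂ hu hu₂ P, e₂.left_inv hu₂]
      rfl
    · exact (normSq_pos (isMetricAt_metricCoeff he α' hu).pos
        (formCoeff_ne_zero he hβ' hu)).ne'
  · rintro ⟨-, hc, τ, θ, -, hτ, hθ⟩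
    rw [sprayRelation_iff] at hθ
    obtain ⟨K, hK⟩ := exists_inChart_eq (M := M)
      (k := fun e => kropinaFactor (metricCoeff e α') (formCoeff e β'))
      fun e he e₂ he₂ u hu hu₂ v =>
        (isPullbackAt_transition he he₂ hu hu₂ α' β').kropinaFactor_eq v
    -- The projective factor is forced by `sprayCoeff_sub_eq`: θ plus the y-coefficient of F minus
    -- the Kropina factor, here glued to the global function K.
    refine ⟨fun x y => formFn θ x y
      + (2 * τ x * (alphaFn α x y - 2 * formFn β x y) - K x y), fun e he u hu v hv i => ?_⟩
    have h1 := sprayCoeff_sub_eq (isBerwaldAt_berwaldFn he hβ hαβ hu)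
      (isKropinaAt_kropinaFn he α' hβ' hu) (hc e he u hu) (hτ e he u hu)
      (mfderiv_symm_mem_kropinaDomain.1 hv.2) i
    rw [hθ e he u hu, ← hK e he u hu, ← inChart_alphaFn, formCoeff_dotProduct,
      sub_eq_iff_eq_add'] at h1
    rw [h1, ← add_mul]
    rfl

end Main

end

end ProjFinsler

theorem mainTheorem4 {n : ℕ} (hn : 3 ≤ n) {M : Type*} [TopologicalSpace M]
    [ChartedSpace (EuclideanSpace ℝ (Fin n)) M] [IsManifold (𝓡 n) ∞ M]
    (α α' : Metric n M) (β β' : OneForm n M)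
    (hαβ : ∀ (x : M) (y : TangentSpace (𝓡 n) x), y ≠ 0 → |formFn β x y| < alphaFn α x y)
    (hβ : ∀ x : M, β x ≠ 0) (hβ' : ∀ x : M, β' x ≠ 0)
    (hcol : ∀ x : M, ∃ c : ℝ, β x = c • β' x) :
    (IsDouglas (berwaldFn α β) nonzeroVec ↔
      ∃ τ : M → ℝ, ContMDiff (𝓡 n) 𝓘(ℝ, ℝ) ∞ τ ∧ CovDerivIdentity α β τ) ∧
    (ProjectivelyRelated (berwaldFn α β) nonzeroVec (kropinaFn α' β') (kropinaDomain β') ↔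
      IsDouglas (berwaldFn α β) nonzeroVec ∧
      IsDouglas (kropinaFn α' β') (kropinaDomain β') ∧
      ∃ (τ : M → ℝ) (θ : OneForm n M), ContMDiff (𝓡 n) 𝓘(ℝ, ℝ) ∞ τ ∧
        CovDerivIdentity α β τ ∧ SprayRelation α β α' β' τ θ) :=
  ⟨isDouglas_berwaldFn_iff (by omega) hβ hαβ,
    projectivelyRelated_iff (by omega) hβ hβ' hαβ⟩
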